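/- **Setting.** Let $m=m_n\to\infty$ and $0\le k=k_n\le m$ be integers (the index $n$ is suppressed below; every limit is as $n\to\infty$). Let $\Sigma$ be an $m\times m$ correlation matrix with spectral decomposition $\Sigma=\sum_{j=1}^m\lambda_j\gamma_j\gamma_j^T$, $\lambda_1\ge\dots\ge\lambda_m$, with orthonormal $\gamma_j$. Let $b_i\in\mathbb R^k$ be the $i$-th row of $L=(\sqrt{\lambda_1}\gamma_1,\dots,\sqrt{\lambda_k}\gamma_k)$ and $A=\sum_{j>k}\lambda_j\gamma_j\gamma_j^T$. Assume $A_{ii}=1-\|b_i\|_2^2>0$ for all $i$, and put $a_i=(1-\|b_i\|_2^2)^{-1/2}$, $a_{\min}=\min_i a_i$, $a_{\max}=\max_i a_i$. Let $\tilde\Sigma$ be the correlation matrix obtained from the covariance matrix $A$. The observed vector is $X=\mu+LW+K$ with independent $W\sim N(0,I_k)$ and $K\sim N(0,A)$, so that $X\sim N(\mu,\Sigma)$. The mean is $\mu_i=\sqrt{2h\log m}$ for $i\in I_1$ and $\mu_i=0$ for $i\notin I_1$, with a constant $h>0$. The proportion $\pi=|I_1|/m$ and the dependence are calibrated by $$\pi=m^{-\gamma},\qquad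 m^{-2}\sum_{i,j}|\tilde\Sigma_{ij}|=m^{-\tilde\eta},\qquad \gamma=\gamma_n\in(0,1),\quad \tilde\eta=\tilde\eta_n\in[0,1]$$ (constants $\gamma,\tilde\eta$ being a special case). Let $I'$ be a (possibly random) set of selected indices on which the null factor model $X_i=b_i^TW+K_i$ is correct: almost surely $\mu_i=0$ for all $i\in I'$, and $I'$ is independent of $(W,K)$. Assume that for a constant $\kappa>0$ and all large $n$, $|I'|\ge\kappa m$ almost surely. Let $\hat w$ be any measurable minimiser of $\beta\mapsto\sum_{i\in I'}|X_i-b_i^T\beta|$ over $\mathbb R^k$, and $\hat z_i=a_i(X_i-b_i^T\hat w)$. Write $x_+=\max(x,0)$, $\bar\Phi(t)=P(N(0,1)>t)$ and $\mathbb T'=\big[\sqrt{2[\gamma-(\tilde\eta-\gamma)_+]_+\log m},\sqrt{5\log m}\big]\cap\mathbb N$. For $\theta\in\{\tfrac12,1\}$ let $$V_\theta=\max_{t\in\mathbb T'}\frac{\big|m^{-1}\sum_{i}1\{z_i^0>t\}-\bar\Phi(t)\big|}{\bar\Phi(t)^\theta},\quad z^0\sim N(0,\tilde\Sigma),\qquad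 \hat\pi^*_{\theta}=\max_{t\in\mathbb T'}\frac{m^{-1}\sum_{i}1\{\hat z_i>t\}-\bar\Phi(t)-c_\theta\bar\Phi(t)^\theta}{1-\bar\Phi(t)},$$ where $c_\theta=c_{\theta,n}$ is a bounding sequence, and let $\hat\pi_A^*(\hat z)=\max\{\hat\pi^*_{1/2},\hat\pi^*_{1}\}$. (The maximum over an empty set is taken to be $0$; $\mathbb T'$ is non-empty for all large $n$ under the conditions below.) Call $c_\theta$ *bounding at level* $\alpha$ if $P(V_\theta>c_\theta)<\alpha/2$. **Conditions.** (C1″) For a constant $C>0$ and all large $n$, $C\sqrt{m^{1-\tilde\eta}}\le a_{\min}\sqrt k$; and $a_{\max}\sqrt k=o\big(\sqrt{m^{1-2(\tilde\eta-\gamma)_+}/\log m}\big)$. (C2) For a constant $d>0$, $\displaystyle\lim_{n\to\infty}\ \sup_{\|u\|_2=1}m^{-1}\sum_{i=1}^m 1\{|b_i^Tu|\le d\}=0$. **Theorem 4.2.** Assume (C1″) and (C2). 1. *(Asymptotic lower bound.)* Let $\alpha>0$, and let $c_{1/2},c_1$ be bounding at level $\alpha$ for all large $n$. Then for every constant $\delta>0$,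 $$P\big(\hat\pi^*_A(\hat z)<\pi(1+\delta)\big)\ge 1-\alpha+o(1).$$ 2. *(Existence of the constants.)* For every $\alpha>0$ there are constants $C'_{1,\alpha},C'_{1/2,\alpha}>0$, depending on $\alpha$ only, such that $c_1=C'_{1,\alpha}\sqrt{\log m}$ and $c_{1/2}=C'_{1/2,\alpha}\sqrt{m^{-\tilde\eta}\log m}$ are bounding at level $\alpha$ for all $m\ge2$ and all $\tilde\Sigma$ as above (whether or not (C1″) and (C2) hold). 3. *(Consistency.)* Let $\alpha=\alpha_n\to0$, and let $c_1=C_{1}\sqrt{\log m}$ and $c_{1/2}=C_{1/2}\sqrt{m^{-\tilde\eta}\log m}$ be bounding at level $\alpha_n$ for all large $n$, where the positive factors $C_1,C_{1/2}$ are constants, or more generally may vary with $n$ (through $\alpha_n$) as long as they are bounded away from $0$ and are eventually at most $m^{\kappa'}$ for each $\kappa'>0$. If, for some constant $\rho>0$ and all large $n$, $$a_{\min}^2\,h\ \ge\ [\gamma-(\tilde\eta-\gamma)_+]_++\rho ,$$ then for every constant $\varepsilon>0$, $$P\big((1-\varepsilon)\pi<\hat\pi^*_A(\hat z)<\pi\big)\to1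 .$$ -/

import Mathlib

open MeasureTheory ProbabilityTheory Filter Topology Set

noncomputable section

/-- An `m × m` correlation matrix with a spectral decomposition (eigenvalues in decreasing order,
column `j` of `eigvec` is the `j`-th unit eigenvector) and a number `k ≤ m` of principal factors,
such that no residual variance vanishes. -/
structure PFAModel (m k : ℕ) where
  corr : Matrix (Fin m) (Fin m) ℝ
  posSemidef : corr.PosSemidef
  diag_one : ∀ i, corr i i = 1
  eigval : Fin m → ℝ
  eigvec : Matrix (Fin m) (Fin m) ℝ
  eigval_antitone : Antitone eigval
  orthonormal : eigvec.transpose * eigvec = 1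
  spectral : corr = eigvec * Matrix.diagonal eigval * eigvec.transpose
  k_le : k ≤ m
  residual_pos : ∀ i, 0 < ∑ j with k ≤ j.val, eigval j * eigvec i j * eigvec i j

namespace PFAModel

variable {m k : ℕ} (M : PFAModel m k)

/-- The loading vector `b i`, the `i`-th row of `L = (√λ₁ γ₁, …, √λₖ γₖ)`. -/
def b (i : Fin m) : EuclideanSpace ℝ (Fin k) :=
  WithLp.toLp 2 fun j =>
    Real.sqrt (M.eigval (Fin.castLE M.k_le j)) * M.eigvec i (Fin.castLE M.k_le j)

/-- The residual covariance matrix `A = ∑_{j > k} λⱼ γⱼ γⱼᵀ`. -/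
def A : Matrix (Fin m) (Fin m) ℝ :=
  Matrix.of fun i i' => ∑ j with k ≤ j.val, M.eigval j * M.eigvec i j * M.eigvec i' j

/-- The scaling `a i = (1 - ‖b i‖²)^(-1/2)`. -/
def a (i : Fin m) : ℝ := (Real.sqrt (1 - ‖M.b i‖ ^ 2))⁻¹

def aMin : ℝ := ⨅ i, M.a i

def aMax : ℝ := ⨆ i, M.a i

/-- The correlation matrix obtained from the covariance matrix `A`. -/
def adjCorr : Matrix (Fin m) (Fin m) ℝ :=
  Matrix.of fun i j => M.A i j / Real.sqrt (M.A i i * M.A j j)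

/-- The average absolute entry of the adjusted correlation matrix. -/
def meanAbsAdjCorr : ℝ := (∑ i, ∑ j, |M.adjCorr i j|) / (m : ℝ) ^ 2

/-- The proportion of indices `i` with `|⟨b i, u⟩| ≤ d`. -/
def smallLoadingFraction (d : ℝ) (u : EuclideanSpace ℝ (Fin k)) : ℝ :=
  ({i : Fin m | |inner ℝ (M.b i) u| ≤ d}.ncard : ℝ) / m

/-- The joint null distribution `N(0, Σ̃)` of the adjusted statistics. -/
def nullLaw : Measure (EuclideanSpace ℝ (Fin m)) := multivariateGaussian 0 M.adjCorr

/-- The observed statistics `X = μ + L W + K`. -/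
def obs (μ : Fin m → ℝ) (w : EuclideanSpace ℝ (Fin k)) (e : EuclideanSpace ℝ (Fin m))
    (i : Fin m) : ℝ :=
  μ i + inner ℝ (M.b i) w + e i

/-- The least-absolute-deviation criterion over the index set `I`. -/
def l1Loss (I : Set (Fin m)) (x : Fin m → ℝ) (β : EuclideanSpace ℝ (Fin k)) : ℝ :=
  ∑ i, I.indicator (fun i => |x i - inner ℝ (M.b i) β|) i

/-- The adjusted statistics computed with the factor value `w`. -/
def adjusted (x : Fin m → ℝ) (w : EuclideanSpace ℝ (Fin k)) (i : Fin m) : ℝ :=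
  M.a i * (x i - inner ℝ (M.b i) w)

/-- `W ~ N(0, I)` are the factors and `K ~ N(0, A)` the errors, independent of each other; `I` is
the set of indices selected for the regression, on which the null factor model
`Xᵢ = ⟨b i, W⟩ + Kᵢ` is correct: the selected means vanish, and the selection leaves the law of
`(W, K)` unchanged; `what` is a minimiser of the least-absolute-deviation criterion over `I`. -/
structure IsSample {Ω : Type*} [MeasurableSpace Ω] (μ : Fin m → ℝ) (P : Measure Ω)
    (W : Ω → EuclideanSpace ℝ (Fin k)) (K : Ω → EuclideanSpace ℝ (Fin m))
    (I : Ω → Set (Fin m)) (what : Ω → EuclideanSpace ℝ (Fin k)) : Prop where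
  law_W : HasLaw W (multivariateGaussian 0 1) P
  law_K : HasLaw K (multivariateGaussian 0 M.A) P
  indep : IndepFun W K P
  measurable_I : Measurable I
  indep_I : IndepFun I (fun ω => (W ω, K ω)) P
  null_model : ∀ᵐ ω ∂P, ∀ i ∈ I ω, μ i = 0
  measurable_what : Measurable what
  minimizer : ∀ᵐ ω ∂P, ∀ β : EuclideanSpace ℝ (Fin k),
    M.l1Loss (I ω) (M.obs μ (W ω) (K ω)) (what ω) ≤ M.l1Loss (I ω) (M.obs μ (W ω) (K ω)) β

end PFAModel

/-- The mean vector equal to `√(2 h log m)` on the signal set and to zero elsewhere. -/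
def signalMean {m : ℕ} (I₁ : Finset (Fin m)) (h : ℝ) (i : Fin m) : ℝ :=
  if i ∈ I₁ then Real.sqrt (2 * h * Real.log m) else 0

/-- The upper tail probability of the standard normal distribution. -/
def normalTail (t : ℝ) : ℝ := (gaussianReal 0 1).real (Ioi t)

/-- The proportion of coordinates exceeding `t`. -/
def exceedFraction {m : ℕ} (x : Fin m → ℝ) (t : ℝ) : ℝ := ({i | t < x i}.ncard : ℝ) / m

/-- `[γ - (η - γ)₊]₊`. -/
def thresholdExponent (γ η : ℝ) : ℝ := max (γ - max (η - γ) 0) 0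

/-- The integers in `[√(2 [γ - (η - γ)₊]₊ log m), √(5 log m)]`. -/
def thresholdGrid (m : ℕ) (γ η : ℝ) : Finset ℕ :=
  (Finset.range (⌊Real.sqrt (5 * Real.log m)⌋₊ + 1)).filter
    fun t => Real.sqrt (2 * thresholdExponent γ η * Real.log m) ≤ (t : ℝ)

/-- The normalised discrepancy whose upper quantiles are the bounding sequences. -/
def discrepancy {m : ℕ} (θ : ℝ) (T : Finset ℕ) (x : Fin m → ℝ) : ℝ :=
  ⨆ t : T, |exceedFraction x (t.1 : ℝ) - normalTail (t.1 : ℝ)| / normalTail (t.1 : ℝ) ^ θ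

/-- The estimator with index `θ` and bounding constant `c`, on the threshold grid `T`. -/
def propEstimator {m : ℕ} (θ c : ℝ) (T : Finset ℕ) (x : Fin m → ℝ) : ℝ :=
  ⨆ t : T, (exceedFraction x (t.1 : ℝ) - normalTail (t.1 : ℝ) - c * normalTail (t.1 : ℝ) ^ θ) /
    (1 - normalTail (t.1 : ℝ))

/-- The adaptive estimator, the larger of those with `θ = 1/2` and `θ = 1`. -/
def adaptiveEstimator {m : ℕ} (cHalf cOne : ℝ) (T : Finset ℕ) (x : Fin m → ℝ) : ℝ :=
  max (propEstimator (1 / 2) cHalf T x) (propEstimator 1 cOne T x)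

/-- `c` exceeds the discrepancy of a vector drawn from `N(0, Σ̃)` with probability more than
`1 - p`. -/
def IsBounding {m k : ℕ} (M : PFAModel m k) (θ : ℝ) (T : Finset ℕ) (p c : ℝ) : Prop :=
  M.nullLaw.real {z | c < discrepancy θ T (fun i => z i)} < p

end

/-!
The adjusted statistics are `zᵢ + aᵢ μᵢ + aᵢ ⟨bᵢ, W - ŵ⟩`, where the scaled errors `z` have law
`N(0, Σ̃)`. The proof has three ingredients.

*Null fluctuations.* The covariance of two exceedance indicators `1{zᵢ > t}`, `1{zⱼ > t}` is at most
a constant times `|Σ̃ᵢⱼ| Φ̄(t)`, so that the exceedance proportion has variance `O(m ^ (-η) Φ̄(t))`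
(`integral_sq_exceedFraction_sub_le`). Chebyshev's inequality over the `O(√(log m))` integer levels
gives the constant for `θ = 1/2`. For `θ = 1` Markov's inequality at each level gives a constant `C
√(log m)` with error probability `O(1 / C)`. This suffices for the existence of the constants, but
consistency with a fixed factor `C` needs a part of `C √(log m)` to absorb the shifts of the levels,
and the rest to be exceeded with vanishing probability. That is provided by the weak-type maximal
inequality `measureReal_exists_exceedFraction_ge_le`, valid for every correlation matrix: the
increments of the running maximum of the normalised proportions are split, for each coordinate `i`,
according to the sign of the correlations with `i`. The coordinates with nonnegative correlation
contribute a telescoping sum, because conditioning `zᵢ` on a higher half-line increases the mean of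
a monotone function of `zᵢ`; the others are no likelier to exceed jointly with `i` than under
independence.

*The estimated factors.* By convexity the least-absolute-deviation estimate lies within `r` of `W`
as soon as the criterion exceeds its value at `W` on the sphere of radius `r`. Along a direction `δ`
the criterion grows at least by a quadratic term, kept large by the scarcity of small loadings,
minus linear and quadratic fluctuations. These are quadratic forms in centred exceedances of `z` at
two levels, whose second moments are again `O(m ^ (-η))` by the covariance bound
(`PFAModel.measureReal_factor_error_le`). With `q → 0` the ratio of `aMax √k` to its allowed order,
all shifts `aᵢ ⟨bᵢ, W - ŵ⟩` are at most `√q m ^ (-(η - γ)₊) / √(log m)` with probability tending to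
one (`exists_shift_bound`). The two bounds on the scalings together also force `m ^ (-[γ - (η -
γ)₊]₊) → 0`, so that the smallest level of the grid tends to infinity.

*The estimator.* A shift by at most `ε` changes an exceedance proportion by at most the proportion
of null statistics in a band of half-width `ε`, of mean at most `6 ε exp (-t² / 2)`. Summed over the
grid this is negligible against `π`, and also against the bounding constants times `Φ̄(t) ^ θ`.
Hence the upper bounds. For consistency, `m⁻¹ ∑ 1{ẑᵢ > t}` is inspected at a level slightly above
the lower end of the grid, which the signals exceed and where `Φ̄(t)` times the bounding constant
with `θ = 1` (if `η < γ`), or `√Φ̄(t)` times that with `θ = 1/2` (if `γ ≤ η`), is negligible against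
`π`.
-/

/-! ### The normal tail -/

/-- The unnormalised standard normal density. -/
noncomputable def gaussExp (t : ℝ) : ℝ := Real.exp (-t ^ 2 / 2)

lemma gaussExp_pos (t : ℝ) : 0 < gaussExp t := Real.exp_pos _

lemma gaussExp_le_one (t : ℝ) : gaussExp t ≤ 1 :=
  Real.exp_le_one_iff.2 (by nlinarith [sq_nonneg t])

lemma gaussExp_anti {s t : ℝ} (hs : 0 ≤ s) (hst : s ≤ t) : gaussExp t ≤ gaussExp s :=
  Real.exp_le_exp.2 (by nlinarith)

lemma gaussianPDFReal_zero_one (x : ℝ) :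
    gaussianPDFReal 0 1 x = (√(2 * Real.pi))⁻¹ * gaussExp x := by
  simp [gaussianPDFReal, gaussExp]

lemma inv_sqrt_two_pi_le : (√(2 * Real.pi))⁻¹ ≤ 1 / 2 := by
  rw [one_div]
  refine inv_anti₀ (by norm_num) (Real.le_sqrt_of_sq_le ?_)
  nlinarith [Real.pi_gt_three]

lemma le_inv_sqrt_two_pi : 1 / 3 ≤ (√(2 * Real.pi))⁻¹ := by
  rw [one_div]
  refine inv_anti₀ (Real.sqrt_pos.2 (by positivity)) (Real.sqrt_le_left (by norm_num) |>.2 ?_)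
  nlinarith [Real.pi_lt_four]

lemma normalTail_nonneg (t : ℝ) : 0 ≤ normalTail t := measureReal_nonneg

lemma normalTail_antitone : Antitone normalTail := fun _ _ h =>
  measureReal_mono (Ioi_subset_Ioi h)

lemma normalTail_le_one (t : ℝ) : normalTail t ≤ 1 := measureReal_le_one

lemma normalTail_sub {a b : ℝ} (h : a ≤ b) :
    normalTail a - normalTail b = ∫ x in a..b, gaussianPDFReal 0 1 x := by
  have h1 : normalTail a - normalTail b = (gaussianReal 0 1).real (Ioc a b) := by
    unfold normalTail
    rw [← Ioc_union_Ioi_eq_Ioi h, measureReal_union _ measurableSet_Ioi]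
    · ring
    · exact Set.disjoint_left.2 fun x hx hx' => absurd hx.2 (not_le.2 hx')
  rw [h1, intervalIntegral.integral_of_le h, measureReal_def,
    gaussianReal_apply_eq_integral 0 one_ne_zero, ENNReal.toReal_ofReal]
  exact integral_nonneg fun x => gaussianPDFReal_nonneg 0 1 x

lemma intervalIntegrable_gaussianPDFReal (a b : ℝ) :
    IntervalIntegrable (gaussianPDFReal 0 1) volume a b :=
  (integrable_gaussianPDFReal 0 1).intervalIntegrable

lemma normalTail_sub_le_of_bound {a b C : ℝ} (h : a ≤ b) (hC : ∀ x ∈ Icc a b, gaussExp x ≤ C) :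
    normalTail a - normalTail b ≤ (b - a) * C := by
  rw [normalTail_sub h]
  calc ∫ x in a..b, gaussianPDFReal 0 1 x ≤ ∫ _ in a..b, C := by
        refine intervalIntegral.integral_mono_on h (intervalIntegrable_gaussianPDFReal a b)
          (by simp) fun x hx => ?_
        rw [gaussianPDFReal_zero_one]
        have := inv_sqrt_two_pi_le
        nlinarith [hC x hx, gaussExp_pos x]
    _ = _ := by simp

lemma normalTail_sub_le {a b : ℝ} (ha : 0 ≤ a) (h : a ≤ b) :
    normalTail a - normalTail b ≤ (b - a) * gaussExp a :=
  normalTail_sub_le_of_bound h fun _ hx => gaussExp_anti ha hx.1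

lemma le_normalTail_sub_of_bound {a b C : ℝ} (h : a ≤ b) (hC : ∀ x ∈ Icc a b, C ≤ gaussExp x) :
    (b - a) * (C / 3) ≤ normalTail a - normalTail b := by
  rw [normalTail_sub h]
  calc (b - a) * (C / 3) = ∫ _ in a..b, C / 3 := by simp [mul_div_assoc]
    _ ≤ ∫ x in a..b, gaussianPDFReal 0 1 x := by
        refine intervalIntegral.integral_mono_on h
          (by simp) (intervalIntegrable_gaussianPDFReal a b) fun x hx => ?_
        rw [gaussianPDFReal_zero_one]
        have := le_inv_sqrt_two_pi
        nlinarith [hC x hx, gaussExp_pos x]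

lemma le_normalTail_sub {a b : ℝ} (ha : 0 ≤ a) (h : a ≤ b) :
    (b - a) * (gaussExp b / 3) ≤ normalTail a - normalTail b :=
  le_normalTail_sub_of_bound h fun _ hx => gaussExp_anti (ha.trans hx.1) hx.2

/-- The normal tail is `1`-Lipschitz. -/
lemma abs_normalTail_sub_le (a b : ℝ) : |normalTail a - normalTail b| ≤ |a - b| := by
  rcases le_total a b with h | h
  · rw [abs_of_nonneg (sub_nonneg.2 (normalTail_antitone h)), abs_sub_comm a b,
      abs_of_nonneg (sub_nonneg.2 h)]
    simpa using normalTail_sub_le_of_bound h fun x _ => gaussExp_le_one x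
  · rw [abs_sub_comm, abs_of_nonneg (sub_nonneg.2 (normalTail_antitone h)),
      abs_of_nonneg (sub_nonneg.2 h)]
    simpa using normalTail_sub_le_of_bound h fun x _ => gaussExp_le_one x

lemma normalTail_le_gaussExp {t : ℝ} (ht : 0 ≤ t) : normalTail t ≤ gaussExp t := by
  have h := measure_ge_le_exp_mul_mgf (μ := gaussianReal 0 1) (X := id) t ht
    (integrable_exp_mul_gaussianReal t)
  rw [mgf_id_gaussianReal] at h
  calc normalTail t ≤ (gaussianReal 0 1).real {ω | t ≤ id ω} :=
        measureReal_mono fun x (hx : t < x) => hx.le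
    _ ≤ _ := h
    _ = gaussExp t := by
        simp only [gaussExp, ← Real.exp_add]
        congr 1
        simp
        ring

/-- A Mills ratio bound: the density is at most a linear multiple of the tail. The tail is bounded
below by the mass of an interval of length `1 / (1 + t)`, on which the density is comparable to
its value at `t`. -/
lemma gaussExp_le_normalTail {t : ℝ} (ht : 0 ≤ t) :
    gaussExp t ≤ 15 * (1 + t) * normalTail t := by
  set u := 1 / (1 + t) with hu
  have hu0 : 0 < u := by positivity
  have h1 : u * (1 + t) = 1 := by rw [hu]; field_simp
  have h2 := le_normalTail_sub ht (le_add_of_nonneg_right hu0.le : t ≤ t + u)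
  have h3 : gaussExp t * Real.exp (-(3 / 2)) ≤ gaussExp (t + u) := by
    rw [gaussExp, gaussExp, ← Real.exp_add]
    refine Real.exp_le_exp.2 ?_
    have : u ≤ 1 := by rw [hu, div_le_one (by positivity)]; linarith
    nlinarith
  have h4 : (1 : ℝ) / 5 ≤ Real.exp (-(3 / 2)) := by
    rw [Real.exp_neg, ← one_div]
    refine one_div_le_one_div_of_le (Real.exp_pos _) ?_
    have h5 : Real.exp (3 / 2) ^ 2 ≤ 5 ^ 2 := by
      rw [← Real.exp_nat_mul]
      have : Real.exp ((2 : ℕ) * (3 / 2)) = Real.exp 1 ^ 3 := by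
        rw [← Real.exp_nat_mul]; norm_num
      rw [this]
      calc Real.exp 1 ^ 3 ≤ 2.7182818286 ^ 3 :=
            pow_le_pow_left₀ (Real.exp_pos _).le Real.exp_one_lt_d9.le 3
        _ ≤ _ := by norm_num
    exact le_of_sq_le_sq h5 (by norm_num)
  have h5 : normalTail t ≥ u * (gaussExp t / 15) := by
    have := normalTail_nonneg (t + u)
    have h6 : gaussExp t / 15 ≤ gaussExp (t + u) / 3 := by nlinarith [gaussExp_pos t]
    nlinarith
  calc gaussExp t = 15 * (u * (1 + t)) * (gaussExp t / 15) := by rw [h1]; ring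
    _ = 15 * (1 + t) * (u * (gaussExp t / 15)) := by ring
    _ ≤ _ := by gcongr

lemma normalTail_pos (t : ℝ) : 0 < normalTail t := by
  rcases le_total 0 t with h | h
  · have := gaussExp_le_normalTail h
    have h1 := gaussExp_pos t
    by_contra hn
    nlinarith [normalTail_nonneg t]
  · refine lt_of_lt_of_le ?_ (normalTail_antitone h)
    have := gaussExp_le_normalTail le_rfl
    have h1 := gaussExp_pos 0
    by_contra hn
    nlinarith [normalTail_nonneg 0]

lemma normalTail_neg (t : ℝ) : normalTail (-t) = 1 - normalTail t := by
  have h0 : (gaussianReal 0 1).real (Iio t) = normalTail (-t) := by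
    have h := gaussianReal_map_neg (μ := 0) (v := 1)
    rw [neg_zero] at h
    unfold normalTail
    conv_rhs => rw [← h]
    rw [map_measureReal_apply measurable_neg measurableSet_Ioi]
    congr 1
    ext x
    simp
  have h1 : (gaussianReal 0 1).real (Iic t) = (gaussianReal 0 1).real (Iio t) := by
    have := nullSingletonClass_gaussianReal (μ := 0) (v := 1) one_ne_zero
    exact measureReal_congr Iio_ae_eq_Iic.symm
  have h2 := probReal_compl_eq_one_sub (μ := gaussianReal 0 1) (measurableSet_Iic (a := t))
  rw [compl_Iic, h1, h0] at h2
  unfold normalTail at *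
  linarith

lemma normalTail_lt_one (t : ℝ) : normalTail t < 1 := by
  have := normalTail_neg t
  linarith [normalTail_pos (-t)]

lemma tendsto_gaussExp_atTop : Tendsto gaussExp atTop (𝓝 0) := by
  refine Real.tendsto_exp_atBot.comp ?_
  have : (fun t : ℝ => -t ^ 2 / 2) = fun t => -(t ^ 2 / 2) := by ext; ring
  rw [this]
  exact tendsto_neg_atTop_atBot.comp ((tendsto_pow_atTop two_ne_zero).atTop_div_const two_pos)

lemma tendsto_normalTail_atTop : Tendsto normalTail atTop (𝓝 0) :=
  squeeze_zero' (Eventually.of_forall normalTail_nonneg)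
    ((eventually_ge_atTop 0).mono fun _ h => normalTail_le_gaussExp h) tendsto_gaussExp_atTop

lemma setIntegral_gaussianReal (s : Set ℝ) (hs : MeasurableSet s) (f : ℝ → ℝ) :
    ∫ x in s, f x ∂(gaussianReal 0 1) = ∫ x in s, gaussianPDFReal 0 1 x * f x := by
  rw [← integral_indicator hs, integral_gaussianReal_eq_integral_smul one_ne_zero,
    ← integral_indicator hs]
  refine integral_congr_ae (Eventually.of_forall fun x => ?_)
  by_cases hx : x ∈ s <;> simp [hx]

lemma integrable_abs_gaussianReal : Integrable (fun x : ℝ => |x|) (gaussianReal 0 1) := by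
  have h : Integrable (fun x : ℝ => x) (gaussianReal 0 1) :=
    (memLp_id_gaussianReal (μ := 0) (v := 1) 1).integrable (by simp)
  exact h.abs

/-- The first moment of a standard normal variable over a right half-line. -/
lemma setIntegral_abs_Ioi_le {t : ℝ} (ht : 0 ≤ t) :
    ∫ x in Ioi t, |x| ∂(gaussianReal 0 1) ≤ gaussExp t := by
  rw [setIntegral_gaussianReal _ measurableSet_Ioi]
  have h1 : ∫ x in Ioi t, gaussianPDFReal 0 1 x * |x| =
      ∫ x in Ioi t, (√(2 * Real.pi))⁻¹ * (x * gaussExp x) := by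
    refine setIntegral_congr_fun measurableSet_Ioi fun x hx => ?_
    have : 0 ≤ x := ht.trans (le_of_lt hx)
    simp only [gaussianPDFReal_zero_one, abs_of_nonneg this]
    ring
  have hd : ∀ x : ℝ, HasDerivAt (fun x => -gaussExp x) (x * gaussExp x) x := by
    intro x
    have h : HasDerivAt (fun y : ℝ => -y ^ 2 / 2) (-(2 * x) / 2) x := by
      simpa using ((hasDerivAt_pow 2 x).neg.div_const 2)
    refine h.exp.neg.congr_deriv ?_
    simp only [gaussExp]
    ring
  have h2 : ∫ x in Ioi t, x * gaussExp x = 0 - -gaussExp t := by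
    refine integral_Ioi_of_hasDerivAt_of_nonneg (hd t).continuousAt.continuousWithinAt
      (fun x _ => hd x) (fun x hx => ?_) ?_
    · exact mul_nonneg (ht.trans (le_of_lt hx)) (gaussExp_pos x).le
    · simpa using tendsto_gaussExp_atTop.neg
  rw [h1, integral_const_mul, h2]
  have := inv_sqrt_two_pi_le
  nlinarith [gaussExp_pos t]

lemma integral_abs_gaussianReal_le : ∫ x, |x| ∂(gaussianReal 0 1) ≤ 1 := by
  have h2 : Integrable (fun x : ℝ => x ^ 2) (gaussianReal 0 1) :=
    (memLp_id_gaussianReal (μ := 0) (v := 1) 2).integrable_sq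
  have h3 : ∫ x, x ^ 2 ∂(gaussianReal 0 1) = 1 := by
    have := variance_fun_id_gaussianReal (μ := 0) (v := 1)
    rw [variance_of_integral_eq_zero (by fun_prop) (by simp)] at this
    simpa using this
  calc ∫ x, |x| ∂(gaussianReal 0 1) ≤ ∫ x, (1 + x ^ 2) / 2 ∂(gaussianReal 0 1) := by
        refine integral_mono integrable_abs_gaussianReal
          (((integrable_const 1).add h2).div_const 2) fun x => ?_
        have := sq_nonneg (|x| - 1)
        have h4 := sq_abs x
        nlinarith
    _ = 1 := by
        rw [integral_div, integral_add (integrable_const 1) h2, h3]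
        simp

/-! ### Exceedances of correlated normal variables -/

lemma abs_shifted_sub_le {ρ s x : ℝ} (hρ : |ρ| ≤ 1 / 2) :
    |(s - ρ * x) / √(1 - ρ ^ 2) - s| ≤ 2 * |ρ| * (|s| + |x|) := by
  have hρ2 : ρ ^ 2 ≤ 1 / 4 := by rw [← sq_abs]; nlinarith [abs_nonneg ρ]
  have hρ3 : ρ ^ 2 ≤ |ρ| / 2 := by rw [← sq_abs]; nlinarith [abs_nonneg ρ]
  set σ := √(1 - ρ ^ 2) with hσ
  have hσ2 : σ ^ 2 = 1 - ρ ^ 2 := Real.sq_sqrt (by linarith)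
  have hσ0 : 0 < σ := Real.sqrt_pos.2 (by linarith)
  have hσ1 : σ ≤ 1 := Real.sqrt_le_one.2 (by nlinarith [sq_nonneg ρ])
  have hlow : 1 - ρ ^ 2 ≤ σ := by nlinarith
  have h1 : |(s - ρ * x) - σ * s| ≤ σ * (2 * |ρ| * (|s| + |x|)) := by
    calc |(s - ρ * x) - σ * s| = |(1 - σ) * s - ρ * x| := by ring_nf
      _ ≤ |(1 - σ) * s| + |ρ * x| := abs_sub _ _
      _ = (1 - σ) * |s| + |ρ| * |x| := by
          rw [abs_mul, abs_mul, abs_of_nonneg (by linarith : 0 ≤ 1 - σ)]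
      _ ≤ (|ρ| / 2) * |s| + |ρ| * |x| := by
          gcongr
          linarith
      _ ≤ _ := by
          have a1 := mul_nonneg (abs_nonneg ρ) (abs_nonneg s)
          have a2 := mul_nonneg (abs_nonneg ρ) (abs_nonneg x)
          nlinarith
  rw [div_sub' hσ0.ne', abs_div, abs_of_pos hσ0, div_le_iff₀ hσ0]
  linarith

lemma abs_normalTail_shifted_sub_le {ρ s x : ℝ} (hρ : |ρ| ≤ 1 / 2) :
    |normalTail ((s - ρ * x) / √(1 - ρ ^ 2)) - normalTail s| ≤ 2 * |ρ| * (|s| + |x|) :=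
  (abs_normalTail_sub_le _ _).trans (abs_shifted_sub_le hρ)

/-- Beyond a level `s ≥ 0` the effect of a correlation `ρ` on the conditional tail is of order
`|ρ|`, uniformly in `s`: for `x ≤ 3 s / 2` the shifted level stays above `s / 4`, where the density
compensates the factor `s`. -/
lemma abs_normalTail_shifted_sub_le_of_lt {ρ s x : ℝ} (hρ : |ρ| ≤ 1 / 2) (hs : 0 ≤ s)
    (hx : s < x) :
    |normalTail ((s - ρ * x) / √(1 - ρ ^ 2)) - normalTail s| ≤
      20 * |ρ| + (Ioi (3 / 2 * s)).indicator (fun x => 4 * |ρ| * |x|) x := by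
  have hx0 : 0 < x := hs.trans_lt hx
  by_cases h : x ≤ 3 / 2 * s
  · rw [indicator_of_notMem (by simpa using h), add_zero]
    set u := (s - ρ * x) / √(1 - ρ ^ 2) with hu
    have hρ2 : ρ ^ 2 ≤ 1 / 4 := by rw [← sq_abs]; nlinarith [abs_nonneg ρ]
    have hus : s / 4 ≤ u := by
      have h1 : ρ * x ≤ 3 / 4 * s := by
        have := le_abs_self ρ
        nlinarith
      rw [hu, le_div_iff₀ (Real.sqrt_pos.2 (by linarith))]
      have : √(1 - ρ ^ 2) ≤ 1 := Real.sqrt_le_one.2 (by nlinarith [sq_nonneg ρ])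
      nlinarith
    have h2 : |u - s| ≤ 5 * |ρ| * s := by
      refine (abs_shifted_sub_le hρ).trans ?_
      rw [abs_of_nonneg hs, abs_of_pos hx0]
      nlinarith [abs_nonneg ρ]
    have h3 : s * gaussExp (s / 4) ≤ 4 := by
      have h4 : gaussExp (s / 4) * Real.exp ((s / 4) ^ 2 / 2) = 1 := by
        rw [gaussExp, ← Real.exp_add]
        ring_nf
        exact Real.exp_zero
      have h5 := Real.add_one_le_exp ((s / 4) ^ 2 / 2)
      have h6 := gaussExp_pos (s / 4)
      have h7 : s ≤ 4 * Real.exp ((s / 4) ^ 2 / 2) := by nlinarith [sq_nonneg (s / 4 - 1)]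
      calc s * gaussExp (s / 4) ≤ 4 * Real.exp ((s / 4) ^ 2 / 2) * gaussExp (s / 4) := by gcongr
        _ = 4 * (gaussExp (s / 4) * Real.exp ((s / 4) ^ 2 / 2)) := by ring
        _ = 4 := by rw [h4, mul_one]
    have h4 : |normalTail u - normalTail s| ≤ |u - s| * gaussExp (s / 4) := by
      rcases le_total u s with hc | hc
      · rw [abs_of_nonneg (sub_nonneg.2 (normalTail_antitone hc)), abs_sub_comm,
          abs_of_nonneg (sub_nonneg.2 hc)]
        exact normalTail_sub_le_of_bound hc fun y hy =>
          gaussExp_anti (by linarith) (hus.trans hy.1)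
      · rw [abs_sub_comm, abs_of_nonneg (sub_nonneg.2 (normalTail_antitone hc)),
          abs_of_nonneg (sub_nonneg.2 hc)]
        exact normalTail_sub_le_of_bound hc fun y hy =>
          gaussExp_anti (by linarith) (by linarith [hy.1])
    calc _ ≤ _ := h4
      _ ≤ 5 * |ρ| * s * gaussExp (s / 4) := by
          gcongr
          exact (gaussExp_pos _).le
      _ = 5 * |ρ| * (s * gaussExp (s / 4)) := by ring
      _ ≤ 5 * |ρ| * 4 := by gcongr
      _ = _ := by ring
  · rw [indicator_of_mem (by simpa using h)]
    refine (abs_normalTail_shifted_sub_le hρ).trans ?_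
    rw [abs_of_nonneg hs, abs_of_pos hx0]
    nlinarith [abs_nonneg ρ]

lemma gaussExp_three_halves_le {s : ℝ} (hs : 0 ≤ s) :
    gaussExp (3 / 2 * s) ≤ 30 * normalTail s := by
  have h1 : gaussExp (3 / 2 * s) * Real.exp (5 / 8 * s ^ 2) = gaussExp s := by
    rw [gaussExp, gaussExp, ← Real.exp_add]
    ring_nf
  have h2 := gaussExp_le_normalTail hs
  have h3 := Real.add_one_le_exp (5 / 8 * s ^ 2)
  have h4 := gaussExp_pos (3 / 2 * s)
  have h5 : 1 + s ≤ 2 * Real.exp (5 / 8 * s ^ 2) := by nlinarith [sq_nonneg (s - 1)]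
  have h6 := Real.exp_pos (5 / 8 * s ^ 2)
  have h7 := normalTail_pos s
  have : gaussExp (3 / 2 * s) * Real.exp (5 / 8 * s ^ 2) ≤
      30 * normalTail s * Real.exp (5 / 8 * s ^ 2) := by
    rw [h1]
    calc _ ≤ 15 * (1 + s) * normalTail s := h2
      _ ≤ 15 * (2 * Real.exp (5 / 8 * s ^ 2)) * normalTail s := by gcongr
      _ = _ := by ring
  exact le_of_mul_le_mul_right this h6

section Pair

variable {Ω : Type*} [MeasurableSpace Ω] {P : Measure Ω} [IsProbabilityMeasure P]

lemma measureReal_gaussianReal_Ioi {v : NNReal} (hv : v ≠ 0) (u : ℝ) :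
    (gaussianReal 0 v).real (Ioi u) = normalTail (u / √v) := by
  have hv0 : 0 < (v : ℝ) := by positivity
  have h0 : 0 < √(v : ℝ) := Real.sqrt_pos.2 hv0
  have h : (gaussianReal 0 1).map (fun x => √(v : ℝ) * x) = gaussianReal 0 v := by
    have := gaussianReal_map_const_mul (μ := 0) (v := 1) (√(v : ℝ))
    rw [mul_zero, mul_one] at this
    convert this using 2
    ext
    simp [Real.sq_sqrt hv0.le]
  rw [← h, map_measureReal_apply (measurable_const_mul _) measurableSet_Ioi, normalTail]
  congr 1
  ext x
  simp [div_lt_iff₀ h0, mul_comm]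

/-- The joint exceedance probability of a correlated standard normal pair `(X, ρ X + R)`,
by conditioning on `X`. -/
lemma measureReal_both_exceed {X R : Ω → ℝ} {ρ s : ℝ} (hρ : |ρ| ≤ 1 / 2)
    (hX : HasLaw X (gaussianReal 0 1) P)
    (hR : HasLaw R (gaussianReal 0 (1 - ρ ^ 2).toNNReal) P) (hind : IndepFun X R P) :
    P.real {ω | s < X ω ∧ s < ρ * X ω + R ω} =
      ∫ x in Ioi s, normalTail ((s - ρ * x) / √(1 - ρ ^ 2)) ∂(gaussianReal 0 1) := by
  have hρ2 : 0 < 1 - ρ ^ 2 := by rw [← sq_abs]; nlinarith [abs_nonneg ρ]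
  have hpair := (indepFun_iff_hasLaw_prodMk_prod hX hR).1 hind
  have hmeas : MeasurableSet {p : ℝ × ℝ | s < p.1 ∧ s < ρ * p.1 + p.2} :=
    (measurableSet_lt measurable_const measurable_fst).inter
      (measurableSet_lt measurable_const
        (by fun_prop : Measurable fun p : ℝ × ℝ => ρ * p.1 + p.2))
  have h1 := hpair.measureReal_eq (p := fun p : ℝ × ℝ => s < p.1 ∧ s < ρ * p.1 + p.2) hmeas
  refine h1.trans ?_
  rw [measureReal_def, Measure.prod_apply hmeas, ← integral_indicator measurableSet_Ioi,
    integral_eq_lintegral_of_nonneg_ae]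
  · congr 1
    refine lintegral_congr fun x => ?_
    by_cases hx : s < x
    · have : Prod.mk x ⁻¹' {p : ℝ × ℝ | s < p.1 ∧ s < ρ * p.1 + p.2} = Ioi (s - ρ * x) := by
        ext y
        simp [hx, sub_lt_iff_lt_add']
      rw [this, indicator_of_mem (by simpa using hx), ← ofReal_measureReal,
        measureReal_gaussianReal_Ioi (by simpa using hρ2), Real.coe_toNNReal _ hρ2.le]
    · have : Prod.mk x ⁻¹' {p : ℝ × ℝ | s < p.1 ∧ s < ρ * p.1 + p.2} = ∅ := by
        ext y
        simp [hx]
      rw [this, indicator_of_notMem (by simpa using hx)]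
      simp
  · exact Eventually.of_forall fun x => indicator_nonneg (fun _ _ => normalTail_nonneg _) x
  · refine (Measurable.indicator ?_ measurableSet_Ioi).aestronglyMeasurable
    exact normalTail_antitone.measurable.comp (by fun_prop)

lemma abs_both_exceed_sub_le {X R : Ω → ℝ} {ρ s : ℝ} (hρ : |ρ| ≤ 1 / 2)
    (hX : HasLaw X (gaussianReal 0 1) P)
    (hR : HasLaw R (gaussianReal 0 (1 - ρ ^ 2).toNNReal) P) (hind : IndepFun X R P) :
    |P.real {ω | s < X ω ∧ s < ρ * X ω + R ω} - normalTail s ^ 2| ≤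
      ∫ x in Ioi s, |normalTail ((s - ρ * x) / √(1 - ρ ^ 2)) - normalTail s|
        ∂(gaussianReal 0 1) := by
  have hint : ∀ f : ℝ → ℝ, Measurable f →
      IntegrableOn (fun x => normalTail (f x)) (Ioi s) (gaussianReal 0 1) := fun f hf => by
    refine Integrable.of_bound (C := 1)
      (normalTail_antitone.measurable.comp hf).aestronglyMeasurable
      (Eventually.of_forall fun x => ?_)
    rw [Real.norm_of_nonneg (normalTail_nonneg _)]
    exact normalTail_le_one _
  have h2 : normalTail s ^ 2 = ∫ x in Ioi s, normalTail s ∂(gaussianReal 0 1) := by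
    rw [setIntegral_const, smul_eq_mul, sq]
    rfl
  rw [measureReal_both_exceed hρ hX hR hind, h2, ← integral_sub (hint _ (by fun_prop))
    (hint _ (by fun_prop))]
  exact abs_integral_le_integral_abs

/-- The covariance of two exceedance indicators is at most a multiple of the correlation. -/
lemma abs_both_exceed_sub_le_of_abs_le_one {X R : Ω → ℝ} {ρ s : ℝ} (hs : |s| ≤ 1)
    (hX : HasLaw X (gaussianReal 0 1) P)
    (hR : HasLaw R (gaussianReal 0 (1 - ρ ^ 2).toNNReal) P) (hind : IndepFun X R P) :
    |P.real {ω | s < X ω ∧ s < ρ * X ω + R ω} - normalTail s ^ 2| ≤ 4 * |ρ| := by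
  by_cases hρ : |ρ| ≤ 1 / 2
  · refine (abs_both_exceed_sub_le hρ hX hR hind).trans ?_
    have hi : Integrable (fun x : ℝ => 2 * |ρ| * (1 + |x|)) (gaussianReal 0 1) :=
      ((integrable_const 1).add integrable_abs_gaussianReal).const_mul _
    calc _ ≤ ∫ x in Ioi s, 2 * |ρ| * (1 + |x|) ∂(gaussianReal 0 1) := by
          refine integral_mono_of_nonneg (Eventually.of_forall fun x => abs_nonneg _)
            hi.integrableOn (Eventually.of_forall fun x => ?_)
          refine (abs_normalTail_shifted_sub_le hρ).trans ?_
          change 2 * |ρ| * (|s| + |x|) ≤ 2 * |ρ| * (1 + |x|)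
          gcongr
      _ ≤ ∫ x, 2 * |ρ| * (1 + |x|) ∂(gaussianReal 0 1) :=
          setIntegral_le_integral hi (Eventually.of_forall fun x => by positivity)
      _ = 2 * |ρ| * (1 + ∫ x, |x| ∂(gaussianReal 0 1)) := by
          rw [integral_const_mul, integral_add (integrable_const 1) integrable_abs_gaussianReal]
          simp
      _ ≤ 2 * |ρ| * (1 + 1) := by
          gcongr
          exact integral_abs_gaussianReal_le
      _ = _ := by ring
  · have h1 : P.real {ω | s < X ω ∧ s < ρ * X ω + R ω} ≤ 1 := measureReal_le_one
    have h2 : 0 ≤ P.real {ω | s < X ω ∧ s < ρ * X ω + R ω} := measureReal_nonneg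
    have h3 := normalTail_le_one s
    have h4 := normalTail_nonneg s
    rw [abs_le]
    constructor <;> nlinarith

/-- The covariance of two exceedance indicators at a level `s ≥ 0` is at most a multiple of the
correlation times the tail probability. -/
lemma abs_both_exceed_sub_le_normalTail {X R : Ω → ℝ} {ρ s : ℝ} (hs : 0 ≤ s)
    (hX : HasLaw X (gaussianReal 0 1) P)
    (hR : HasLaw R (gaussianReal 0 (1 - ρ ^ 2).toNNReal) P) (hind : IndepFun X R P) :
    |P.real {ω | s < X ω ∧ s < ρ * X ω + R ω} - normalTail s ^ 2| ≤
      140 * |ρ| * normalTail s := by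
  by_cases hρ : |ρ| ≤ 1 / 2
  · refine (abs_both_exceed_sub_le hρ hX hR hind).trans ?_
    have hi : Integrable (fun x : ℝ => 4 * |ρ| * |x|) (gaussianReal 0 1) :=
      integrable_abs_gaussianReal.const_mul _
    have hi2 := hi.indicator (measurableSet_Ioi (a := 3 / 2 * s))
    calc _ ≤ ∫ x in Ioi s, (20 * |ρ| + (Ioi (3 / 2 * s)).indicator (fun x => 4 * |ρ| * |x|) x)
            ∂(gaussianReal 0 1) := by
          refine integral_mono_of_nonneg (Eventually.of_forall fun x => abs_nonneg _)
            ((integrable_const _).add hi2).integrableOn ?_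
          filter_upwards [ae_restrict_mem measurableSet_Ioi] with x hx
          exact abs_normalTail_shifted_sub_le_of_lt hρ hs hx
      _ = 20 * |ρ| * normalTail s +
          ∫ x in Ioi s, (Ioi (3 / 2 * s)).indicator (fun x => 4 * |ρ| * |x|) x
            ∂(gaussianReal 0 1) := by
          rw [integral_add (integrable_const _) hi2.integrableOn, setIntegral_const, smul_eq_mul,
            mul_comm]
          rfl
      _ ≤ 20 * |ρ| * normalTail s +
          ∫ x, (Ioi (3 / 2 * s)).indicator (fun x => 4 * |ρ| * |x|) x ∂(gaussianReal 0 1) := by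
          refine add_le_add le_rfl (setIntegral_le_integral hi2 (Eventually.of_forall fun x => ?_))
          exact indicator_nonneg (fun _ _ => by positivity) x
      _ ≤ 20 * |ρ| * normalTail s + 4 * |ρ| * (30 * normalTail s) := by
          rw [integral_indicator measurableSet_Ioi, integral_const_mul]
          gcongr
          exact (setIntegral_abs_Ioi_le (by positivity)).trans (gaussExp_three_halves_le hs)
      _ = _ := by ring
  · have h1 : P.real {ω | s < X ω ∧ s < ρ * X ω + R ω} ≤ normalTail s := by
      change _ ≤ (gaussianReal 0 1).real {x | s < x}
      rw [← hX.measureReal_eq (p := fun x => s < x) measurableSet_Ioi]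
      exact measureReal_mono fun ω hω => hω.1
    have h2 : 0 ≤ P.real {ω | s < X ω ∧ s < ρ * X ω + R ω} := measureReal_nonneg
    have h3 := normalTail_le_one s
    have h4 := normalTail_nonneg s
    rw [abs_le]
    constructor <;> nlinarith

end Pair

/-! ### Gaussian vectors with a correlation matrix -/

section Correlated

variable {ι : Type*} {S : Matrix ι ι ℝ}

/-- The residuals of the coordinates after regression on coordinate `i`. -/
def coordResidual (S : Matrix ι ι ℝ) (i : ι) (x : EuclideanSpace ℝ ι) : ι → ℝ :=
  fun j => x j - S i j * x i

lemma measurable_coordResidual (i : ι) : Measurable (coordResidual S i) := by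
  unfold coordResidual
  fun_prop

lemma coord_eq_add_coordResidual (i j : ι) (x : EuclideanSpace ℝ ι) :
    x j = S i j * x i + coordResidual S i x j := by simp [coordResidual]

/-- The centred indicator that a coordinate exceeds the level `s`. -/
noncomputable def centredExceed (s y : ℝ) : ℝ := (Ioi s).indicator 1 y - normalTail s

lemma measurable_centredExceed (s : ℝ) : Measurable (centredExceed s) :=
  (measurable_const.indicator measurableSet_Ioi).sub_const _

lemma abs_centredExceed_le (s y : ℝ) : |centredExceed s y| ≤ 1 := by
  have h1 := normalTail_le_one s
  have h2 := normalTail_nonneg s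
  by_cases h : s < y
  · rw [centredExceed, indicator_of_mem (by simpa using h), abs_le]
    simp only [Pi.one_apply]
    constructor <;> linarith
  · rw [centredExceed, indicator_of_notMem (by simpa using h), abs_le]
    constructor <;> linarith

variable [Fintype ι] [DecidableEq ι]

lemma map_eval_multivariateGaussian (hS : S.PosSemidef) (h1 : ∀ i, S i i = 1) (i : ι) :
    HasLaw (fun x : EuclideanSpace ℝ ι => x i) (gaussianReal 0 1) (multivariateGaussian 0 S) := by
  have h := (measurePreserving_eval_multivariateGaussian (μ := 0) hS (i := i)).hasLaw
  simpa [h1 i] using h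

lemma memLp_eval (i : ι) :
    MemLp (fun x : EuclideanSpace ℝ ι => x i) 2 (multivariateGaussian 0 S) :=
  (IsGaussian.hasGaussianLaw_id.map_fun
    (EuclideanSpace.proj i : EuclideanSpace ℝ ι →L[ℝ] ℝ)).memLp_two

lemma covariance_eval_coordResidual (hS : S.PosSemidef) (h1 : ∀ i, S i i = 1) (i j : ι) :
    cov[fun x : EuclideanSpace ℝ ι => x i, fun x => coordResidual S i x j;
      multivariateGaussian 0 S] = 0 := by
  unfold coordResidual
  rw [covariance_fun_sub_right (memLp_eval i) (memLp_eval j) ((memLp_eval i).const_mul _),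
    covariance_const_mul_right, covariance_eval_multivariateGaussian hS,
    covariance_eval_multivariateGaussian hS, h1]
  ring

lemma indepFun_coordResidual (hS : S.PosSemidef) (h1 : ∀ i, S i i = 1) (i : ι) :
    IndepFun (fun x : EuclideanSpace ℝ ι => x i) (coordResidual S i)
      (multivariateGaussian 0 S) := by
  have hg : HasGaussianLaw (fun x : EuclideanSpace ℝ ι =>
      ((fun _ : Unit => x i), (fun j => coordResidual S i x j))) (multivariateGaussian 0 S) := by
    let p : ι → EuclideanSpace ℝ ι →L[ℝ] ℝ := fun j => EuclideanSpace.proj j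
    exact IsGaussian.hasGaussianLaw_id.map_fun
      ((ContinuousLinearMap.pi fun _ : Unit => p i).prod
        (ContinuousLinearMap.pi fun j => p j - S i j • p i))
  have h := hg.indepFun_of_covariance_eval fun _ j => covariance_eval_coordResidual hS h1 i j
  exact h.comp (φ := fun f : Unit → ℝ => f ()) (ψ := id) (by fun_prop) measurable_id

lemma hasLaw_coordResidual (hS : S.PosSemidef) (h1 : ∀ i, S i i = 1) (i j : ι) :
    HasLaw (fun x => coordResidual S i x j) (gaussianReal 0 (1 - S i j ^ 2).toNNReal)
      (multivariateGaussian 0 S) := by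
  have hsymm : S j i = S i j := by simpa using congrFun (congrFun hS.isHermitian i) j
  have hg : HasGaussianLaw (fun x : EuclideanSpace ℝ ι => coordResidual S i x j)
      (multivariateGaussian 0 S) := by
    let p : ι → EuclideanSpace ℝ ι →L[ℝ] ℝ := fun j => EuclideanSpace.proj j
    exact IsGaussian.hasGaussianLaw_id.map_fun (p j - S i j • p i)
  refine ⟨hg.aemeasurable, ?_⟩
  rw [hg.map_eq_gaussianReal]
  have hmean : ∀ l, ∫ x : EuclideanSpace ℝ ι, x l ∂(multivariateGaussian 0 S) = 0 := fun l => by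
    rw [(map_eval_multivariateGaussian hS h1 l).integral_eq, integral_id_gaussianReal]
  have hint : ∀ l, Integrable (fun x : EuclideanSpace ℝ ι => x l) (multivariateGaussian 0 S) :=
    fun l => (memLp_eval l).integrable (by simp)
  congr 1
  · unfold coordResidual
    rw [integral_sub (hint j) ((hint i).const_mul _), integral_const_mul, hmean, hmean]
    simp
  · unfold coordResidual
    rw [variance_fun_sub (memLp_eval j) ((memLp_eval i).const_mul _),
      variance_const_mul, covariance_const_mul_right, ← covariance_self (by fun_prop),
      ← covariance_self (by fun_prop), covariance_eval_multivariateGaussian hS,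
      covariance_eval_multivariateGaussian hS, covariance_eval_multivariateGaussian hS, h1, h1,
      hsymm]
    ring_nf

lemma measureReal_exceed (hS : S.PosSemidef) (h1 : ∀ i, S i i = 1) (i : ι) (s : ℝ) :
    (multivariateGaussian 0 S).real {x | s < x i} = normalTail s :=
  (map_eval_multivariateGaussian hS h1 i).measureReal_eq (p := fun y => s < y) measurableSet_Ioi

lemma integral_centredExceed_mul (hS : S.PosSemidef) (h1 : ∀ i, S i i = 1) (i j : ι) (s : ℝ) :
    ∫ x, centredExceed s (x i) * centredExceed s (x j) ∂(multivariateGaussian 0 S) =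
      (multivariateGaussian 0 S).real {x | s < x i ∧ s < x j} - normalTail s ^ 2 := by
  set P := multivariateGaussian (0 : EuclideanSpace ℝ ι) S
  have hm : ∀ l, MeasurableSet {x : EuclideanSpace ℝ ι | s < x l} := fun l =>
    measurableSet_lt measurable_const (by fun_prop)
  have hint : ∀ A : Set (EuclideanSpace ℝ ι), MeasurableSet A →
      Integrable (fun x => A.indicator (1 : EuclideanSpace ℝ ι → ℝ) x) P :=
    fun A hA => (integrable_const (1 : ℝ)).indicator hA
  have hE : ∀ A : Set (EuclideanSpace ℝ ι), MeasurableSet A →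
      ∫ x, A.indicator (1 : EuclideanSpace ℝ ι → ℝ) x ∂P = P.real A :=
    fun A hA => integral_indicator_one hA
  have hexp : ∀ x : EuclideanSpace ℝ ι, centredExceed s (x i) * centredExceed s (x j) =
      {x : EuclideanSpace ℝ ι | s < x i ∧ s < x j}.indicator 1 x
        - normalTail s * {x : EuclideanSpace ℝ ι | s < x i}.indicator 1 x
        - normalTail s * {x : EuclideanSpace ℝ ι | s < x j}.indicator 1 x
        + normalTail s ^ 2 := by
    intro x
    by_cases hi : s < x i <;> by_cases hj : s < x j <;>
      simp [centredExceed, hi, hj, indicator] <;> ring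
  have hmm : MeasurableSet {x : EuclideanSpace ℝ ι | s < x i ∧ s < x j} := (hm i).inter (hm j)
  simp_rw [hexp]
  rw [integral_add (by
      exact ((hint _ hmm).sub ((hint _ (hm i)).const_mul _)).sub ((hint _ (hm j)).const_mul _))
      (integrable_const _),
    integral_sub (by exact (hint _ hmm).sub ((hint _ (hm i)).const_mul _))
      ((hint _ (hm j)).const_mul _),
    integral_sub (hint _ hmm) ((hint _ (hm i)).const_mul _), integral_const_mul,
    integral_const_mul, hE _ hmm, hE _ (hm i), hE _ (hm j), measureReal_exceed hS h1 i s,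
    measureReal_exceed hS h1 j s]
  simp
  ring

lemma abs_integral_centredExceed_mul_le (hS : S.PosSemidef) (h1 : ∀ i, S i i = 1) (i j : ι)
    {s : ℝ} (hs : |s| ≤ 1) :
    |∫ x, centredExceed s (x i) * centredExceed s (x j) ∂(multivariateGaussian 0 S)| ≤
      4 * |S i j| := by
  rw [integral_centredExceed_mul hS h1]
  have := abs_both_exceed_sub_le_of_abs_le_one hs (map_eval_multivariateGaussian hS h1 i)
    (hasLaw_coordResidual hS h1 i j)
    ((indepFun_coordResidual hS h1 i).comp measurable_id (measurable_pi_apply j))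
  simpa only [← coord_eq_add_coordResidual] using this

lemma abs_integral_centredExceed_mul_le_normalTail (hS : S.PosSemidef) (h1 : ∀ i, S i i = 1)
    (i j : ι) {s : ℝ} (hs : 0 ≤ s) :
    |∫ x, centredExceed s (x i) * centredExceed s (x j) ∂(multivariateGaussian 0 S)| ≤
      140 * |S i j| * normalTail s := by
  rw [integral_centredExceed_mul hS h1]
  have := abs_both_exceed_sub_le_normalTail hs (map_eval_multivariateGaussian hS h1 i)
    (hasLaw_coordResidual hS h1 i j)
    ((indepFun_coordResidual hS h1 i).comp measurable_id (measurable_pi_apply j))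
  simpa only [← coord_eq_add_coordResidual] using this

end Correlated

/-! ### Exceedance proportions -/

lemma exceedFraction_eq {m : ℕ} (x : Fin m → ℝ) (t : ℝ) :
    exceedFraction x t = (∑ i, (Ioi t).indicator (1 : ℝ → ℝ) (x i)) / m := by
  unfold exceedFraction
  congr 1
  rw [Set.ncard_eq_toFinset_card']
  simp [indicator]

lemma exceedFraction_nonneg {m : ℕ} (x : Fin m → ℝ) (t : ℝ) : 0 ≤ exceedFraction x t := by
  unfold exceedFraction
  positivity

lemma exceedFraction_sub_normalTail {m : ℕ} (hm : m ≠ 0) (x : Fin m → ℝ) (t : ℝ) :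
    exceedFraction x t - normalTail t = (∑ i, centredExceed t (x i)) / m := by
  have : (m : ℝ) ≠ 0 := by exact_mod_cast hm
  rw [exceedFraction_eq]
  simp only [centredExceed, Finset.sum_sub_distrib, Finset.sum_const, Finset.card_univ,
    Fintype.card_fin, nsmul_eq_mul]
  field_simp

section Fraction

variable {m : ℕ} {S : Matrix (Fin m) (Fin m) ℝ}

lemma measurable_exceedFraction (t : ℝ) :
    Measurable fun x : EuclideanSpace ℝ (Fin m) => exceedFraction (fun i => x i) t := by
  simp_rw [exceedFraction_eq]
  refine (Finset.measurable_sum _ fun i _ => ?_).div_const _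
  exact (measurable_const.indicator measurableSet_Ioi).comp (by fun_prop)

lemma exceedFraction_le_one (x : Fin m → ℝ) (t : ℝ) : exceedFraction x t ≤ 1 := by
  unfold exceedFraction
  refine div_le_one_of_le₀ ?_ (by positivity)
  have := Set.ncard_le_card (s := {i | t < x i})
  simpa using this

lemma integrable_exceedFraction (t : ℝ) :
    Integrable (fun x : EuclideanSpace ℝ (Fin m) => exceedFraction (fun i => x i) t)
      (multivariateGaussian 0 S) :=
  Integrable.of_bound (measurable_exceedFraction t).aestronglyMeasurable 1
    (Eventually.of_forall fun x => by
      rw [Real.norm_of_nonneg (exceedFraction_nonneg _ _)]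
      exact exceedFraction_le_one _ _)

lemma integral_exceedFraction (hm : m ≠ 0) (hS : S.PosSemidef) (h1 : ∀ i, S i i = 1) (t : ℝ) :
    ∫ x : EuclideanSpace ℝ (Fin m), exceedFraction (fun i => x i) t
      ∂(multivariateGaussian 0 S) = normalTail t := by
  have hm0 : (m : ℝ) ≠ 0 := by exact_mod_cast hm
  have hms : ∀ i, MeasurableSet {x : EuclideanSpace ℝ (Fin m) | t < x i} := fun l =>
    measurableSet_lt measurable_const (by fun_prop)
  have h : ∀ i (x : EuclideanSpace ℝ (Fin m)), (Ioi t).indicator (1 : ℝ → ℝ) (x i) =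
      {x : EuclideanSpace ℝ (Fin m) | t < x i}.indicator 1 x := fun i x => by
    simp [indicator]
  simp_rw [exceedFraction_eq, h]
  rw [integral_div, integral_finsetSum]
  · simp_rw [integral_indicator_one (hms _), measureReal_exceed hS h1]
    simp
    field_simp
  · exact fun i _ => (integrable_const (1 : ℝ)).indicator (hms i)

/-- The variance of an exceedance proportion is controlled by the average absolute correlation. -/
lemma integral_sq_exceedFraction_sub_le (hm : m ≠ 0) (hS : S.PosSemidef) (h1 : ∀ i, S i i = 1)
    {t : ℝ} (ht : 0 ≤ t) :
    ∫ x : EuclideanSpace ℝ (Fin m), (exceedFraction (fun i => x i) t - normalTail t) ^ 2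
      ∂(multivariateGaussian 0 S) ≤
      140 * ((∑ i, ∑ j, |S i j|) / (m : ℝ) ^ 2) * normalTail t := by
  have hint : ∀ i j, Integrable (fun x : EuclideanSpace ℝ (Fin m) =>
      centredExceed t (x i) * centredExceed t (x j)) (multivariateGaussian 0 S) := fun i j => by
    refine Integrable.of_bound (C := 1) ?_ (Eventually.of_forall fun x => ?_)
    · exact (((measurable_centredExceed t).comp (by fun_prop)).mul
        ((measurable_centredExceed t).comp (by fun_prop))).aestronglyMeasurable
    · rw [norm_mul]
      exact mul_le_one₀ (abs_centredExceed_le _ _) (norm_nonneg _) (abs_centredExceed_le _ _)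
  simp_rw [exceedFraction_sub_normalTail hm, div_pow, sq (∑ i, centredExceed t _),
    Finset.sum_mul_sum]
  rw [integral_div, integral_finsetSum _ fun i _ => integrable_finsetSum _ fun j _ => hint i j]
  simp_rw [integral_finsetSum _ fun j _ => hint _ j]
  rw [mul_div_assoc', div_mul_eq_mul_div]
  gcongr
  rw [mul_assoc, mul_comm _ (normalTail t), ← mul_assoc, Finset.mul_sum]
  refine Finset.sum_le_sum fun i _ => ?_
  rw [Finset.mul_sum]
  refine Finset.sum_le_sum fun j _ => ?_
  refine (le_abs_self _).trans ((abs_integral_centredExceed_mul_le_normalTail hS h1 i j ht).trans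
    (le_of_eq ?_))
  ring

end Fraction

/-! ### A maximal inequality for exceedance proportions -/

/-- Conditioning a normal variable on a higher half-line increases the mean of a monotone
function. -/
lemma setIntegral_mul_normalTail_le {h : ℝ → ℝ} (hm : Monotone h)
    (hi : Integrable h (gaussianReal 0 1)) {A : Set ℝ} (hA : MeasurableSet A) {t : ℝ}
    (hAt : Ioi t ⊆ A) :
    (∫ x in A, h x ∂(gaussianReal 0 1)) * normalTail t ≤
      (∫ x in Ioi t, h x ∂(gaussianReal 0 1)) * (gaussianReal 0 1).real A := by
  have hAm : MeasurableSet (A \ Ioi t) := hA.diff measurableSet_Ioi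
  have hdisj : Disjoint (A \ Ioi t) (Ioi t) := disjoint_sdiff_left
  have hun : A \ Ioi t ∪ Ioi t = A := sdiff_union_of_subset hAt
  have h1 : ∫ x in A, h x ∂(gaussianReal 0 1) = ∫ x in A \ Ioi t, h x ∂(gaussianReal 0 1) +
      ∫ x in Ioi t, h x ∂(gaussianReal 0 1) := by
    rw [← setIntegral_union hdisj measurableSet_Ioi hi.integrableOn hi.integrableOn, hun]
  have h2 : (gaussianReal 0 1).real A = (gaussianReal 0 1).real (A \ Ioi t) + normalTail t := by
    rw [normalTail, ← measureReal_union hdisj measurableSet_Ioi, hun]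
  have h3 : ∫ x in A \ Ioi t, h x ∂(gaussianReal 0 1) ≤
      (gaussianReal 0 1).real (A \ Ioi t) * h t := by
    rw [← smul_eq_mul, ← setIntegral_const]
    exact setIntegral_mono_on hi.integrableOn (integrable_const _).integrableOn hAm
      fun x hx => hm (not_lt.1 hx.2)
  have h4 : normalTail t * h t ≤ ∫ x in Ioi t, h x ∂(gaussianReal 0 1) := by
    rw [normalTail, ← smul_eq_mul, ← setIntegral_const]
    exact setIntegral_mono_on (integrable_const _).integrableOn hi.integrableOn
      measurableSet_Ioi fun x hx => hm (le_of_lt hx)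
  rw [h1, h2]
  have h5 := normalTail_nonneg t
  have h6 : 0 ≤ (gaussianReal 0 1).real (A \ Ioi t) := measureReal_nonneg
  nlinarith

section Vector

variable {ι : Type*} [Fintype ι] [DecidableEq ι] {S : Matrix ι ι ℝ}

lemma setIntegral_eval_mem_eq (hS : S.PosSemidef) (h1 : ∀ i, S i i = 1) (i : ι)
    {g : (ι → ℝ) → ℝ} (hg : Measurable g) {C : ℝ} (hC : ∀ y, |g y| ≤ C) {A : Set ℝ}
    (hA : MeasurableSet A) :
    ∫ x in {x : EuclideanSpace ℝ ι | x i ∈ A}, g (fun j => x j) ∂(multivariateGaussian 0 S) =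
      ∫ r, ∫ x in A, g (fun j => S i j * x + r j) ∂(gaussianReal 0 1)
        ∂((multivariateGaussian 0 S).map (coordResidual S i)) := by
  set P := multivariateGaussian (0 : EuclideanSpace ℝ ι) S
  have : IsProbabilityMeasure (P.map (coordResidual S i)) :=
    Measure.isProbabilityMeasure_map (measurable_coordResidual i).aemeasurable
  have hpair := (indepFun_iff_hasLaw_prodMk_prod (map_eval_multivariateGaussian hS h1 i)
    (⟨(measurable_coordResidual i).aemeasurable, rfl⟩ :
      HasLaw (coordResidual S i) (P.map (coordResidual S i)) P)).1 (indepFun_coordResidual hS h1 i)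
  have hgm : Measurable fun p : ℝ × (ι → ℝ) => g (fun j => S i j * p.1 + p.2 j) :=
    hg.comp (by fun_prop)
  have hfm : Measurable fun p : ℝ × (ι → ℝ) =>
      A.indicator (fun x => g (fun j => S i j * x + p.2 j)) p.1 := by
    have : (fun p : ℝ × (ι → ℝ) => A.indicator (fun x => g (fun j => S i j * x + p.2 j)) p.1) =
        (Prod.fst ⁻¹' A).indicator fun p : ℝ × (ι → ℝ) => g (fun j => S i j * p.1 + p.2 j) := by
      rfl
    rw [this]
    exact hgm.indicator (measurable_fst hA)
  have hS' : MeasurableSet {x : EuclideanSpace ℝ ι | x i ∈ A} := by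
    have : Measurable fun x : EuclideanSpace ℝ ι => x i := by fun_prop
    exact this hA
  rw [← integral_indicator hS']
  have h2 : ∀ x : EuclideanSpace ℝ ι,
      {x : EuclideanSpace ℝ ι | x i ∈ A}.indicator (fun x => g (fun j => x j)) x =
        (fun p : ℝ × (ι → ℝ) => A.indicator (fun x => g (fun j => S i j * x + p.2 j)) p.1)
          (x i, coordResidual S i x) := fun x => by
    simp only [indicator, mem_ofPred_eq, ← coord_eq_add_coordResidual]
  simp_rw [h2]
  have hC0 : 0 ≤ C := (abs_nonneg _).trans (hC 0)
  have h3 := hpair.integral_comp hfm.aestronglyMeasurable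
  refine h3.trans ?_
  rw [integral_prod_symm]
  · refine integral_congr_ae (Eventually.of_forall fun r => ?_)
    exact integral_indicator hA
  · refine Integrable.of_bound (C := C) hfm.aestronglyMeasurable (Eventually.of_forall fun p => ?_)
    by_cases hp : p.1 ∈ A
    · simp only [indicator_of_mem hp]
      exact hC _
    · simp only [indicator_of_notMem hp, norm_zero, hC0]

/-- Conditioning coordinate `i` of a Gaussian vector on a higher half-line increases the mean of a
function that is monotone along the regression lines of the vector on coordinate `i`. -/
lemma setIntegral_eval_mul_normalTail_le (hS : S.PosSemidef) (h1 : ∀ i, S i i = 1) (i : ι)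
    {g : (ι → ℝ) → ℝ} (hg : Measurable g) {C : ℝ} (hC : ∀ y, |g y| ≤ C)
    (hmono : ∀ r : ι → ℝ, Monotone fun x : ℝ => g (fun j => S i j * x + r j)) {A : Set ℝ}
    (hA : MeasurableSet A) {t : ℝ} (hAt : Ioi t ⊆ A) :
    (∫ x in {x : EuclideanSpace ℝ ι | x i ∈ A}, g (fun j => x j) ∂(multivariateGaussian 0 S)) *
        normalTail t ≤
      (∫ x in {x : EuclideanSpace ℝ ι | t < x i}, g (fun j => x j)
        ∂(multivariateGaussian 0 S)) * (gaussianReal 0 1).real A := by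
  have := setIntegral_eval_mem_eq hS h1 i hg hC (measurableSet_Ioi (a := t))
  simp only [mem_Ioi] at this
  rw [this, setIntegral_eval_mem_eq hS h1 i hg hC hA, ← integral_mul_const, ← integral_mul_const]
  set ν := (multivariateGaussian (0 : EuclideanSpace ℝ ι) S).map (coordResidual S i)
  have : IsProbabilityMeasure ν :=
    Measure.isProbabilityMeasure_map (measurable_coordResidual i).aemeasurable
  have hgm : Measurable fun p : (ι → ℝ) × ℝ => g (fun j => S i j * p.2 + p.1 j) :=
    hg.comp (by fun_prop)
  have hint : ∀ B : Set ℝ, Integrable (fun r => ∫ x in B, g (fun j => S i j * x + r j)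
      ∂(gaussianReal 0 1)) ν := fun B => by
    refine Integrable.of_bound (C := C) ?_ (Eventually.of_forall fun r => ?_)
    · exact (hgm.stronglyMeasurable.integral_prod_right'
        (ν := (gaussianReal 0 1).restrict B)).aestronglyMeasurable
    · refine (norm_setIntegral_le_of_norm_le_const (C := C) (measure_lt_top _ _)
        fun x _ => hC _).trans ?_
      have hC0 : 0 ≤ C := (abs_nonneg _).trans (hC 0)
      exact mul_le_of_le_one_right hC0 measureReal_le_one
  refine integral_mono ((hint _).mul_const _) ((hint _).mul_const _) fun r => ?_
  refine setIntegral_mul_normalTail_le (hmono r) ?_ hA hAt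
  refine Integrable.of_bound (C := C) ?_ (Eventually.of_forall fun x => hC _)
  exact (hg.comp (by fun_prop)).aestronglyMeasurable

/-- Joint exceedances of negatively correlated coordinates are no likelier than under
independence. -/
lemma measureReal_both_exceed_le (hS : S.PosSemidef) (h1 : ∀ i, S i i = 1) {i j : ι}
    (hij : S i j ≤ 0) (t : ℝ) :
    (multivariateGaussian 0 S).real {x | t < x i ∧ t < x j} ≤ normalTail t * normalTail t := by
  have hm : ∀ l, MeasurableSet {x : EuclideanSpace ℝ ι | t < x l} := fun l =>
    measurableSet_lt measurable_const (by fun_prop)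
  have hg : Measurable fun y : ι → ℝ => -(Ioi t).indicator (1 : ℝ → ℝ) (y j) :=
    ((measurable_const.indicator measurableSet_Ioi).comp (measurable_pi_apply j)).neg
  have h := setIntegral_eval_mul_normalTail_le hS h1 i hg (C := 1) (fun y => by
      by_cases hy : t < y j <;> simp [indicator, hy])
    (fun r x x' hx => by
      have hle : S i j * x' + r j ≤ S i j * x + r j := by nlinarith
      simp only [neg_le_neg_iff]
      by_cases h' : t < S i j * x' + r j
      · rw [indicator_of_mem (by simpa using h'), indicator_of_mem (by simpa using h'.trans_le hle)]
        rfl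
      · rw [indicator_of_notMem (by simpa using h')]
        exact indicator_nonneg (fun _ _ => zero_le_one) _)
    MeasurableSet.univ (t := t) (subset_univ _)
  have hind : ∀ x : EuclideanSpace ℝ ι, (Ioi t).indicator (1 : ℝ → ℝ) (x j) =
      {x : EuclideanSpace ℝ ι | t < x j}.indicator 1 x := fun x => by simp [indicator]
  simp only [mem_univ, ofPred_true, Measure.restrict_univ, hind, integral_neg, probReal_univ,
    mul_one] at h
  rw [integral_indicator_one (hm j), integral_indicator_one (hm j), measureReal_exceed hS h1 j,
    measureReal_restrict_apply (hm j), inter_comm] at h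
  have h2 : {x : EuclideanSpace ℝ ι | t < x i} ∩ {x | t < x j} = {x | t < x i ∧ t < x j} := rfl
  rw [h2] at h
  linarith

end Vector

/-- The maximum of `c` and the first `n` terms of a sequence. -/
noncomputable def runningMax (c : ℝ) (u : ℕ → ℝ) : ℕ → ℝ
  | 0 => c
  | n + 1 => max (runningMax c u n) (u n)

lemma le_runningMax (c : ℝ) (u : ℕ → ℝ) (n : ℕ) : c ≤ runningMax c u n := by
  induction n with
  | zero => exact le_rfl
  | succ n ih => exact ih.trans (le_max_left _ _)

lemma le_runningMax_of_lt (c : ℝ) (u : ℕ → ℝ) {n t : ℕ} (h : t < n) :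
    u t ≤ runningMax c u n := by
  induction n with
  | zero => omega
  | succ n ih =>
    rcases Nat.lt_succ_iff_lt_or_eq.1 h with h | rfl
    · exact (ih h).trans (le_max_left _ _)
    · exact le_max_right _ _

lemma runningMax_le {c d : ℝ} {u : ℕ → ℝ} (hcd : c ≤ d) (hu : ∀ t, u t ≤ d) (n : ℕ) :
    runningMax c u n ≤ d := by
  induction n with
  | zero => exact hcd
  | succ n ih => exact max_le ih (hu n)

lemma runningMax_mono {c : ℝ} {u v : ℕ → ℝ} (h : ∀ t, u t ≤ v t) (n : ℕ) :
    runningMax c u n ≤ runningMax c v n := by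
  induction n with
  | zero => exact le_rfl
  | succ n ih => exact max_le_max ih (h n)

/-- The truncation of `a` to the interval `[c, 2 c]`. -/
noncomputable def truncRatio (c a : ℝ) : ℝ := max c (min a (2 * c))

lemma truncRatio_le {c : ℝ} (hc : 0 ≤ c) (a : ℝ) : truncRatio c a ≤ 2 * c :=
  max_le (by linarith) (min_le_right _ _)

lemma truncRatio_mono (c : ℝ) {a b : ℝ} (h : a ≤ b) : truncRatio c a ≤ truncRatio c b :=
  max_le_max le_rfl (min_le_min h le_rfl)

lemma truncRatio_add_le (c a : ℝ) {b : ℝ} (hb : 0 ≤ b) :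
    truncRatio c (a + b) ≤ truncRatio c a + b := by
  unfold truncRatio
  refine max_le (by linarith [le_max_left c (min a (2 * c))]) ?_
  have h := le_max_right c (min a (2 * c))
  rcases le_total a (2 * c) with h' | h'
  · rw [min_eq_left h'] at h ⊢
    linarith [min_le_left (a + b) (2 * c)]
  · rw [min_eq_right h'] at h ⊢
    linarith [min_le_right (a + b) (2 * c)]

lemma abs_runningMax_truncRatio_le {c : ℝ} (hc : 0 < c) (u : ℕ → ℝ) (n : ℕ) :
    |runningMax c (fun t => truncRatio c (u t)) n| ≤ 2 * c := by
  rw [abs_of_nonneg (hc.le.trans (le_runningMax _ _ _))]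
  exact runningMax_le (by linarith) (fun t => truncRatio_le hc.le _) n

section Maximal

variable {m : ℕ} {S : Matrix (Fin m) (Fin m) ℝ}

/-- The proportion, relative to all coordinates, of the coordinates in `J` that exceed `t`. -/
noncomputable def partialFraction (J : Finset (Fin m)) (y : Fin m → ℝ) (t : ℝ) : ℝ :=
  (∑ j ∈ J, (Ioi t).indicator (1 : ℝ → ℝ) (y j)) / m

lemma partialFraction_nonneg (J : Finset (Fin m)) (y : Fin m → ℝ) (t : ℝ) :
    0 ≤ partialFraction J y t :=
  div_nonneg (Finset.sum_nonneg fun _ _ => indicator_nonneg (fun _ _ => zero_le_one) _)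
    (Nat.cast_nonneg _)

lemma measurable_partialFraction (J : Finset (Fin m)) (t : ℝ) :
    Measurable fun y : Fin m → ℝ => partialFraction J y t :=
  (Finset.measurable_sum _ fun i _ =>
    (measurable_const.indicator measurableSet_Ioi).comp (measurable_pi_apply i)).div_const _

lemma measurable_runningMax {α : Type*} [MeasurableSpace α] {c : ℝ} {u : α → ℕ → ℝ}
    (hu : ∀ t, Measurable fun y => u y t) (n : ℕ) : Measurable fun y => runningMax c (u y) n := by
  induction n with
  | zero => exact measurable_const
  | succ n ih => exact ih.max (hu n)

/-- The running maximum of the truncated ratios of the exceedance proportion within `J` to the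
normal tail. -/
noncomputable def ratioMax (J : Finset (Fin m)) (c : ℝ) (n : ℕ) (y : Fin m → ℝ) : ℝ :=
  runningMax c (fun t : ℕ => truncRatio c (partialFraction J y t / normalTail t)) n

lemma measurable_ratioMax (J : Finset (Fin m)) (c : ℝ) (n : ℕ) : Measurable (ratioMax J c n) :=
  measurable_runningMax (fun t => measurable_const.max
    (((measurable_partialFraction J t).div_const _).min measurable_const)) n

lemma abs_ratioMax_le (J : Finset (Fin m)) {c : ℝ} (hc : 0 < c) (n : ℕ) (y : Fin m → ℝ) :
    |ratioMax J c n y| ≤ 2 * c := abs_runningMax_truncRatio_le hc _ n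

lemma le_ratioMax (J : Finset (Fin m)) (c : ℝ) (n : ℕ) (y : Fin m → ℝ) : c ≤ ratioMax J c n y :=
  le_runningMax _ _ _

lemma ratioMax_le_succ (J : Finset (Fin m)) (c : ℝ) (n : ℕ) (y : Fin m → ℝ) :
    ratioMax J c n y ≤ ratioMax J c (n + 1) y := le_max_left _ _

lemma integrable_ratioMax (J : Finset (Fin m)) {c : ℝ} (hc : 0 < c) (n : ℕ) :
    Integrable (fun x : EuclideanSpace ℝ (Fin m) => ratioMax J c n (fun j => x j))
      (multivariateGaussian 0 S) :=
  Integrable.of_bound ((measurable_ratioMax J c n).comp (by fun_prop)).aestronglyMeasurable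
    (2 * c) (Eventually.of_forall fun _ => abs_ratioMax_le J hc n _)

/-- The coordinates that are nonnegatively correlated with coordinate `i` exceed any level more
easily when coordinate `i` grows and its residuals stay fixed. -/
lemma monotone_ratioMax (i : Fin m) (c : ℝ) (n : ℕ) (r : Fin m → ℝ) :
    Monotone fun x : ℝ => ratioMax {j | 0 ≤ S i j} c n (fun j => S i j * x + r j) := by
  intro x x' hx
  refine runningMax_mono (fun t => truncRatio_mono c ?_) n
  refine div_le_div_of_nonneg_right ?_ (normalTail_nonneg _)
  refine div_le_div_of_nonneg_right (Finset.sum_le_sum fun j hj => ?_) (Nat.cast_nonneg _)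
  have hj' : 0 ≤ S i j := by simpa using hj
  have hle : S i j * x + r j ≤ S i j * x' + r j := by nlinarith
  by_cases h' : (t : ℝ) < S i j * x + r j
  · rw [indicator_of_mem (by simpa using h'), indicator_of_mem (by simpa using h'.trans_le hle)]
    rfl
  · rw [indicator_of_notMem (by simpa using h')]
    exact indicator_nonneg (fun _ _ => zero_le_one) _

/-- An increment of the running maximum over all coordinates is at most the increment over the
nonnegatively correlated ones plus the ratio contributed by the others. -/
lemma ratioMax_increment_le (i : Fin m) (c : ℝ) (n : ℕ) (y : Fin m → ℝ) :
    ratioMax Finset.univ c (n + 1) y - ratioMax Finset.univ c n y ≤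
      ratioMax {j | 0 ≤ S i j} c (n + 1) y - ratioMax {j | 0 ≤ S i j} c n y +
        partialFraction {j | ¬ 0 ≤ S i j} y n / normalTail n := by
  set J : Finset (Fin m) := {j | 0 ≤ S i j}
  set J' : Finset (Fin m) := {j | ¬ 0 ≤ S i j}
  have hΦ := normalTail_pos (n : ℝ)
  have hsplit : ∀ t : ℝ, partialFraction Finset.univ y t =
      partialFraction J y t + partialFraction J' y t := fun t => by
    unfold partialFraction
    rw [← add_div, Finset.sum_filter_add_sum_filter_not]
  have hle : ratioMax J c n y ≤ ratioMax Finset.univ c n y :=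
    runningMax_mono (fun t => truncRatio_mono c (by
      rw [hsplit]
      refine div_le_div_of_nonneg_right ?_ (normalTail_nonneg _)
      linarith [partialFraction_nonneg J' y t])) n
  have ha : 0 ≤ partialFraction J' y n / normalTail n :=
    div_nonneg (partialFraction_nonneg _ _ _) hΦ.le
  have hb : truncRatio c (partialFraction Finset.univ y n / normalTail n) ≤
      truncRatio c (partialFraction J y n / normalTail n) +
        partialFraction J' y n / normalTail n := by
    rw [hsplit, add_div]
    exact truncRatio_add_le c _ ha
  have hs : ∀ K : Finset (Fin m), ratioMax K c (n + 1) y =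
      max (ratioMax K c n y) (truncRatio c (partialFraction K y n / normalTail n)) := fun K => rfl
  rw [hs, hs, sub_le_iff_le_add]
  refine max_le ?_ ?_
  · linarith [le_max_left (ratioMax J c n y) (truncRatio c (partialFraction J y n / normalTail n))]
  · linarith [le_max_right (ratioMax J c n y) (truncRatio c (partialFraction J y n / normalTail n))]

/-- The expected total increase of the running maximum, when each increment is weighted by the
conditional law given that coordinate `i` exceeds the current level. Over the coordinates
nonnegatively correlated with `i` the sum telescopes, since the conditional means increase with the
level; a negatively correlated coordinate contributes at most its exceedance probability. -/
lemma sum_conditional_increment_le (hm : m ≠ 0) (hS : S.PosSemidef) (h1 : ∀ i, S i i = 1)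
    (i : Fin m) {c : ℝ} (hc : 0 < c) (N : ℕ) :
    ∑ n ∈ Finset.range N, (∫ x in {x : EuclideanSpace ℝ (Fin m) | (n : ℝ) < x i},
      (ratioMax Finset.univ c (n + 1) (fun j => x j) - ratioMax Finset.univ c n (fun j => x j))
        ∂(multivariateGaussian 0 S)) / normalTail n ≤ c + N := by
  set P := multivariateGaussian (0 : EuclideanSpace ℝ (Fin m)) S
  set J : Finset (Fin m) := {j | 0 ≤ S i j} with hJ
  set J' : Finset (Fin m) := {j | ¬ 0 ≤ S i j} with hJ'
  set E : ℕ → Set (EuclideanSpace ℝ (Fin m)) := fun n => {x | (n : ℝ) < x i} with hE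
  have hEm : ∀ l (n : ℕ), MeasurableSet {x : EuclideanSpace ℝ (Fin m) | (n : ℝ) < x l} :=
    fun l n => measurableSet_lt measurable_const (by fun_prop)
  have hm0 : (0 : ℝ) < m := by positivity
  have hpi : ∀ n : ℕ, Integrable (fun x : EuclideanSpace ℝ (Fin m) =>
      partialFraction J' (fun j => x j) n / normalTail n) P := fun n => by
    refine Integrable.div_const ?_ _
    refine Integrable.div_const (integrable_finsetSum _ fun j _ => ?_) _
    refine Integrable.of_bound (C := 1)
      ((measurable_const.indicator measurableSet_Ioi).comp (by fun_prop)).aestronglyMeasurable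
      (Eventually.of_forall fun x => ?_)
    by_cases h : (n : ℝ) < x j <;> simp [indicator, h]
  -- the conditional mean, given that coordinate `i` exceeds `n`, of the maximum of the first `k`
  -- ratios over the coordinates in `J`; the diagonal of `G` telescopes
  set G : ℕ → ℕ → ℝ := fun k n => (∫ x in E n, ratioMax J c k (fun j => x j) ∂P) / normalTail n
    with hG
  have hΦ : ∀ n : ℕ, 0 < normalTail n := fun n => normalTail_pos _
  -- the contribution of the coordinates negatively correlated with `i`
  have hneg : ∀ n : ℕ, (∫ x in E n, partialFraction J' (fun j => x j) n / normalTail n ∂P) /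
      normalTail n ≤ 1 := by
    intro n
    have hind : ∀ j (x : EuclideanSpace ℝ (Fin m)), (Ioi (n : ℝ)).indicator (1 : ℝ → ℝ) (x j) =
        {x : EuclideanSpace ℝ (Fin m) | (n : ℝ) < x j}.indicator 1 x := fun j x => by
      simp [indicator]
    have h2 : ∫ x in E n, partialFraction J' (fun j => x j) n ∂P =
        (∑ j ∈ J', P.real {x | (n : ℝ) < x i ∧ (n : ℝ) < x j}) / m := by
      simp_rw [partialFraction, hind]
      rw [integral_div, integral_finsetSum]
      · congr 1
        refine Finset.sum_congr rfl fun j _ => ?_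
        rw [integral_indicator_one (hEm j n), measureReal_restrict_apply (hEm j n), inter_comm]
        rfl
      · exact fun j _ => ((integrable_const (1 : ℝ)).indicator (hEm j n)).integrableOn
    rw [integral_div, h2, div_div, div_le_one (by have := hΦ n; positivity),
      div_le_iff₀ hm0]
    calc ∑ j ∈ J', P.real {x | (n : ℝ) < x i ∧ (n : ℝ) < x j}
        ≤ ∑ j ∈ J', normalTail n * normalTail n := Finset.sum_le_sum fun j hj =>
          measureReal_both_exceed_le hS h1 (by
            have : ¬ 0 ≤ S i j := by simpa [hJ'] using hj
            exact (not_le.1 this).le) _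
      _ = J'.card * (normalTail n * normalTail n) := by simp
      _ ≤ m * (normalTail n * normalTail n) := by
          refine mul_le_mul_of_nonneg_right ?_ (mul_self_nonneg _)
          have := Finset.card_le_univ J'
          rw [Fintype.card_fin] at this
          exact_mod_cast this
      _ = _ := mul_comm _ _
  have hstep : ∀ n : ℕ, (∫ x in E n,
      (ratioMax Finset.univ c (n + 1) (fun j => x j) - ratioMax Finset.univ c n (fun j => x j))
        ∂P) / normalTail n ≤ G (n + 1) n - G n n + 1 := by
    intro n
    have h2 : ∫ x in E n, (ratioMax Finset.univ c (n + 1) (fun j => x j) -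
        ratioMax Finset.univ c n (fun j => x j)) ∂P ≤
        ∫ x in E n, (ratioMax J c (n + 1) (fun j => x j) - ratioMax J c n (fun j => x j) +
          partialFraction J' (fun j => x j) n / normalTail n) ∂P := by
      refine integral_mono ?_ ?_ fun x => ratioMax_increment_le i c n _
      · exact ((integrable_ratioMax _ hc _).sub (integrable_ratioMax _ hc _)).integrableOn
      · exact (((integrable_ratioMax _ hc _).sub (integrable_ratioMax _ hc _)).add
          (hpi n)).integrableOn
    have h4 : ∫ x in E n, (ratioMax J c (n + 1) (fun j => x j) - ratioMax J c n (fun j => x j)) ∂P =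
        ∫ x in E n, ratioMax J c (n + 1) (fun j => x j) ∂P -
          ∫ x in E n, ratioMax J c n (fun j => x j) ∂P :=
      integral_sub (integrable_ratioMax _ hc _).integrableOn
        (integrable_ratioMax _ hc _).integrableOn
    rw [integral_add (by exact ((integrable_ratioMax _ hc _).sub
        (integrable_ratioMax _ hc _)).integrableOn) (hpi n).integrableOn, h4] at h2
    have h3 := div_le_div_of_nonneg_right h2 (hΦ n).le
    rw [add_div, sub_div] at h3
    linarith [hneg n]
  -- raising the conditioning level from `n` to `n + 1` increases the mean of a monotone function
  have hcheb : ∀ n : ℕ, G (n + 1) n ≤ G (n + 1) (n + 1) := by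
    intro n
    have h := setIntegral_eval_mul_normalTail_le hS h1 i (measurable_ratioMax J c (n + 1))
      (abs_ratioMax_le J hc (n + 1)) (monotone_ratioMax i c (n + 1))
      (measurableSet_Ioi (a := (n : ℝ))) (t := ((n + 1 : ℕ) : ℝ))
      (Ioi_subset_Ioi (by push_cast; linarith))
    simp only [mem_Ioi] at h
    rw [hG]
    simp only
    rw [div_le_div_iff₀ (hΦ n) (hΦ (n + 1))]
    exact h
  have hreal : ∀ n : ℕ, P.real (E n) = normalTail n := fun n => measureReal_exceed hS h1 i n
  have hup : G N N ≤ 2 * c := by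
    rw [hG]
    simp only
    rw [div_le_iff₀ (hΦ N)]
    calc ∫ x in E N, ratioMax J c N (fun j => x j) ∂P ≤ ∫ x in E N, 2 * c ∂P :=
          integral_mono (integrable_ratioMax _ hc _).integrableOn (integrable_const _)
            fun x => (le_abs_self _).trans (abs_ratioMax_le J hc N _)
      _ = _ := by rw [setIntegral_const, hreal, smul_eq_mul, mul_comm]
  have hlow : c ≤ G 0 0 := by
    rw [hG]
    simp only
    rw [le_div_iff₀ (hΦ 0)]
    calc c * normalTail (0 : ℕ) = ∫ x in E 0, c ∂P := by
          rw [setIntegral_const, hreal, smul_eq_mul, mul_comm]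
      _ ≤ _ := integral_mono (integrable_const _) (integrable_ratioMax _ hc _).integrableOn
            fun x => le_ratioMax J c 0 _
  calc _ ≤ ∑ n ∈ Finset.range N, (G (n + 1) (n + 1) - G n n + 1) :=
        Finset.sum_le_sum fun n _ => (hstep n).trans (by linarith [hcheb n])
    _ = G N N - G 0 0 + N := by
        rw [Finset.sum_add_distrib, Finset.sum_range_sub (fun n => G n n)]
        simp
    _ ≤ _ := by linarith

/-- A weak-type maximal inequality: the probability that some exceedance proportion at an integer
level below `N` is at least `2 c` times its mean is of order `1 / c` as long as `N = O(c)`, whatever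
the correlations. A union bound would only give `N / c`. -/
theorem measureReal_exists_exceedFraction_ge_le (hm : m ≠ 0) (hS : S.PosSemidef)
    (h1 : ∀ i, S i i = 1) {c : ℝ} (hc : 0 < c) (N : ℕ) :
    (multivariateGaussian 0 S).real {x : EuclideanSpace ℝ (Fin m) |
      ∃ t < N, 2 * c * normalTail (t : ℕ) ≤ exceedFraction (fun i => x i) (t : ℕ)} ≤
      (c + N) / c ^ 2 := by
  set P := multivariateGaussian (0 : EuclideanSpace ℝ (Fin m)) S
  set M : ℕ → EuclideanSpace ℝ (Fin m) → ℝ := fun n x => ratioMax Finset.univ c n (fun j => x j)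
    with hM
  have hm0 : (0 : ℝ) < m := by positivity
  have hF : ∀ (x : EuclideanSpace ℝ (Fin m)) (t : ℝ),
      partialFraction Finset.univ (fun j => x j) t = exceedFraction (fun i => x i) t :=
    fun x t => by rw [exceedFraction_eq, partialFraction]
  have hMi : ∀ n, Integrable (M n) P := fun n => integrable_ratioMax _ hc n
  have hΦ : ∀ n : ℕ, 0 < normalTail n := fun n => normalTail_pos _
  set B := {x : EuclideanSpace ℝ (Fin m) |
      ∃ t < N, 2 * c * normalTail (t : ℕ) ≤ exceedFraction (fun i => x i) (t : ℕ)} with hB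
  have hsub : B ⊆ {x | c ≤ M N x - c} := by
    rintro x ⟨t, htN, ht⟩
    have h2 : 2 * c ≤ truncRatio c (partialFraction Finset.univ (fun j => x j) t / normalTail t) := by
      rw [hF]
      refine le_max_of_le_right (le_min ?_ le_rfl)
      rwa [le_div_iff₀ (hΦ t)]
    have h3 := h2.trans (le_runningMax_of_lt c (fun t : ℕ => truncRatio c
      (partialFraction Finset.univ (fun j => x j) t / normalTail t)) htN)
    have h4 : 2 * c ≤ M N x := h3
    simp only [mem_ofPred_eq]
    linarith
  have hmarkov : c * P.real B ≤ ∫ x, (M N x - c) ∂P := by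
    refine le_trans ?_ (mul_meas_ge_le_integral_of_nonneg
      (Eventually.of_forall fun x => sub_nonneg.2 (le_ratioMax _ _ _ _))
      ((hMi N).sub (integrable_const c)) c)
    exact mul_le_mul_of_nonneg_left (measureReal_mono hsub) hc.le
  have htel : ∀ x, M N x - c = ∑ n ∈ Finset.range N, (M (n + 1) x - M n x) := fun x => by
    rw [Finset.sum_range_sub (fun n => M n x)]
    rfl
  have hincr : ∀ (n : ℕ) x, M (n + 1) x - M n x ≤
      c⁻¹ * ((M (n + 1) x - M n x) * (exceedFraction (fun i => x i) (n : ℕ) / normalTail n)) := by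
    intro n x
    have h0 : 0 ≤ M (n + 1) x - M n x := sub_nonneg.2 (ratioMax_le_succ _ _ _ _)
    by_cases ha : c ≤ exceedFraction (fun i => x i) (n : ℕ) / normalTail n
    · rw [inv_mul_eq_div, le_div_iff₀ hc]
      exact mul_le_mul_of_nonneg_left ha h0
    · have h2 : M (n + 1) x = M n x := by
        have : truncRatio c (partialFraction Finset.univ (fun j => x j) n / normalTail n) = c := by
          rw [hF]
          exact max_eq_left ((min_le_left _ _).trans (not_le.1 ha).le)
        change max (M n x) (truncRatio c _) = M n x
        rw [this]
        exact max_eq_left (le_ratioMax _ _ _ _)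
      rw [h2]
      simp
  have hEm : ∀ l (n : ℕ), MeasurableSet {x : EuclideanSpace ℝ (Fin m) | (n : ℝ) < x l} :=
    fun l n => measurableSet_lt measurable_const (by fun_prop)
  have hind : ∀ (n : ℕ) j (x : EuclideanSpace ℝ (Fin m)),
      (Ioi (n : ℝ)).indicator (1 : ℝ → ℝ) (x j) =
        {x : EuclideanSpace ℝ (Fin m) | (n : ℝ) < x j}.indicator 1 x := fun n j x => by
    simp [indicator]
  have hexp : ∀ (n : ℕ) x, (M (n + 1) x - M n x) *
      (exceedFraction (fun i => x i) (n : ℕ) / normalTail n) =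
      (∑ i, {x : EuclideanSpace ℝ (Fin m) | (n : ℝ) < x i}.indicator
        (fun x => M (n + 1) x - M n x) x) / (m * normalTail n) := by
    intro n x
    rw [exceedFraction_eq, div_div, mul_div_assoc', Finset.mul_sum]
    congr 1
    refine Finset.sum_congr rfl fun i _ => ?_
    rw [hind]
    by_cases hx : (n : ℝ) < x i <;> simp [indicator, hx]
  have hii : ∀ (n : ℕ) (i : Fin m), Integrable ({x : EuclideanSpace ℝ (Fin m) | (n : ℝ) < x i}.indicator
        (fun x => M (n + 1) x - M n x)) P := fun n i =>
    ((hMi (n + 1)).sub (hMi n)).indicator (hEm i n)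
  have hmain : ∀ n : ℕ, ∫ x, (M (n + 1) x - M n x) ∂P ≤
      c⁻¹ * ((∑ i, (∫ x in {x : EuclideanSpace ℝ (Fin m) | (n : ℝ) < x i},
        (M (n + 1) x - M n x) ∂P) / normalTail n) / m) := by
    intro n
    calc ∫ x, (M (n + 1) x - M n x) ∂P ≤ ∫ x, c⁻¹ * ((∑ i,
          {x : EuclideanSpace ℝ (Fin m) | (n : ℝ) < x i}.indicator
            (fun x => M (n + 1) x - M n x) x) / (m * normalTail n)) ∂P := by
          refine integral_mono ((hMi (n + 1)).sub (hMi n)) ?_ fun x => ?_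
          · exact ((integrable_finsetSum _ fun i _ => hii n i).div_const _).const_mul _
          · have := hincr n x
            rwa [hexp] at this
      _ = _ := by
          rw [integral_const_mul, integral_div, integral_finsetSum _ fun i _ => hii n i]
          simp_rw [integral_indicator (hEm _ n)]
          rw [← Finset.sum_div, div_div, mul_comm (m : ℝ)]
  have htotal : ∫ x, (M N x - c) ∂P ≤ c⁻¹ * (c + N) := by
    simp_rw [htel]
    rw [integral_finsetSum _ fun n _ => by exact (hMi (n + 1)).sub (hMi n)]
    calc _ ≤ ∑ n ∈ Finset.range N, c⁻¹ *
          ((∑ i, (∫ x in {x : EuclideanSpace ℝ (Fin m) | (n : ℝ) < x i},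
            (M (n + 1) x - M n x) ∂P) / normalTail n) / m) := Finset.sum_le_sum fun n _ => hmain n
      _ = c⁻¹ * ((∑ i, ∑ n ∈ Finset.range N,
            (∫ x in {x : EuclideanSpace ℝ (Fin m) | (n : ℝ) < x i},
              (M (n + 1) x - M n x) ∂P) / normalTail n) / m) := by
          rw [← Finset.mul_sum, ← Finset.sum_div, Finset.sum_comm]
      _ ≤ c⁻¹ * ((∑ i : Fin m, (c + N)) / m) := by
          gcongr with i _
          exact sum_conditional_increment_le hm hS h1 i hc N
      _ = _ := by
          simp only [Finset.sum_const, Finset.card_univ, Fintype.card_fin, nsmul_eq_mul]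
          field_simp
  have h5 := hmarkov.trans htotal
  rw [le_div_iff₀ (by positivity)]
  rw [inv_mul_eq_div, le_div_iff₀ hc] at h5
  linarith

end Maximal

/-! ### The residual correlation matrix -/

namespace PFAModel

variable {m k : ℕ} (M : PFAModel m k)

lemma eigval_nonneg (j : Fin m) : 0 ≤ M.eigval j := by
  have h1 : M.eigvec.conjTranspose * M.corr * M.eigvec = Matrix.diagonal M.eigval := by
    rw [Matrix.conjTranspose_eq_transpose_of_trivial, M.spectral]
    calc _ = (M.eigvec.transpose * M.eigvec) * Matrix.diagonal M.eigval *
          (M.eigvec.transpose * M.eigvec) := by simp only [Matrix.mul_assoc]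
      _ = _ := by rw [M.orthonormal, Matrix.one_mul, Matrix.mul_one]
  have h2 := (M.posSemidef.conjTranspose_mul_mul_same M.eigvec).diag_nonneg (i := j)
  rw [h1] at h2
  simpa using h2

lemma norm_b_sq (i : Fin m) : ‖M.b i‖ ^ 2 =
    ∑ j : Fin m with j.val < k, M.eigval j * M.eigvec i j * M.eigvec i j := by
  rw [EuclideanSpace.real_norm_sq_eq]
  have h1 : (Finset.univ.filter fun j : Fin m => j.val < k) =
      Finset.univ.map (Fin.castLEEmb M.k_le) := by
    ext j
    simp only [Finset.mem_filter_univ, Finset.mem_map, Finset.mem_univ, true_and]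
    exact ⟨fun h => ⟨⟨j, h⟩, rfl⟩, by rintro ⟨a, rfl⟩; exact a.2⟩
  rw [h1, Finset.sum_map]
  refine Finset.sum_congr rfl fun j _ => ?_
  simp only [b, Fin.castLEEmb_apply]
  rw [mul_pow, Real.sq_sqrt (M.eigval_nonneg _)]
  ring

lemma A_apply_self (i : Fin m) : M.A i i = 1 - ‖M.b i‖ ^ 2 := by
  have h1 : ∑ j, M.eigval j * M.eigvec i j * M.eigvec i j = 1 := by
    rw [← M.diag_one i]
    conv_rhs => rw [M.spectral]
    rw [Matrix.mul_apply]
    refine Finset.sum_congr rfl fun j _ => ?_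
    rw [Matrix.mul_diagonal, Matrix.transpose_apply]
    ring
  rw [norm_b_sq, ← h1, ← Finset.sum_filter_add_sum_filter_not Finset.univ
    (fun j : Fin m => j.val < k)]
  simp [A]

lemma A_self_pos (i : Fin m) : 0 < M.A i i := M.residual_pos i

lemma a_eq (i : Fin m) : M.a i = (√(M.A i i))⁻¹ := by rw [a, A_apply_self]

lemma a_pos (i : Fin m) : 0 < M.a i := by
  rw [a_eq]
  exact inv_pos.2 (Real.sqrt_pos.2 (M.A_self_pos i))

lemma norm_b_le_one (i : Fin m) : ‖M.b i‖ ≤ 1 := by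
  have h1 := M.A_self_pos i
  rw [A_apply_self] at h1
  nlinarith [norm_nonneg (M.b i)]

lemma one_le_a (i : Fin m) : 1 ≤ M.a i := by
  rw [a_eq]
  refine (one_le_inv₀ (Real.sqrt_pos.2 (M.A_self_pos i))).2 (Real.sqrt_le_one.2 ?_)
  rw [A_apply_self]
  nlinarith [sq_nonneg ‖M.b i‖]

lemma aMin_le (i : Fin m) : M.aMin ≤ M.a i := ciInf_le (finite_range _).bddBelow i

lemma le_aMax (i : Fin m) : M.a i ≤ M.aMax := le_ciSup (finite_range _).bddAbove i

lemma one_le_aMin (hm : m ≠ 0) : 1 ≤ M.aMin := by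
  have : Nonempty (Fin m) := Fin.pos_iff_nonempty.1 (Nat.pos_of_ne_zero hm)
  exact le_ciInf M.one_le_a

lemma aMin_le_aMax (hm : m ≠ 0) : M.aMin ≤ M.aMax :=
  (M.aMin_le ⟨0, Nat.pos_of_ne_zero hm⟩).trans (M.le_aMax _)

lemma posSemidef_A : M.A.PosSemidef := by
  have h1 : M.A = M.eigvec * Matrix.diagonal (fun j : Fin m => if k ≤ j.val then M.eigval j else 0) *
      M.eigvec.conjTranspose := by
    ext i i'
    rw [Matrix.conjTranspose_eq_transpose_of_trivial, Matrix.mul_apply]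
    simp only [A, Matrix.of_apply, Matrix.mul_diagonal, Matrix.transpose_apply]
    rw [Finset.sum_filter]
    refine Finset.sum_congr rfl fun j _ => ?_
    split_ifs <;> ring
  rw [h1]
  refine Matrix.PosSemidef.mul_mul_conjTranspose_same ?_ _
  refine Matrix.posSemidef_diagonal_iff.2 fun j => ?_
  split_ifs
  · exact M.eigval_nonneg j
  · exact le_rfl

lemma adjCorr_apply (i j : Fin m) : M.adjCorr i j = M.a i * M.A i j * M.a j := by
  simp only [adjCorr, Matrix.of_apply, a_eq]
  rw [Real.sqrt_mul (M.A_self_pos i).le]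
  have h1 := Real.sqrt_pos.2 (M.A_self_pos i)
  have h2 := Real.sqrt_pos.2 (M.A_self_pos j)
  field_simp

lemma adjCorr_self (i : Fin m) : M.adjCorr i i = 1 := by
  simp only [adjCorr, Matrix.of_apply]
  rw [Real.sqrt_mul_self (M.A_self_pos i).le, div_self (M.A_self_pos i).ne']

lemma posSemidef_adjCorr : M.adjCorr.PosSemidef := by
  have h1 : M.adjCorr = Matrix.diagonal M.a * M.A * (Matrix.diagonal M.a).conjTranspose := by
    ext i j
    rw [adjCorr_apply, Matrix.diagonal_conjTranspose, Matrix.mul_diagonal, Matrix.diagonal_mul]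
    simp
  rw [h1]
  exact M.posSemidef_A.mul_mul_conjTranspose_same _

instance isProbabilityMeasure_nullLaw : IsProbabilityMeasure M.nullLaw := by
  unfold nullLaw
  infer_instance

/-- The errors rescaled to unit variance. -/
noncomputable def scaledErrors (e : EuclideanSpace ℝ (Fin m)) : EuclideanSpace ℝ (Fin m) :=
  WithLp.toLp 2 fun i => M.a i * e i

@[simp] lemma scaledErrors_apply (e : EuclideanSpace ℝ (Fin m)) (i : Fin m) :
    M.scaledErrors e i = M.a i * e i := rfl

lemma measurable_scaledErrors : Measurable M.scaledErrors := by
  unfold scaledErrors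
  fun_prop

lemma hasLaw_scaledErrors {Ω : Type*} [MeasurableSpace Ω] {P : Measure Ω}
    {K : Ω → EuclideanSpace ℝ (Fin m)} (hK : HasLaw K (multivariateGaussian 0 M.A) P) :
    HasLaw (fun ω => M.scaledErrors (K ω)) M.nullLaw P := by
  have h : HasLaw M.scaledErrors M.nullLaw (multivariateGaussian 0 M.A) := by
    refine ⟨M.measurable_scaledErrors.aemeasurable, ?_⟩
    have : IsProbabilityMeasure ((multivariateGaussian 0 M.A).map M.scaledErrors) :=
      Measure.isProbabilityMeasure_map M.measurable_scaledErrors.aemeasurable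
    refine Measure.ext_of_charFun ?_
    ext t
    have h1 : charFun ((multivariateGaussian 0 M.A).map M.scaledErrors) t =
        charFun (multivariateGaussian 0 M.A) (M.scaledErrors t) := by
      rw [charFun_apply, charFun_apply, integral_map M.measurable_scaledErrors.aemeasurable
        (by fun_prop)]
      congr 1 with x
      congr 3
      simp only [PiLp.inner_apply, scaledErrors_apply, RCLike.inner_apply, conj_trivial]
      refine Finset.sum_congr rfl fun i _ => ?_
      ring
    rw [h1, nullLaw, charFun_multivariateGaussian M.posSemidef_A,
      charFun_multivariateGaussian M.posSemidef_adjCorr]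
    congr 2
    · simp
    · congr 2
      simp only [dotProduct, Matrix.mulVec, scaledErrors_apply, adjCorr_apply, Finset.mul_sum]
      refine Finset.sum_congr rfl fun i _ => Finset.sum_congr rfl fun j _ => ?_
      ring
  exact h.comp hK

end PFAModel

/-! ### The least-absolute-deviation estimate of the factors -/

/-- The quadratic form of the kernel `κ` at the weights `ξ`. -/
def kernelForm {ι : Type*} [Fintype ι] (κ : ι → ι → ℝ) (ξ : ι → ℝ) : ℝ :=
  ∑ i, ∑ j, κ i j * (ξ i * ξ j)

section Kernel

variable {ι : Type*} [Fintype ι] {k : ℕ}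

lemma sum_indicator_one_eq_ncard (A : Set ι) : ∑ i, A.indicator (1 : ι → ℝ) i = (A.ncard : ℝ) := by
  classical
  rw [Set.ncard_eq_toFinset_card']
  simp [indicator]

lemma norm_sq_sum_smul_eq (b : ι → EuclideanSpace ℝ (Fin k)) (ξ : ι → ℝ) :
    ‖∑ i, ξ i • b i‖ ^ 2 = kernelForm (fun i j => inner ℝ (b i) (b j)) ξ := by
  rw [← real_inner_self_eq_norm_sq, kernelForm, sum_inner]
  refine Finset.sum_congr rfl fun i _ => ?_
  rw [inner_sum]
  refine Finset.sum_congr rfl fun j _ => ?_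
  rw [real_inner_smul_left, real_inner_smul_right]
  ring

/-- A weighted sum of squared loadings, as a quadratic form in the direction `u`, is bounded by the
Frobenius norm of its matrix. -/
lemma sq_sum_mul_inner_sq_le (b : ι → EuclideanSpace ℝ (Fin k)) (ξ : ι → ℝ)
    (u : EuclideanSpace ℝ (Fin k)) :
    (∑ i, ξ i * inner ℝ (b i) u ^ 2) ^ 2 ≤
      (‖u‖ ^ 2) ^ 2 * kernelForm (fun i j => inner ℝ (b i) (b j) ^ 2) ξ := by
  have hin : ∀ v w : EuclideanSpace ℝ (Fin k), inner ℝ v w = ∑ p, v p * w p := fun v w => by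
    simp only [PiLp.inner_apply, RCLike.inner_apply, conj_trivial]
    exact Finset.sum_congr rfl fun _ _ => mul_comm _ _
  have hsq : ∀ v w : EuclideanSpace ℝ (Fin k), inner ℝ v w ^ 2 =
      ∑ p : Fin k × Fin k, (v p.1 * v p.2) * (w p.1 * w p.2) := fun v w => by
    rw [hin, sq, Finset.sum_mul_sum, Fintype.sum_prod_type]
    refine Finset.sum_congr rfl fun p _ => Finset.sum_congr rfl fun q _ => ?_
    ring
  have h1 : ∑ i, ξ i * inner ℝ (b i) u ^ 2 =
      ∑ p : Fin k × Fin k, (u p.1 * u p.2) * ∑ i, ξ i * (b i p.1 * b i p.2) := by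
    simp_rw [hsq, Finset.mul_sum]
    rw [Finset.sum_comm]
    refine Finset.sum_congr rfl fun p _ => Finset.sum_congr rfl fun q _ => ?_
    ring
  have h2 : (‖u‖ ^ 2) ^ 2 = ∑ p : Fin k × Fin k, (u p.1 * u p.2) ^ 2 := by
    rw [← real_inner_self_eq_norm_sq, hsq]
    exact Finset.sum_congr rfl fun _ _ => by ring
  have h3 : kernelForm (fun i j => inner ℝ (b i) (b j) ^ 2) ξ =
      ∑ p : Fin k × Fin k, (∑ i, ξ i * (b i p.1 * b i p.2)) ^ 2 := by
    simp_rw [sq (∑ i, ξ i * _), Finset.sum_mul_sum]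
    rw [Finset.sum_comm, kernelForm]
    refine Finset.sum_congr rfl fun i _ => ?_
    rw [Finset.sum_comm]
    refine Finset.sum_congr rfl fun j _ => ?_
    rw [hsq, Finset.sum_mul]
    refine Finset.sum_congr rfl fun p _ => ?_
    ring
  rw [h1, h2, h3]
  exact Finset.sum_mul_sq_le_sq_mul_sq _ _ _

lemma sq_sum_eq_kernelForm (ξ : ι → ℝ) : (∑ i, ξ i) ^ 2 = kernelForm (fun _ _ => 1) ξ := by
  rw [sq, Finset.sum_mul_sum, kernelForm]
  simp

end Kernel

/-- The mass of `(-x, x]` under the standard normal distribution. -/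
noncomputable def centralMass (x : ℝ) : ℝ := normalTail (-x) - normalTail x

lemma le_centralMass {x : ℝ} (h0 : 0 ≤ x) (h1 : x ≤ 1) : x / 3 ≤ centralMass x := by
  have h := le_normalTail_sub_of_bound (a := -x) (b := x) (C := 1 / 2) (by linarith) fun y hy => by
    have hy2 : y ^ 2 ≤ 1 := by nlinarith [hy.1, hy.2]
    have := Real.add_one_le_exp (-y ^ 2 / 2)
    rw [gaussExp]
    linarith
  unfold centralMass
  linarith

/-- The gain in absolute deviation at a shift `y` is at least linear with the sign of the error,
and of order `|y|` if the error is small. -/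
lemma abs_sub_sub_abs_ge {a e y r ε x₀ : ℝ} (hr : 0 < r) (ha : 0 < a) (hx₀ : 0 < x₀)
    (hax : x₀ ≤ a * (ε * r)) (hy : |y| ≤ r) :
    -y * (centredExceed x₀ (a * e) + centredExceed (-x₀) (a * e)) +
      (centredExceed (-x₀) (a * e) - centredExceed x₀ (a * e) + centralMass x₀) *
        (y ^ 2 / r - 2 * (ε * r)) ≤ |e - y| - |e| := by
  have hs := normalTail_neg x₀
  unfold centralMass centredExceed
  by_cases h1 : x₀ < a * e
  · have h2 : -x₀ < a * e := by linarith
    have he : 0 < e := by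
      by_contra hn
      nlinarith
    rw [indicator_of_mem (by simpa using h1), indicator_of_mem (by simpa using h2), abs_of_pos he]
    simp only [Pi.one_apply]
    have h4 := le_abs_self (e - y)
    rw [hs]
    generalize |e - y| = q at h4 ⊢
    ring_nf
    linarith
  · by_cases h2 : -x₀ < a * e
    · rw [indicator_of_notMem (by simpa using h1), indicator_of_mem (by simpa using h2)]
      simp only [Pi.one_apply]
      have h3 : |e| ≤ ε * r := by
        have h4 : a * |e| ≤ x₀ := by
          have h5 : |a * e| ≤ x₀ := abs_le.2 ⟨h2.le, not_lt.1 h1⟩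
          rwa [abs_mul, abs_of_pos ha] at h5
        exact le_of_mul_le_mul_left (h4.trans hax) ha
      have h4 : y ^ 2 / r ≤ |y| := by
        rw [div_le_iff₀ hr, ← sq_abs, sq]
        exact mul_le_mul_of_nonneg_left hy (abs_nonneg _)
      have h5 : |y| - |e| ≤ |e - y| := by
        rw [abs_sub_comm]
        exact abs_sub_abs_le_abs_sub y e
      rw [hs]
      generalize |e - y| = q at h5 ⊢
      generalize y ^ 2 / r = q' at h4 ⊢
      ring_nf
      linarith
    · have he : e < 0 := by
        by_contra hn
        have := mul_nonneg ha.le (not_lt.1 hn)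
        linarith
      rw [indicator_of_notMem (by simpa using h1), indicator_of_notMem (by simpa using h2),
        abs_of_neg he]
      have h4 := neg_abs_le (e - y)
      rw [hs]
      generalize |e - y| = q at h4 ⊢
      ring_nf
      linarith

namespace PFAModel

variable {m k : ℕ} (M : PFAModel m k)

lemma abs_inner_b_le (i : Fin m) (u : EuclideanSpace ℝ (Fin k)) : |inner ℝ (M.b i) u| ≤ ‖u‖ :=
  (abs_real_inner_le_norm _ _).trans (mul_le_of_le_one_left (norm_nonneg _) (M.norm_b_le_one i))

/-- The selection weight of index `i` times the centred exceedance of its standardised error. -/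
noncomputable def selectedExceed (I : Set (Fin m)) (e : EuclideanSpace ℝ (Fin m)) (s : ℝ)
    (i : Fin m) : ℝ :=
  I.indicator 1 i * centredExceed s (M.scaledErrors e i)

lemma l1Loss_eq (I : Set (Fin m)) (x : Fin m → ℝ) (β : EuclideanSpace ℝ (Fin k)) :
    M.l1Loss I x β = ∑ i, I.indicator (1 : Fin m → ℝ) i * |x i - inner ℝ (M.b i) β| := by
  unfold l1Loss
  refine Finset.sum_congr rfl fun i _ => ?_
  by_cases h : i ∈ I <;> simp [h]

/-- On the sphere of radius `r` around the factors the criterion exceeds its value at the factors,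
provided that all fluctuations are below the bound `B`. -/
lemma l1Loss_lt_of_norm_eq {I : Set (Fin m)} {x : Fin m → ℝ} {w δ : EuclideanSpace ℝ (Fin k)}
    {e : EuclideanSpace ℝ (Fin m)} (hx : ∀ i ∈ I, x i = inner ℝ (M.b i) w + e i)
    {r θ ε B : ℝ} (hr : 0 < r) (hε : 0 < ε) (hε1 : ε ≤ 1) (hB : 0 ≤ B) (hδ : ‖δ‖ = r)
    (hx₀ : 0 < M.aMin * (ε * r))
    (hθ : θ * m * r ^ 2 ≤ ∑ i, I.indicator (1 : Fin m → ℝ) i * inner ℝ (M.b i) δ ^ 2)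
    (hlin : ∀ s ∈ ({M.aMin * (ε * r), -(M.aMin * (ε * r))} : Set ℝ),
      kernelForm (fun i j => inner ℝ (M.b i) (M.b j)) (M.selectedExceed I e s) ≤ B ^ 2)
    (hquad : ∀ s ∈ ({M.aMin * (ε * r), -(M.aMin * (ε * r))} : Set ℝ),
      kernelForm (fun i j => inner ℝ (M.b i) (M.b j) ^ 2) (M.selectedExceed I e s) ≤ B ^ 2)
    (hcount : ∀ s ∈ ({M.aMin * (ε * r), -(M.aMin * (ε * r))} : Set ℝ),
      kernelForm (fun _ _ => 1) (M.selectedExceed univ e s) ≤ B ^ 2)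
    (hmain : 8 * B < centralMass (M.aMin * (ε * r)) * m * (θ - 2 * ε)) :
    M.l1Loss I x w < M.l1Loss I x (w + δ) := by
  set x₀ := M.aMin * (ε * r) with hx₀def
  set p := centralMass x₀ with hp
  have hp0 : 0 ≤ p := sub_nonneg.2 (normalTail_antitone (by linarith))
  set ω : Fin m → ℝ := fun i => I.indicator 1 i with hω
  have hω0 : ∀ i, 0 ≤ ω i := fun i => indicator_nonneg (fun _ _ => zero_le_one) i
  have hω1 : ∀ i, ω i ≤ 1 := fun i => indicator_le_self' (fun _ _ => zero_le_one) i
  set y : Fin m → ℝ := fun i => inner ℝ (M.b i) δ with hy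
  have hyr : ∀ i, |y i| ≤ r := fun i => hδ ▸ M.abs_inner_b_le i δ
  set H : ℝ → Fin m → ℝ := fun s i => centredExceed s (M.a i * e i) with hH
  have hsel : ∀ s i, M.selectedExceed I e s i = ω i * H s i := fun s i => rfl
  have hselu : ∀ s i, M.selectedExceed univ e s i = H s i := fun s i => by
    simp [selectedExceed, hH]
  -- linear fluctuations, quadratic ones, and those of the number of small errors
  have hA : ∀ s ∈ ({x₀, -x₀} : Set ℝ), ∑ i, ω i * (y i * H s i) ≤ r * B := by
    intro s hs
    have h1 := hlin s hs
    rw [← norm_sq_sum_smul_eq] at h1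
    have h2 := le_of_sq_le_sq h1 hB
    have h3 : ∑ i, ω i * (y i * H s i) = inner ℝ (∑ i, M.selectedExceed I e s i • M.b i) δ := by
      rw [sum_inner]
      refine Finset.sum_congr rfl fun i _ => ?_
      rw [real_inner_smul_left, hsel]
      ring
    rw [h3]
    refine (real_inner_le_norm _ _).trans ?_
    rw [hδ, mul_comm]
    exact mul_le_mul_of_nonneg_left h2 hr.le
  have hQ : ∀ s ∈ ({x₀, -x₀} : Set ℝ), |∑ i, ω i * H s i * y i ^ 2| ≤ r ^ 2 * B := by
    intro s hs
    have h1 := sq_sum_mul_inner_sq_le M.b (M.selectedExceed I e s) δ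
    rw [hδ] at h1
    refine abs_le_of_sq_le_sq (h1.trans ?_) (by positivity)
    rw [mul_pow]
    exact mul_le_mul_of_nonneg_left (hquad s hs) (by positivity)
  have hN : ∀ s ∈ ({x₀, -x₀} : Set ℝ), |∑ i, H s i| ≤ B := by
    intro s hs
    have h1 := hcount s hs
    rw [← sq_sum_eq_kernelForm] at h1
    simp only [hselu] at h1
    exact abs_le_of_sq_le_sq h1 hB
  have hxp : x₀ ∈ ({x₀, -x₀} : Set ℝ) := by simp
  have hxn : -x₀ ∈ ({x₀, -x₀} : Set ℝ) := by simp
  -- `H (-x₀) i - H x₀ i + p` is the indicator that the standardised error lies in `(-x₀, x₀]`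
  have hJ0 : ∀ i, 0 ≤ H (-x₀) i - H x₀ i + p := by
    intro i
    simp only [hH, centredExceed, hp, centralMass]
    have : (Ioi x₀).indicator (1 : ℝ → ℝ) (M.a i * e i) ≤ (Ioi (-x₀)).indicator 1 (M.a i * e i) :=
      indicator_le_indicator_of_subset (Ioi_subset_Ioi (by linarith)) (fun _ => zero_le_one) _
    linarith
  have hdiff : M.l1Loss I x (w + δ) - M.l1Loss I x w = ∑ i, ω i * (|e i - y i| - |e i|) := by
    rw [l1Loss_eq, l1Loss_eq, ← Finset.sum_sub_distrib]
    refine Finset.sum_congr rfl fun i _ => ?_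
    by_cases hi : i ∈ I
    · rw [hx i hi, inner_add_right]
      simp only [hω, hy, indicator_of_mem hi, Pi.one_apply, one_mul]
      congr 2 <;> ring
    · simp [hω, indicator_of_notMem hi]
  have hlow : ∑ i, ω i * (-y i * (H x₀ i + H (-x₀) i) +
      (H (-x₀) i - H x₀ i + p) * (y i ^ 2 / r - 2 * (ε * r))) ≤
      ∑ i, ω i * (|e i - y i| - |e i|) := by
    refine Finset.sum_le_sum fun i _ => mul_le_mul_of_nonneg_left ?_ (hω0 i)
    refine abs_sub_sub_abs_ge hr (M.a_pos i) hx₀ ?_ (hyr i)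
    exact mul_le_mul_of_nonneg_right (M.aMin_le i) (by positivity)
  have hexp : ∑ i, ω i * (-y i * (H x₀ i + H (-x₀) i) +
      (H (-x₀) i - H x₀ i + p) * (y i ^ 2 / r - 2 * (ε * r))) =
      -∑ i, ω i * (y i * H x₀ i) - ∑ i, ω i * (y i * H (-x₀) i) +
      (∑ i, ω i * H (-x₀) i * y i ^ 2 - ∑ i, ω i * H x₀ i * y i ^ 2 +
        p * ∑ i, ω i * y i ^ 2) / r -
      2 * (ε * r) * ∑ i, ω i * (H (-x₀) i - H x₀ i + p) := by
    rw [Finset.mul_sum, Finset.mul_sum, ← Finset.sum_sub_distrib, ← Finset.sum_add_distrib,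
      Finset.sum_div, ← Finset.sum_neg_distrib, ← Finset.sum_sub_distrib, ← Finset.sum_add_distrib,
      ← Finset.sum_sub_distrib]
    refine Finset.sum_congr rfl fun i _ => ?_
    field_simp
    ring
  -- the cap `2 ε r` on small errors is paid at most once for each of them, selected or not
  have hcnt : ∑ i, ω i * (H (-x₀) i - H x₀ i + p) ≤ 2 * B + p * m := by
    calc _ ≤ ∑ i, (H (-x₀) i - H x₀ i + p) :=
          Finset.sum_le_sum fun i _ => mul_le_of_le_one_left (hJ0 i) (hω1 i)
      _ = ∑ i, H (-x₀) i - ∑ i, H x₀ i + p * m := by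
          rw [Finset.sum_add_distrib, Finset.sum_sub_distrib]
          simp [mul_comm]
      _ ≤ _ := by linarith [(abs_le.1 (hN _ hxp)).1, (abs_le.1 (hN _ hxn)).2]
  have hsq : r * (p * (θ * m) - 2 * B) ≤ (∑ i, ω i * H (-x₀) i * y i ^ 2 -
      ∑ i, ω i * H x₀ i * y i ^ 2 + p * ∑ i, ω i * y i ^ 2) / r := by
    rw [le_div_iff₀ hr]
    have h1 := mul_le_mul_of_nonneg_left hθ hp0
    have h2 := (abs_le.1 (hQ _ hxp)).2
    have h3 := (abs_le.1 (hQ _ hxn)).1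
    calc _ = p * (θ * m * r ^ 2) - 2 * (r ^ 2 * B) := by ring
      _ ≤ _ := by linarith
  have hfin : 0 < r * (p * m * (θ - 2 * ε) - 4 * B - 4 * ε * B) := by
    refine mul_pos hr ?_
    nlinarith
  have h4 : 2 * (ε * r) * ∑ i, ω i * (H (-x₀) i - H x₀ i + p) ≤ 2 * (ε * r) * (2 * B + p * m) :=
    mul_le_mul_of_nonneg_left hcnt (by positivity)
  rw [← sub_pos, hdiff]
  refine lt_of_lt_of_le ?_ hlow
  rw [hexp]
  have := hA _ hxp
  have := hA _ hxn
  nlinarith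

lemma l1Loss_segment_le (I : Set (Fin m)) (x : Fin m → ℝ) (w v : EuclideanSpace ℝ (Fin k)) {c : ℝ}
    (h0 : 0 ≤ c) (h1 : c ≤ 1) :
    M.l1Loss I x (w + c • (v - w)) ≤ (1 - c) * M.l1Loss I x w + c * M.l1Loss I x v := by
  simp only [l1Loss_eq, Finset.mul_sum, ← Finset.sum_add_distrib]
  refine Finset.sum_le_sum fun i _ => ?_
  have hω0 : (0 : ℝ) ≤ I.indicator 1 i := indicator_nonneg (fun _ _ => zero_le_one) i
  have h2 : x i - inner ℝ (M.b i) (w + c • (v - w)) =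
      (1 - c) * (x i - inner ℝ (M.b i) w) + c * (x i - inner ℝ (M.b i) v) := by
    rw [inner_add_right, inner_smul_right, inner_sub_right]
    ring
  have h3 : |x i - inner ℝ (M.b i) (w + c • (v - w))| ≤
      (1 - c) * |x i - inner ℝ (M.b i) w| + c * |x i - inner ℝ (M.b i) v| := by
    rw [h2]
    refine (abs_add_le _ _).trans ?_
    rw [abs_mul, abs_mul, abs_of_nonneg h0, abs_of_nonneg (sub_nonneg.2 h1)]
  calc _ ≤ I.indicator 1 i * ((1 - c) * |x i - inner ℝ (M.b i) w| +
        c * |x i - inner ℝ (M.b i) v|) := mul_le_mul_of_nonneg_left h3 hω0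
    _ = _ := by ring

/-- By convexity a minimiser cannot leave a ball on whose boundary the criterion exceeds its value
at the centre. -/
lemma norm_sub_lt_of_minimizer {I : Set (Fin m)} {x : Fin m → ℝ} {w v : EuclideanSpace ℝ (Fin k)}
    {r : ℝ} (hr : 0 < r)
    (hsphere : ∀ δ : EuclideanSpace ℝ (Fin k), ‖δ‖ = r → M.l1Loss I x w < M.l1Loss I x (w + δ))
    (hv : M.l1Loss I x v ≤ M.l1Loss I x w) : ‖v - w‖ < r := by
  by_contra hn
  have hn := not_lt.1 hn
  have hpos : 0 < ‖v - w‖ := hr.trans_le hn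
  have hc0 : 0 ≤ r / ‖v - w‖ := by positivity
  have hc1 : r / ‖v - w‖ ≤ 1 := (div_le_one hpos).2 hn
  have h1 := hsphere ((r / ‖v - w‖) • (v - w)) (by
    rw [norm_smul, Real.norm_of_nonneg hc0, div_mul_cancel₀ _ hpos.ne'])
  have h2 := M.l1Loss_segment_le I x w v hc0 hc1
  nlinarith

/-- If few loadings are small in each direction and the selected set is large, then the loadings of
the selected indices have a large second moment in each direction. -/
lemma le_sum_indicator_mul_inner_sq {I : Set (Fin m)} {κ d : ℝ} (hd : 0 < d)
    (hm : m ≠ 0) (hI : κ * m ≤ (I.ncard : ℝ))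
    (hsmall : ∀ u : EuclideanSpace ℝ (Fin k), ‖u‖ = 1 → M.smallLoadingFraction d u ≤ κ / 2)
    (δ : EuclideanSpace ℝ (Fin k)) :
    d ^ 2 * κ / 2 * m * ‖δ‖ ^ 2 ≤
      ∑ i, I.indicator (1 : Fin m → ℝ) i * inner ℝ (M.b i) δ ^ 2 := by
  have hm0 : (0 : ℝ) < m := by positivity
  rcases eq_or_ne δ 0 with rfl | hδ
  · simp
  have hδ0 : 0 < ‖δ‖ := norm_pos_iff.2 hδ
  set u := ‖δ‖⁻¹ • δ with hu
  have hu1 : ‖u‖ = 1 := by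
    rw [hu, norm_smul, norm_inv, norm_norm, inv_mul_cancel₀ hδ0.ne']
  have hδu : ∀ i, inner ℝ (M.b i) δ = ‖δ‖ * inner ℝ (M.b i) u := fun i => by
    rw [hu, inner_smul_right, ← mul_assoc, mul_inv_cancel₀ hδ0.ne', one_mul]
  have h1 := hsmall u hu1
  rw [smallLoadingFraction, div_le_iff₀ hm0] at h1
  set Bad : Set (Fin m) := {i | |inner ℝ (M.b i) u| ≤ d} with hBad
  have h2 : (I.ncard : ℝ) ≤ ((I \ Bad).ncard : ℝ) + (Bad.ncard : ℝ) := by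
    have := Set.ncard_le_ncard_sdiff_add_ncard I Bad (Set.toFinite _)
    exact_mod_cast this
  have h3 : κ / 2 * m ≤ ((I \ Bad).ncard : ℝ) := by linarith
  have h4 := sum_indicator_one_eq_ncard (I \ Bad)
  have h5 : d ^ 2 * ‖δ‖ ^ 2 * ∑ i, (I \ Bad).indicator (1 : Fin m → ℝ) i ≤
      ∑ i, I.indicator (1 : Fin m → ℝ) i * inner ℝ (M.b i) δ ^ 2 := by
    rw [Finset.mul_sum]
    refine Finset.sum_le_sum fun i _ => ?_
    by_cases hi : i ∈ I \ Bad
    · have hi2 : d < |inner ℝ (M.b i) u| := not_le.1 hi.2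
      rw [indicator_of_mem hi, indicator_of_mem hi.1, hδu, mul_pow, ← sq_abs (inner ℝ (M.b i) u)]
      simp only [Pi.one_apply, mul_one, one_mul]
      rw [mul_comm]
      gcongr
    · rw [indicator_of_notMem hi, mul_zero]
      exact mul_nonneg (indicator_nonneg (fun _ _ => zero_le_one) i) (sq_nonneg _)
  rw [h4] at h5
  refine le_trans ?_ h5
  calc _ = d ^ 2 * ‖δ‖ ^ 2 * (κ / 2 * m) := by ring
    _ ≤ _ := by gcongr

end PFAModel

namespace PFAModel

variable {m k : ℕ} (M : PFAModel m k)

section Sample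

variable {Ω : Type*} [MeasurableSpace Ω] {P : Measure Ω} [IsProbabilityMeasure P]

lemma measurable_indicator_mem (i : Fin m) :
    Measurable fun A : Set (Fin m) => A.indicator (1 : Fin m → ℝ) i := by
  have h : MeasurableSet {A : Set (Fin m) | i ∈ A} := measurableSet_setOfPred.2 (measurable_set_mem i)
  have h2 : (fun A : Set (Fin m) => A.indicator (1 : Fin m → ℝ) i) =
      {A : Set (Fin m) | i ∈ A}.indicator 1 := by
    ext A
    by_cases hA : i ∈ A <;> simp [hA]
  rw [h2]
  exact measurable_const.indicator h

/-- A second-moment bound for the fluctuations over a randomly selected index set that is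
independent of the errors. -/
lemma measureReal_kernelForm_gt_le {I : Ω → Set (Fin m)} {K : Ω → EuclideanSpace ℝ (Fin m)}
    (hI : Measurable I) (hK : HasLaw K (multivariateGaussian 0 M.A) P) (hind : IndepFun I K P)
    {κ : Fin m → Fin m → ℝ} (hκ : ∀ i j, |κ i j| ≤ 1) (hκ0 : ∀ ξ, 0 ≤ kernelForm κ ξ)
    {s : ℝ} (hs : |s| ≤ 1) {B : ℝ} (hB : 0 < B) :
    P.real {ω | B ^ 2 < kernelForm κ (M.selectedExceed (I ω) (K ω) s)} ≤
      4 * (m : ℝ) ^ 2 * M.meanAbsAdjCorr / B ^ 2 := by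
  set φ : Fin m → Fin m → Ω → ℝ := fun i j ω =>
    (I ω).indicator (1 : Fin m → ℝ) i * (I ω).indicator (1 : Fin m → ℝ) j
  set ψ : Fin m → Fin m → Ω → ℝ := fun i j ω =>
    centredExceed s (M.scaledErrors (K ω) i) * centredExceed s (M.scaledErrors (K ω) j)
  have hω0 : ∀ i ω, (0 : ℝ) ≤ (I ω).indicator 1 i := fun i ω =>
    indicator_nonneg (fun _ _ => zero_le_one) i
  have hω1 : ∀ i ω, (I ω).indicator (1 : Fin m → ℝ) i ≤ 1 := fun i ω =>
    indicator_le_self' (fun _ _ => zero_le_one) i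
  have hφ0 : ∀ i j ω, 0 ≤ φ i j ω := fun i j ω => mul_nonneg (hω0 i ω) (hω0 j ω)
  have hφ1 : ∀ i j ω, φ i j ω ≤ 1 := fun i j ω => mul_le_one₀ (hω1 i ω) (hω0 j ω) (hω1 j ω)
  have hψ1 : ∀ i j ω, |ψ i j ω| ≤ 1 := fun i j ω => by
    rw [abs_mul]
    exact mul_le_one₀ (abs_centredExceed_le _ _) (abs_nonneg _) (abs_centredExceed_le _ _)
  have hφm : ∀ i j, Measurable fun A : Set (Fin m) =>
      A.indicator (1 : Fin m → ℝ) i * A.indicator (1 : Fin m → ℝ) j := fun i j =>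
    (measurable_indicator_mem i).mul (measurable_indicator_mem j)
  have hcm : ∀ i, Measurable fun e : EuclideanSpace ℝ (Fin m) => centredExceed s (e i) := fun i =>
    (measurable_centredExceed s).comp (by fun_prop)
  have hψm : ∀ i j, Measurable fun e : EuclideanSpace ℝ (Fin m) =>
      centredExceed s (M.scaledErrors e i) * centredExceed s (M.scaledErrors e j) := fun i j =>
    ((hcm i).comp M.measurable_scaledErrors).mul ((hcm j).comp M.measurable_scaledErrors)
  have hφa : ∀ i j, AEStronglyMeasurable (φ i j) P := fun i j =>
    ((hφm i j).comp hI).aestronglyMeasurable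
  have hψa : ∀ i j, AEStronglyMeasurable (ψ i j) P := fun i j =>
    ((hψm i j).comp_aemeasurable hK.aemeasurable).aestronglyMeasurable
  have hint : ∀ i j, Integrable (fun ω => κ i j * (φ i j ω * ψ i j ω)) P := fun i j => by
    refine Integrable.const_mul (Integrable.of_bound (C := 1) ((hφa i j).mul (hψa i j))
      (Eventually.of_forall fun ω => ?_)) _
    rw [Real.norm_eq_abs, Pi.mul_apply, abs_mul, abs_of_nonneg (hφ0 i j ω)]
    exact mul_le_one₀ (hφ1 i j ω) (abs_nonneg _) (hψ1 i j ω)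
  have hE : ∀ i j, |∫ ω, κ i j * (φ i j ω * ψ i j ω) ∂P| ≤ 4 * |M.adjCorr i j| := by
    intro i j
    have h1 : ∫ ω, φ i j ω * ψ i j ω ∂P = (∫ ω, φ i j ω ∂P) * ∫ ω, ψ i j ω ∂P :=
      IndepFun.integral_fun_mul_eq_mul_integral (hind.comp (hφm i j) (hψm i j)) (hφa i j) (hψa i j)
    have h2 : ∫ ω, ψ i j ω ∂P = ∫ x, centredExceed s (x i) * centredExceed s (x j) ∂M.nullLaw :=
      (M.hasLaw_scaledErrors hK).integral_comp ((hcm i).mul (hcm j)).aestronglyMeasurable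
    have h3 : |∫ ω, ψ i j ω ∂P| ≤ 4 * |M.adjCorr i j| := by
      rw [h2]
      exact abs_integral_centredExceed_mul_le M.posSemidef_adjCorr M.adjCorr_self i j hs
    have h4 : |∫ ω, φ i j ω ∂P| ≤ 1 := by
      rw [abs_of_nonneg (integral_nonneg (hφ0 i j))]
      calc ∫ ω, φ i j ω ∂P ≤ ∫ _, 1 ∂P := integral_mono_of_nonneg
            (Eventually.of_forall (hφ0 i j)) (integrable_const _) (Eventually.of_forall (hφ1 i j))
        _ = 1 := by simp
    rw [integral_const_mul, h1, abs_mul, abs_mul]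
    calc |κ i j| * (|∫ ω, φ i j ω ∂P| * |∫ ω, ψ i j ω ∂P|)
        ≤ 1 * (1 * (4 * |M.adjCorr i j|)) := by
          gcongr
          exact hκ i j
      _ = _ := by ring
  have hform : ∀ ω, kernelForm κ (M.selectedExceed (I ω) (K ω) s) =
      ∑ i, ∑ j, κ i j * (φ i j ω * ψ i j ω) := fun ω => by
    refine Finset.sum_congr rfl fun i _ => Finset.sum_congr rfl fun j _ => ?_
    simp only [selectedExceed, φ, ψ]
    ring
  have hfi : Integrable (fun ω => kernelForm κ (M.selectedExceed (I ω) (K ω) s)) P := by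
    simp_rw [hform]
    exact integrable_finsetSum _ fun i _ => integrable_finsetSum _ fun j _ => hint i j
  have hbound : ∫ ω, kernelForm κ (M.selectedExceed (I ω) (K ω) s) ∂P ≤
      4 * ∑ i, ∑ j, |M.adjCorr i j| := by
    simp_rw [hform]
    rw [integral_finsetSum _ fun i _ => integrable_finsetSum _ fun j _ => hint i j, Finset.mul_sum]
    refine Finset.sum_le_sum fun i _ => ?_
    rw [integral_finsetSum _ fun j _ => hint i j, Finset.mul_sum]
    exact Finset.sum_le_sum fun j _ => (le_abs_self _).trans (hE i j)
  have hmk := mul_meas_ge_le_integral_of_nonneg (Eventually.of_forall fun ω => hκ0 _) hfi (B ^ 2)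
  have hmono : P.real {ω | B ^ 2 < kernelForm κ (M.selectedExceed (I ω) (K ω) s)} ≤
      P.real {ω | B ^ 2 ≤ kernelForm κ (M.selectedExceed (I ω) (K ω) s)} :=
    measureReal_mono fun ω hω => by
      rw [mem_ofPred_eq] at hω ⊢
      exact hω.le
  have hD : 4 * ∑ i, ∑ j, |M.adjCorr i j| ≤ 4 * (m : ℝ) ^ 2 * M.meanAbsAdjCorr := by
    rcases eq_or_ne m 0 with rfl | hm
    · simp
    · have : (m : ℝ) ≠ 0 := by exact_mod_cast hm
      rw [meanAbsAdjCorr]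
      field_simp
      exact le_rfl
  rw [le_div_iff₀ (by positivity)]
  calc _ ≤ P.real {ω | B ^ 2 ≤ kernelForm κ (M.selectedExceed (I ω) (K ω) s)} * B ^ 2 := by gcongr
    _ ≤ _ := by linarith

/-- The least-absolute-deviation estimate lies within `r` of the factors, up to a probability of
order `m⁻² ∑ |Σ̃ᵢⱼ| / (aMin r)²`. -/
theorem measureReal_factor_error_le {μ : Fin m → ℝ} {W what : Ω → EuclideanSpace ℝ (Fin k)}
    {K : Ω → EuclideanSpace ℝ (Fin m)} {I : Ω → Set (Fin m)}
    (hs : M.IsSample μ P W K I what) (hm : m ≠ 0) {κ d : ℝ} (hκ : 0 < κ) (hκ1 : κ ≤ 1)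
    (hd : 0 < d) (hd1 : d ≤ 1) (hI : ∀ᵐ ω ∂P, κ * m ≤ ((I ω).ncard : ℝ))
    (hsmall : ∀ u : EuclideanSpace ℝ (Fin k), ‖u‖ = 1 → M.smallLoadingFraction d u ≤ κ / 2)
    {r : ℝ} (hr : 0 < r) (hx1 : M.aMin * (d ^ 2 * κ / 8 * r) ≤ 1) :
    P.real {ω | r ≤ ‖what ω - W ω‖} ≤
      24 * (51 * 8) ^ 2 / (d ^ 2 * κ / 2 * (d ^ 2 * κ)) ^ 2 * M.meanAbsAdjCorr /
        (M.aMin * r) ^ 2 := by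
  -- half of the selected loadings have `|⟨b i, u⟩| ≥ d`, which gives the quadratic growth `θ`; with
  -- `ε = θ / 4` the errors of size at most `ε r` consume half of it
  set θ := d ^ 2 * κ / 2 with hθ
  set ε := d ^ 2 * κ / 8 with hε
  set x₀ := M.aMin * (ε * r) with hx₀
  have hθ0 : 0 < θ := by positivity
  have hε0 : 0 < ε := by positivity
  have hdκ : d ^ 2 * κ ≤ 1 := mul_le_one₀ (by nlinarith) hκ.le hκ1
  have hε1 : ε ≤ 1 := by rw [hε]; linarith
  have hmin : 0 < M.aMin := lt_of_lt_of_le one_pos (M.one_le_aMin hm)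
  have hx₀0 : 0 < x₀ := by positivity
  have hm0 : (0 : ℝ) < m := by positivity
  have hp := le_centralMass hx₀0.le hx1
  -- any divisor above `16` makes the fluctuations smaller than the growth in `hmain`
  set B := θ * (x₀ / 3) * m / 17 with hB
  have hB0 : 0 < B := by positivity
  have hmain : 8 * B < centralMass x₀ * m * (θ - 2 * ε) := by
    have h1 : θ - 2 * ε = θ / 2 := by rw [hθ, hε]; ring
    rw [h1]
    have h2 : x₀ / 3 * (m * (θ / 2)) ≤ centralMass x₀ * (m * (θ / 2)) := by gcongr
    have h3 : 0 < θ * (x₀ / 3) * m := by positivity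
    rw [hB]
    linarith
  have hindK : IndepFun I K P := hs.indep_I.comp measurable_id measurable_snd
  have hindU : IndepFun (fun _ : Ω => (univ : Set (Fin m))) K P := indepFun_const_left _ _
  have habs : ∀ s ∈ ({x₀, -x₀} : Set ℝ), |s| ≤ 1 := by
    rintro s (rfl | rfl)
    · rwa [abs_of_pos hx₀0]
    · rwa [abs_neg, abs_of_pos hx₀0]
  set κ1 : Fin m → Fin m → ℝ := fun i j => inner ℝ (M.b i) (M.b j) with hκ1d
  set κ2 : Fin m → Fin m → ℝ := fun i j => inner ℝ (M.b i) (M.b j) ^ 2 with hκ2d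
  set κ3 : Fin m → Fin m → ℝ := fun _ _ => 1 with hκ3d
  have hk1 : ∀ i j, |κ1 i j| ≤ 1 := fun i j =>
    (M.abs_inner_b_le i _).trans (M.norm_b_le_one j)
  have hk2 : ∀ i j, |κ2 i j| ≤ 1 := fun i j => by
    simp only [hκ2d, abs_pow]
    exact pow_le_one₀ (abs_nonneg _) (hk1 i j)
  have hk3 : ∀ i j, |κ3 i j| ≤ 1 := fun i j => by simp [hκ3d]
  have hn1 : ∀ ξ, 0 ≤ kernelForm κ1 ξ := fun ξ => by
    rw [hκ1d, ← norm_sq_sum_smul_eq]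
    positivity
  have hn3 : ∀ ξ, 0 ≤ kernelForm κ3 ξ := fun ξ => by
    rw [hκ3d, ← sq_sum_eq_kernelForm]
    positivity
  have hn2 : ∀ ξ, 0 ≤ kernelForm κ2 ξ := fun ξ => by
    rcases Nat.eq_zero_or_pos k with hk | hk
    · subst hk
      have : κ2 = fun _ _ => 0 := by
        ext i j
        simp [hκ2d, Subsingleton.elim (M.b i) 0]
      simp [this, kernelForm]
    · have h1 := sq_sum_mul_inner_sq_le M.b ξ (EuclideanSpace.single (⟨0, hk⟩ : Fin k) 1)
      have h2 : ‖(EuclideanSpace.single (⟨0, hk⟩ : Fin k) (1 : ℝ))‖ = 1 := by simp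
      rw [h2] at h1
      have h3 := (sq_nonneg _).trans h1
      simpa using h3
  set E1 : ℝ → Set Ω := fun s => {ω | B ^ 2 < kernelForm κ1 (M.selectedExceed (I ω) (K ω) s)}
  set E2 : ℝ → Set Ω := fun s => {ω | B ^ 2 < kernelForm κ2 (M.selectedExceed (I ω) (K ω) s)}
  set E3 : ℝ → Set Ω := fun s => {ω | B ^ 2 < kernelForm κ3 (M.selectedExceed univ (K ω) s)}
  set Q := 4 * (m : ℝ) ^ 2 * M.meanAbsAdjCorr / B ^ 2 with hQ
  have hP1 : ∀ s ∈ ({x₀, -x₀} : Set ℝ), P.real (E1 s) ≤ Q := fun s h =>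
    M.measureReal_kernelForm_gt_le hs.measurable_I hs.law_K hindK hk1 hn1 (habs s h) hB0
  have hP2 : ∀ s ∈ ({x₀, -x₀} : Set ℝ), P.real (E2 s) ≤ Q := fun s h =>
    M.measureReal_kernelForm_gt_le hs.measurable_I hs.law_K hindK hk2 hn2 (habs s h) hB0
  have hP3 : ∀ s ∈ ({x₀, -x₀} : Set ℝ), P.real (E3 s) ≤ Q := fun s h =>
    M.measureReal_kernelForm_gt_le measurable_const hs.law_K hindU hk3 hn3 (habs s h) hB0
  have hsub : ∀ᵐ ω ∂P, ω ∈ {ω | r ≤ ‖what ω - W ω‖} →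
      ω ∈ (E1 x₀ ∪ E1 (-x₀)) ∪ ((E2 x₀ ∪ E2 (-x₀)) ∪ (E3 x₀ ∪ E3 (-x₀))) := by
    filter_upwards [hI, hs.null_model, hs.minimizer] with ω h1 h2 h3 h4
    by_contra hcon
    simp only [mem_union, not_or] at hcon
    obtain ⟨⟨c1, c2⟩, ⟨c3, c4⟩, c5, c6⟩ := hcon
    have hx : ∀ i ∈ I ω, M.obs μ (W ω) (K ω) i = inner ℝ (M.b i) (W ω) + K ω i := fun i hi => by
      rw [obs, h2 i hi, zero_add]
    refine absurd h4 (not_le.2 (M.norm_sub_lt_of_minimizer hr (fun δ hδ => ?_) (h3 (W ω))))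
    refine M.l1Loss_lt_of_norm_eq hx hr hε0 hε1 hB0.le hδ hx₀0 (θ := θ) ?_ ?_ ?_ ?_ hmain
    · rw [← hδ]
      exact M.le_sum_indicator_mul_inner_sq hd hm h1 hsmall δ
    · rintro s (rfl | rfl)
      · exact not_lt.1 c1
      · exact not_lt.1 c2
    · rintro s (rfl | rfl)
      · exact not_lt.1 c3
      · exact not_lt.1 c4
    · rintro s (rfl | rfl)
      · exact not_lt.1 c5
      · exact not_lt.1 c6
  have hxp : x₀ ∈ ({x₀, -x₀} : Set ℝ) := by simp
  have hxn : -x₀ ∈ ({x₀, -x₀} : Set ℝ) := by simp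
  have hle : P.real {ω | r ≤ ‖what ω - W ω‖} ≤ 6 * Q := by
    refine (ENNReal.toReal_mono (measure_ne_top _ _) (measure_mono_ae hsub)).trans ?_
    refine (measureReal_union_le _ _).trans ?_
    have u1 := measureReal_union_le (μ := P) (E1 x₀) (E1 (-x₀))
    have u2 := measureReal_union_le (μ := P) (E2 x₀) (E2 (-x₀))
    have u3 := measureReal_union_le (μ := P) (E3 x₀) (E3 (-x₀))
    have u4 := measureReal_union_le (μ := P) (E2 x₀ ∪ E2 (-x₀)) (E3 x₀ ∪ E3 (-x₀))
    linarith [hP1 _ hxp, hP1 _ hxn, hP2 _ hxp, hP2 _ hxn, hP3 _ hxp, hP3 _ hxn]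
  refine hle.trans (le_of_eq ?_)
  rw [hQ, hB, hx₀, hε, hθ]
  field_simp
  ring

end Sample

end PFAModel

/-! ### The threshold grid and the estimators -/

lemma log_two_ge : (16 / 25 : ℝ) ≤ Real.log 2 := by
  have := Real.log_two_gt_d9
  linarith

lemma four_fifths_le_sqrt_log {m : ℕ} (hm : 2 ≤ m) : (4 / 5 : ℝ) ≤ √(Real.log m) := by
  refine Real.le_sqrt_of_sq_le ?_
  have h1 : Real.log 2 ≤ Real.log m := Real.log_le_log two_pos (by exact_mod_cast hm)
  have := log_two_ge
  linarith

lemma sqrt_five_mul_add_one_le {m : ℕ} (hm : 2 ≤ m) :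
    √(5 * Real.log m) + 1 ≤ 4 * √(Real.log m) := by
  have h1 := four_fifths_le_sqrt_log hm
  have h2 : √(5 * Real.log m) ≤ 5 / 2 * √(Real.log m) := by
    rw [Real.sqrt_mul (by norm_num)]
    refine mul_le_mul_of_nonneg_right ?_ (Real.sqrt_nonneg _)
    exact Real.sqrt_le_iff.2 ⟨by norm_num, by norm_num⟩
  linarith

section Grid

variable {m : ℕ} {γ η : ℝ} {t : ℕ}

lemma floor_sqrt_add_one_le (hm : 2 ≤ m) :
    ((⌊√(5 * Real.log m)⌋₊ + 1 : ℕ) : ℝ) ≤ 4 * √(Real.log m) := by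
  push_cast
  have := Nat.floor_le (Real.sqrt_nonneg (5 * Real.log m))
  linarith [sqrt_five_mul_add_one_le hm]

lemma card_thresholdGrid_le (hm : 2 ≤ m) :
    ((thresholdGrid m γ η).card : ℝ) ≤ 4 * √(Real.log m) := by
  refine le_trans ?_ (floor_sqrt_add_one_le hm)
  have := (Finset.card_filter_le (Finset.range (⌊√(5 * Real.log m)⌋₊ + 1))
    fun t => √(2 * thresholdExponent γ η * Real.log m) ≤ (t : ℝ))
  rw [Finset.card_range] at this
  exact_mod_cast this

lemma mem_thresholdGrid : t ∈ thresholdGrid m γ η ↔ t < ⌊√(5 * Real.log m)⌋₊ + 1 ∧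
    √(2 * thresholdExponent γ η * Real.log m) ≤ (t : ℝ) := by
  simp [thresholdGrid]

lemma le_of_mem_thresholdGrid (ht : t ∈ thresholdGrid m γ η) : (t : ℝ) ≤ √(5 * Real.log m) := by
  have h := Nat.lt_succ_iff.1 (mem_thresholdGrid.1 ht).1
  exact (Nat.le_floor_iff (Real.sqrt_nonneg _)).1 h

lemma thresholdExponent_nonneg (γ η : ℝ) : 0 ≤ thresholdExponent γ η := le_max_right _ _

lemma one_add_le_of_mem_thresholdGrid (hm : 2 ≤ m) (ht : t ∈ thresholdGrid m γ η) :
    1 + (t : ℝ) ≤ 4 * √(Real.log m) := by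
  linarith [le_of_mem_thresholdGrid ht, sqrt_five_mul_add_one_le hm]

lemma gaussExp_le_rpow {m : ℕ} (hm : 2 ≤ m) {e t : ℝ} (he : 0 ≤ e)
    (ht : √(2 * e * Real.log m) ≤ t) : gaussExp t ≤ (m : ℝ) ^ (-e) := by
  have hm0 : (0 : ℝ) < m := by positivity
  have hL : 0 ≤ Real.log m := Real.log_natCast_nonneg m
  have h2 : 2 * e * Real.log m ≤ t ^ 2 := by
    have h3 : 0 ≤ 2 * e * Real.log m := by positivity
    calc _ = √(2 * e * Real.log m) ^ 2 := (Real.sq_sqrt h3).symm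
      _ ≤ _ := pow_le_pow_left₀ (Real.sqrt_nonneg _) ht 2
  rw [Real.rpow_def_of_pos hm0, gaussExp]
  refine Real.exp_le_exp.2 ?_
  linarith

lemma gaussExp_le_of_mem_thresholdGrid (hm : 2 ≤ m) (ht : t ∈ thresholdGrid m γ η) :
    gaussExp t ≤ (m : ℝ) ^ (-thresholdExponent γ η) :=
  gaussExp_le_rpow hm (thresholdExponent_nonneg _ _) (mem_thresholdGrid.1 ht).2

lemma sum_thresholdGrid_le (hm : 2 ≤ m) {f : ℕ → ℝ} {C : ℝ} (hC : 0 ≤ C)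
    (hf : ∀ t ∈ thresholdGrid m γ η, f t ≤ C) :
    ∑ t ∈ thresholdGrid m γ η, f t ≤ 4 * √(Real.log m) * C := by
  refine (Finset.sum_le_card_nsmul _ _ _ hf).trans ?_
  rw [nsmul_eq_mul]
  exact mul_le_mul_of_nonneg_right (card_thresholdGrid_le hm) hC

end Grid

lemma ciSup_finset_lt {T : Finset ℕ} {f : T → ℝ} {C : ℝ} (hC : 0 < C) (h : ∀ t, f t < C) :
    ⨆ t, f t < C := by
  rcases isEmpty_or_nonempty T with hT | hT
  · rwa [Real.iSup_of_isEmpty]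
  · obtain ⟨t, ht⟩ := exists_eq_ciSup_of_finite (f := f)
    rw [← ht]
    exact h t

lemma propEstimator_lt {m : ℕ} {θ c C : ℝ} {T : Finset ℕ} {x : Fin m → ℝ} (hC : 0 < C)
    (h : ∀ t ∈ T, exceedFraction x t - normalTail t - c * normalTail t ^ θ <
      C * (1 - normalTail t)) : propEstimator θ c T x < C := by
  refine ciSup_finset_lt hC fun t => ?_
  rw [div_lt_iff₀ (by linarith [normalTail_lt_one t.1])]
  exact h t.1 t.2

/-- Dividing by `1 - normalTail t < 1` only increases a nonnegative numerator. -/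
lemma lt_propEstimator {m : ℕ} {θ c C : ℝ} {T : Finset ℕ} {x : Fin m → ℝ} (hC : 0 ≤ C) {t : ℕ}
    (ht : t ∈ T) (h : C < exceedFraction x t - normalTail t - c * normalTail t ^ θ) :
    C < propEstimator θ c T x := by
  have h1 : (exceedFraction x t - normalTail t - c * normalTail t ^ θ) / (1 - normalTail t) ≤
      propEstimator θ c T x :=
    le_ciSup (f := fun t : T => (exceedFraction x (t.1 : ℝ) - normalTail (t.1 : ℝ) -
      c * normalTail (t.1 : ℝ) ^ θ) / (1 - normalTail (t.1 : ℝ))) (finite_range _).bddAbove ⟨t, ht⟩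
  refine lt_of_lt_of_le ?_ h1
  have h2 := normalTail_lt_one t
  have h3 := normalTail_nonneg t
  rw [lt_div_iff₀ (by linarith)]
  nlinarith

lemma abs_sub_le_of_discrepancy_le {m : ℕ} {θ c : ℝ} {T : Finset ℕ} {x : Fin m → ℝ}
    (h : discrepancy θ T x ≤ c) {t : ℕ} (ht : t ∈ T) :
    |exceedFraction x t - normalTail t| ≤ c * normalTail t ^ θ := by
  have h1 := le_ciSup (f := fun t : T => |exceedFraction x (t.1 : ℝ) - normalTail (t.1 : ℝ)| /
    normalTail (t.1 : ℝ) ^ θ) (finite_range _).bddAbove ⟨t, ht⟩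
  have h2 := h1.trans h
  rwa [div_le_iff₀ (Real.rpow_pos_of_pos (normalTail_pos _) _)] at h2

lemma exists_of_lt_discrepancy {m : ℕ} {θ c : ℝ} {T : Finset ℕ} {x : Fin m → ℝ} (hc : 0 ≤ c)
    (h : c < discrepancy θ T x) :
    ∃ t ∈ T, c * normalTail (t : ℕ) ^ θ < |exceedFraction x (t : ℕ) - normalTail (t : ℕ)| := by
  have hT : Nonempty T := by
    by_contra hn
    rw [not_nonempty_iff] at hn
    rw [discrepancy, Real.iSup_of_isEmpty] at h
    linarith
  obtain ⟨t, ht⟩ := exists_lt_of_lt_ciSup h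
  refine ⟨t.1, t.2, ?_⟩
  rwa [lt_div_iff₀ (Real.rpow_pos_of_pos (normalTail_pos _) _)] at ht

/-! ### Uniform fluctuation bounds over a grid -/

section Uniform

variable {m : ℕ} {S : Matrix (Fin m) (Fin m) ℝ}

lemma measureReal_biUnion_le_sum {α : Type*} [MeasurableSpace α] {μ : Measure α}
    (T : Finset ℕ) (A : ℕ → Set α) {f : ℕ → ℝ} (h : ∀ t ∈ T, μ.real (A t) ≤ f t) :
    μ.real {x | ∃ t ∈ T, x ∈ A t} ≤ ∑ t ∈ T, f t := by
  have h1 : {x | ∃ t ∈ T, x ∈ A t} = ⋃ t ∈ T, A t := by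
    ext x
    simp
  rw [h1]
  exact (measureReal_biUnion_finset_le T A).trans (Finset.sum_le_sum h)

lemma measureReal_lt_le_integral_div {α : Type*} [MeasurableSpace α] {μ : Measure α}
    [IsProbabilityMeasure μ] {f : α → ℝ} (h0 : ∀ x, 0 ≤ f x) (hf : Integrable f μ) {y C : ℝ}
    (hy : 0 < y) (hC : ∫ x, f x ∂μ ≤ C) : μ.real {x | y < f x} ≤ C / y := by
  have h1 := mul_meas_ge_le_integral_of_nonneg (Eventually.of_forall h0) hf y
  have h2 : μ.real {x | y < f x} ≤ μ.real {x | y ≤ f x} := measureReal_mono fun x hx => by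
    rw [mem_ofPred_eq] at hx ⊢
    exact hx.le
  rw [le_div_iff₀ hy]
  nlinarith

/-- Chebyshev's inequality for the exceedance proportions on a grid. -/
lemma measureReal_exists_abs_sub_gt_le (hm : m ≠ 0) (hS : S.PosSemidef) (h1 : ∀ i, S i i = 1)
    (T : Finset ℕ) {y : ℕ → ℝ} (hy : ∀ t ∈ T, 0 < y t) :
    (multivariateGaussian 0 S).real {x : EuclideanSpace ℝ (Fin m) |
      ∃ t ∈ T, y t < |exceedFraction (fun i => x i) (t : ℕ) - normalTail (t : ℕ)|} ≤
      ∑ t ∈ T, 140 * ((∑ i, ∑ j, |S i j|) / (m : ℝ) ^ 2) * normalTail t / y t ^ 2 := by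
  refine measureReal_biUnion_le_sum T (fun t => {x : EuclideanSpace ℝ (Fin m) |
    y t < |exceedFraction (fun i => x i) (t : ℕ) - normalTail (t : ℕ)|}) fun t ht => ?_
  have hint : Integrable (fun x : EuclideanSpace ℝ (Fin m) =>
      (exceedFraction (fun i => x i) (t : ℕ) - normalTail (t : ℕ)) ^ 2)
      (multivariateGaussian 0 S) := by
    refine Integrable.of_bound (C := 1)
      (((measurable_exceedFraction _).sub_const _).pow_const 2).aestronglyMeasurable
      (Eventually.of_forall fun x => ?_)
    have a1 := exceedFraction_nonneg (fun i => x i) (t : ℝ)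
    have a2 := exceedFraction_le_one (fun i => x i) (t : ℝ)
    have a3 := normalTail_nonneg t
    have a4 := normalTail_le_one t
    rw [Real.norm_eq_abs, abs_of_nonneg (sq_nonneg _)]
    nlinarith
  refine le_trans (measureReal_mono fun x hx => ?_) (measureReal_lt_le_integral_div
    (fun x => sq_nonneg _) hint (pow_pos (hy t ht) 2)
    (integral_sq_exceedFraction_sub_le hm hS h1 (Nat.cast_nonneg t)))
  rw [mem_ofPred_eq] at hx ⊢
  rw [← sq_abs (exceedFraction _ _ - _)]
  exact pow_lt_pow_left₀ hx (hy t ht).le two_ne_zero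

/-- The standard normal mass of a band of half-width `ε` around a level `t` with `t * ε ≤ 1`, over
which the density varies by a bounded factor only. -/
lemma normalTail_band_le {t ε : ℝ} (hε : 0 ≤ ε) (ht : ε ≤ t) (htε : t * ε ≤ 1) :
    normalTail (t - ε) - normalTail (t + ε) ≤ 6 * ε * gaussExp t := by
  refine (normalTail_sub_le (by linarith) (by linarith)).trans ?_
  have h1 : gaussExp (t - ε) ≤ 3 * gaussExp t := by
    have h2 : gaussExp (t - ε) ≤ gaussExp t * Real.exp 1 := by
      rw [gaussExp, gaussExp, ← Real.exp_add]
      exact Real.exp_le_exp.2 (by nlinarith)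
    have h3 := Real.exp_one_lt_d9
    have h4 := gaussExp_pos t
    nlinarith
  calc _ = 2 * ε * gaussExp (t - ε) := by ring
    _ ≤ 2 * ε * (3 * gaussExp t) := by gcongr
    _ = _ := by ring

lemma exceedFraction_antitone (x : Fin m → ℝ) : Antitone (exceedFraction x) := by
  intro s t hst
  unfold exceedFraction
  have : {i | t < x i} ⊆ {i | s < x i} := fun i hi => by
    rw [mem_ofPred_eq] at hi ⊢
    exact hst.trans_lt hi
  have h2 := Set.ncard_le_ncard this (toFinite _)
  gcongr

/-- Few coordinates lie close to a level of the grid. -/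
lemma measureReal_exists_band_gt_le (hm : m ≠ 0) (hS : S.PosSemidef) (h1 : ∀ i, S i i = 1)
    (T : Finset ℕ) {y : ℕ → ℝ} (hy : ∀ t ∈ T, 0 < y t) {ε : ℝ} (hε : 0 ≤ ε)
    (hT : ∀ t ∈ T, ε ≤ (t : ℝ) ∧ (t : ℝ) * ε ≤ 1) :
    (multivariateGaussian 0 S).real {x : EuclideanSpace ℝ (Fin m) |
      ∃ t ∈ T, y t < exceedFraction (fun i => x i) ((t : ℕ) - ε) -
        exceedFraction (fun i => x i) ((t : ℕ) + ε)} ≤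
      ∑ t ∈ T, 6 * ε * gaussExp t / y t := by
  refine measureReal_biUnion_le_sum T (fun t => {x : EuclideanSpace ℝ (Fin m) |
    y t < exceedFraction (fun i => x i) ((t : ℕ) - ε) -
      exceedFraction (fun i => x i) ((t : ℕ) + ε)}) fun t ht => ?_
  refine measureReal_lt_le_integral_div (fun x => ?_)
    ((integrable_exceedFraction _).sub (integrable_exceedFraction _)) (hy t ht) ?_
  · exact sub_nonneg.2 (exceedFraction_antitone _ (by linarith))
  · refine (integral_sub (integrable_exceedFraction _)
      (integrable_exceedFraction _)).trans_le ?_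
    rw [integral_exceedFraction hm hS h1, integral_exceedFraction hm hS h1]
    exact normalTail_band_le hε (hT t ht).1 (hT t ht).2

lemma integrable_partialFraction (J : Finset (Fin m)) (t : ℝ) :
    Integrable (fun x : EuclideanSpace ℝ (Fin m) => partialFraction J (fun i => x i) t)
      (multivariateGaussian 0 S) := by
  refine Integrable.div_const (integrable_finsetSum _ fun j _ => ?_) _
  refine Integrable.of_bound (C := 1)
    ((measurable_const.indicator measurableSet_Ioi).comp (by fun_prop)).aestronglyMeasurable
    (Eventually.of_forall fun x => ?_)
  by_cases h : t < x j <;> simp [indicator, h]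

lemma integral_partialFraction (hS : S.PosSemidef) (h1 : ∀ i, S i i = 1) (J : Finset (Fin m))
    (t : ℝ) :
    ∫ x : EuclideanSpace ℝ (Fin m), partialFraction J (fun i => x i) t
      ∂(multivariateGaussian 0 S) = (J.card : ℝ) / m * normalTail t := by
  have hms : ∀ i, MeasurableSet {x : EuclideanSpace ℝ (Fin m) | t < x i} := fun l =>
    measurableSet_lt measurable_const (by fun_prop)
  have h : ∀ i (x : EuclideanSpace ℝ (Fin m)), (Ioi t).indicator (1 : ℝ → ℝ) (x i) =
      {x : EuclideanSpace ℝ (Fin m) | t < x i}.indicator 1 x := fun i x => by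
    simp [indicator]
  simp_rw [partialFraction, h]
  rw [integral_div, integral_finsetSum]
  · simp_rw [integral_indicator_one (hms _), measureReal_exceed hS h1]
    simp
    ring
  · exact fun i _ => (integrable_const (1 : ℝ)).indicator (hms i)

lemma partialFraction_le (J : Finset (Fin m)) (y : Fin m → ℝ) (t : ℝ) :
    partialFraction J y t ≤ (J.card : ℝ) / m := by
  unfold partialFraction
  gcongr
  calc _ ≤ ∑ j ∈ J, (1 : ℝ) :=
        Finset.sum_le_sum fun j _ => indicator_le_self' (fun _ _ => zero_le_one) _
    _ = _ := by simp

lemma exceedFraction_eq_partialFraction_add (J : Finset (Fin m)) (y : Fin m → ℝ) (t : ℝ) :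
    exceedFraction y t = partialFraction J y t + partialFraction Jᶜ y t := by
  rw [exceedFraction_eq, partialFraction, partialFraction, ← add_div, Finset.sum_add_sum_compl]

lemma partialFraction_le_of_forall {J : Finset (Fin m)} {y y' : Fin m → ℝ} {t t' : ℝ}
    (h : ∀ j ∈ J, t < y j → t' < y' j) : partialFraction J y t ≤ partialFraction J y' t' := by
  unfold partialFraction
  refine div_le_div_of_nonneg_right (Finset.sum_le_sum fun j hj => ?_) (Nat.cast_nonneg _)
  by_cases h' : t < y j
  · rw [indicator_of_mem (by simpa using h'), indicator_of_mem (by simpa using h j hj h')]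
    rfl
  · rw [indicator_of_notMem (by simpa using h')]
    exact indicator_nonneg (fun _ _ => zero_le_one) _

/-- If the coordinates outside `J` grow by at most `ε`, the exceedance proportion grows by at most
the proportion of `J` and of the coordinates that were close to the level. -/
lemma exceedFraction_le_add {J : Finset (Fin m)} {x z : Fin m → ℝ} {ε : ℝ}
    (h : ∀ i ∉ J, x i ≤ z i + ε) (t : ℝ) :
    exceedFraction x t ≤ (J.card : ℝ) / m + exceedFraction z (t - ε) := by
  rw [exceedFraction_eq_partialFraction_add J x, exceedFraction_eq_partialFraction_add J z]
  have h1 := partialFraction_le J x t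
  have h2 := partialFraction_nonneg J z (t - ε)
  have h3 : partialFraction Jᶜ x t ≤ partialFraction Jᶜ z (t - ε) :=
    partialFraction_le_of_forall fun j hj hx => by
      linarith [h j (by simpa using hj)]
  linarith

/-- If no coordinate falls by more than `ε` and those in `J` grow by at least `g - ε`, the
exceedance proportion is at least that of a mixture of shifted and unshifted coordinates. -/
lemma le_exceedFraction {J : Finset (Fin m)} {x z : Fin m → ℝ} {ε g : ℝ}
    (h : ∀ i ∉ J, z i - ε ≤ x i) (hJ : ∀ i ∈ J, z i + g - ε ≤ x i) (t : ℝ) :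
    exceedFraction z (t + ε) - partialFraction J z (t + ε) + partialFraction J z (t + ε - g) ≤
      exceedFraction x t := by
  rw [exceedFraction_eq_partialFraction_add J x, exceedFraction_eq_partialFraction_add J z]
  have h1 : partialFraction J z (t + ε - g) ≤ partialFraction J x t :=
    partialFraction_le_of_forall fun j hj hx => by linarith [hJ j hj]
  have h3 : partialFraction Jᶜ z (t + ε) ≤ partialFraction Jᶜ x t :=
    partialFraction_le_of_forall fun j hj hx => by
      linarith [h j (by simpa using hj)]
  linarith

end Uniform

/-! ### The error of the estimated factors in the calibrated regime -/

namespace PFAModel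

section Calibration

variable {m k : ℕ} (M : PFAModel m k) {C q γ η : ℝ}

/-- The size of the shifts of the adjusted statistics that the estimated factors cause, when the
ratio of `aMax * √k` to its upper bound is `q`. -/
noncomputable def shiftBound (m : ℕ) (x q : ℝ) : ℝ := √q * (m : ℝ) ^ (-x) / √(Real.log m)

/-- The two bounds on the scalings are compatible only if `γ` and `η` are not too far apart. -/
lemma calibration_le (hm : 2 ≤ m) (hC : 0 < C) (x : ℝ)
    (hlow : C * √((m : ℝ) ^ (1 - η)) ≤ M.aMin * √k)
    (hup : M.aMax * √k ≤ q * √((m : ℝ) ^ (1 - 2 * x) / Real.log m)) :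
    C ^ 2 * ((m : ℝ) ^ (2 * x - η) * Real.log m) ≤ q ^ 2 := by
  have hm0 : (0 : ℝ) < m := by positivity
  have hL : 0 < Real.log m := Real.log_pos (by exact_mod_cast hm)
  have h1 : C * √((m : ℝ) ^ (1 - η)) ≤ q * √((m : ℝ) ^ (1 - 2 * x) / Real.log m) :=
    hlow.trans ((mul_le_mul_of_nonneg_right (M.aMin_le_aMax (by omega))
      (Real.sqrt_nonneg _)).trans hup)
  have h2 := pow_le_pow_left₀ (by positivity) h1 2
  rw [mul_pow, mul_pow, Real.sq_sqrt (by positivity), Real.sq_sqrt (by positivity),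
    ← mul_div_assoc, le_div_iff₀ hL] at h2
  have h3 : (0 : ℝ) < (m : ℝ) ^ (1 - 2 * x) := by positivity
  refine le_of_mul_le_mul_right ?_ h3
  calc _ = C ^ 2 * ((m : ℝ) ^ (2 * x - η) * (m : ℝ) ^ (1 - 2 * x)) * Real.log m := by ring
    _ = C ^ 2 * (m : ℝ) ^ (1 - η) * Real.log m := by
        rw [← Real.rpow_add hm0]
        congr 3
        ring
    _ ≤ _ := h2

/-- The adjusted statistics differ from the signals plus the scaled errors by a small shift. -/
lemma adjusted_obs_eq (μ : Fin m → ℝ) (w v : EuclideanSpace ℝ (Fin k))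
    (e : EuclideanSpace ℝ (Fin m)) (i : Fin m) :
    M.adjusted (M.obs μ w e) v i =
      M.a i * μ i + M.scaledErrors e i + M.a i * inner ℝ (M.b i) (w - v) := by
  simp only [adjusted, obs, scaledErrors_apply, inner_sub_right]
  ring

lemma abs_shift_le (hm : m ≠ 0) (u : EuclideanSpace ℝ (Fin k)) (i : Fin m) :
    |M.a i * inner ℝ (M.b i) u| ≤ M.aMax * ‖u‖ := by
  rw [abs_mul, abs_of_pos (M.a_pos i)]
  exact mul_le_mul (M.le_aMax i) (M.abs_inner_b_le i u) (abs_nonneg _)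
    (zero_le_one.trans ((M.one_le_aMin hm).trans (M.aMin_le_aMax hm)))

variable {Ω : Type*} [MeasurableSpace Ω] {P : Measure Ω} [IsProbabilityMeasure P]
  {μ : Fin m → ℝ} {W what : Ω → EuclideanSpace ℝ (Fin k)} {K : Ω → EuclideanSpace ℝ (Fin m)}
  {I : Ω → Set (Fin m)} {κ d : ℝ}

/-- The choice of `shiftBound` turns the rate of the estimated factors into a bound by a multiple of
the ratio `q`. -/
lemma measureReal_shift_gt_le (hs : M.IsSample μ P W K I what) (hm : 2 ≤ m) (hκ : 0 < κ)
    (hκ1 : κ ≤ 1) (hd : 0 < d) (hd1 : d ≤ 1) (hI : ∀ᵐ ω ∂P, κ * m ≤ ((I ω).ncard : ℝ))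
    (hsmall : ∀ u, ‖u‖ = 1 → M.smallLoadingFraction d u ≤ κ / 2) (hC : 0 < C) (hq : 0 < q) (x : ℝ)
    (hdep : M.meanAbsAdjCorr = (m : ℝ) ^ (-η))
    (hlow : C * √((m : ℝ) ^ (1 - η)) ≤ M.aMin * √k)
    (hup : M.aMax * √k ≤ q * √((m : ℝ) ^ (1 - 2 * x) / Real.log m))
    (hε : shiftBound m x q ≤ 1) :
    P.real {ω | ∃ i, shiftBound m x q < |M.a i * inner ℝ (M.b i) (W ω - what ω)|} ≤
      24 * (51 * 8) ^ 2 / (d ^ 2 * κ / 2 * (d ^ 2 * κ)) ^ 2 / C ^ 2 * q := by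
  have hm0 : (0 : ℝ) < m := by positivity
  have hmne : m ≠ 0 := by omega
  have hL : 0 < Real.log m := Real.log_pos (by exact_mod_cast hm)
  have hε0 : 0 < shiftBound m x q := by unfold shiftBound; positivity
  have hamin : 0 < M.aMin := zero_lt_one.trans_le (M.one_le_aMin hmne)
  have hamax : 0 < M.aMax := hamin.trans_le (M.aMin_le_aMax hmne)
  set r := shiftBound m x q / M.aMax with hr
  have hr0 : 0 < r := by positivity
  have hrε : M.aMax * r = shiftBound m x q := by rw [hr]; field_simp
  have hx1 : M.aMin * (d ^ 2 * κ / 8 * r) ≤ 1 := by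
    have h1 : M.aMin * r ≤ 1 :=
      (mul_le_mul_of_nonneg_right (M.aMin_le_aMax hmne) hr0.le).trans (hrε.le.trans hε)
    have h2 : d ^ 2 * κ / 8 ≤ 1 := by
      have : d ^ 2 ≤ 1 := pow_le_one₀ hd.le hd1
      nlinarith
    calc _ = (d ^ 2 * κ / 8) * (M.aMin * r) := by ring
      _ ≤ 1 * 1 := mul_le_mul h2 h1 (by positivity) zero_le_one
      _ = 1 := one_mul 1
  have hmain := M.measureReal_factor_error_le hs hmne hκ hκ1 hd hd1 hI hsmall hr0 hx1
  refine (measureReal_mono ?_).trans (hmain.trans ?_)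
  · rintro ω ⟨i, hi⟩
    rw [mem_ofPred_eq]
    have h1 := hi.trans_le (M.abs_shift_le hmne (W ω - what ω) i)
    rw [← hrε, norm_sub_rev] at h1
    exact (lt_of_mul_lt_mul_left h1 hamax.le).le
  · rw [hdep, mul_div_assoc, div_mul_eq_mul_div _ (C ^ 2), mul_div_assoc _ q]
    refine mul_le_mul_of_nonneg_left ?_ (by positivity)
    -- this is where the choice of `shiftBound` balances the two bounds on the scalings
    rw [div_le_div_iff₀ (by positivity) (by positivity)]
    have h1 := pow_le_pow_left₀ (by positivity) hlow 2
    have h2 := pow_le_pow_left₀ (by positivity) hup 2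
    rw [mul_pow, mul_pow, Real.sq_sqrt (by positivity), Real.sq_sqrt (by positivity)] at h1
    rw [mul_pow, mul_pow, Real.sq_sqrt (by positivity), Real.sq_sqrt (by positivity),
      ← mul_div_assoc, le_div_iff₀ hL] at h2
    have h3 : shiftBound m x q ^ 2 * Real.log m = q * (m : ℝ) ^ (-(2 * x)) := by
      rw [shiftBound, div_pow, mul_pow, Real.sq_sqrt hq.le, Real.sq_sqrt hL.le,
        ← Real.rpow_natCast, ← Real.rpow_mul hm0.le, div_mul_cancel₀ _ hL.ne']
      congr 2
      push_cast
      ring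
    have hy : (m : ℝ) ^ (1 - 2 * x) = m * (m : ℝ) ^ (-(2 * x)) := by
      rw [sub_eq_add_neg, Real.rpow_add hm0, Real.rpow_one]
    have hz : (m : ℝ) ^ (1 - η) = m * (m : ℝ) ^ (-η) := by
      rw [sub_eq_add_neg, Real.rpow_add hm0, Real.rpow_one]
    rw [hy] at h2
    rw [hz] at h1
    have hk : (0 : ℝ) < k := by
      by_contra hk
      have hk0 : (k : ℝ) = 0 := le_antisymm (not_lt.1 hk) (Nat.cast_nonneg k)
      rw [hk0, mul_zero] at h1
      have : 0 < C ^ 2 * (m * (m : ℝ) ^ (-η)) := by positivity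
      linarith
    rw [hr]
    set E := shiftBound m x q
    set U := (m : ℝ) ^ (-(2 * x))
    have hU : 0 < U := by positivity
    have h4 : (M.aMin * (E / M.aMax)) ^ 2 = M.aMin ^ 2 * E ^ 2 / M.aMax ^ 2 := by
      field_simp
    rw [h4, ← mul_div_assoc, le_div_iff₀ (by positivity)]
    have h5 : (m : ℝ) ^ (-η) * C ^ 2 * m ≤ M.aMin ^ 2 * k := by linarith
    refine le_of_mul_le_mul_right ?_ (show 0 < k * Real.log m * m by positivity)
    calc (m : ℝ) ^ (-η) * C ^ 2 * M.aMax ^ 2 * (k * Real.log m * m)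
        = ((m : ℝ) ^ (-η) * C ^ 2 * m) * (M.aMax ^ 2 * k * Real.log m) := by ring
      _ ≤ (M.aMin ^ 2 * k) * (q ^ 2 * (m * U)) := mul_le_mul h5 h2 (by positivity) (by positivity)
      _ = q * (M.aMin ^ 2 * (q * U)) * (k * m) := by ring
      _ = q * (M.aMin ^ 2 * E ^ 2) * (k * Real.log m * m) := by rw [← h3]; ring

end Calibration

end PFAModel

/-- By this comparison `calibration_le` forces `m ^ (-thresholdExponent γ η)` to vanish, so that all
levels of the grid tend to infinity. -/
lemma neg_thresholdExponent_le (γ η : ℝ) :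
    -thresholdExponent γ η ≤ 2 * max (η - γ) 0 - η := by
  unfold thresholdExponent
  rcases le_total (η - γ) 0 with h | h
  · rw [max_eq_right h]
    linarith [le_max_left (γ - 0) 0]
  · rw [max_eq_left h]
    linarith [le_max_left (γ - (η - γ)) 0]

/-- In the calibrated regime the estimated factors shift the adjusted statistics by at most `ε`,
with probability tending to one, and `ε` is small enough for the band of width `ε` around a level
of the grid to hold a negligible number of null statistics. -/
lemma exists_shift_bound {m k : ℕ → ℕ} (hm : Tendsto m atTop atTop)
    (M : ∀ n, PFAModel (m n) (k n)) {μ : ∀ n, Fin (m n) → ℝ} {γ η : ℕ → ℝ}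
    (hdep : ∀ n, (M n).meanAbsAdjCorr = (m n : ℝ) ^ (-η n))
    {Ω : ℕ → Type*} [∀ n, MeasurableSpace (Ω n)] {P : ∀ n, Measure (Ω n)}
    [∀ n, IsProbabilityMeasure (P n)]
    {W what : ∀ n, Ω n → EuclideanSpace ℝ (Fin (k n))}
    {K : ∀ n, Ω n → EuclideanSpace ℝ (Fin (m n))}
    {I : ∀ n, Ω n → Set (Fin (m n))}
    (hsample : ∀ n, (M n).IsSample (μ n) (P n) (W n) (K n) (I n) (what n))
    (hI : ∃ κ : ℝ, 0 < κ ∧ ∀ᶠ n in atTop, ∀ᵐ ω ∂(P n), κ * m n ≤ ((I n ω).ncard : ℝ))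
    (hC1_lower : ∃ C : ℝ, 0 < C ∧ ∀ᶠ n in atTop,
      C * √((m n : ℝ) ^ (1 - η n)) ≤ (M n).aMin * √(k n))
    (hC1_upper : (fun n => (M n).aMax * √(k n)) =o[atTop]
      fun n => √((m n : ℝ) ^ (1 - 2 * max (η n - γ n) 0) / Real.log (m n)))
    (hC2 : ∃ d : ℝ, 0 < d ∧ Tendsto
      (fun n => ⨆ u : Metric.sphere (0 : EuclideanSpace ℝ (Fin (k n))) 1,
        (M n).smallLoadingFraction d u) atTop (𝓝 0)) :
    ∃ ε p : ℕ → ℝ, (∀ n, 0 ≤ ε n) ∧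
      Tendsto (fun n => ε n * (m n : ℝ) ^ max (η n - γ n) 0 * √(Real.log (m n))) atTop (𝓝 0) ∧
      Tendsto p atTop (𝓝 0) ∧
      (∀ᶠ n in atTop, (P n).real {ω | ∃ i, ε n <
        |(M n).a i * inner ℝ ((M n).b i) (W n ω - what n ω)|} ≤ p n) ∧
      Tendsto (fun n => (m n : ℝ) ^ (-thresholdExponent (γ n) (η n))) atTop (𝓝 0) := by
  obtain ⟨κ₀, hκ₀, hI⟩ := hI
  obtain ⟨C, hC, hlow⟩ := hC1_lower
  obtain ⟨d₀, hd₀, hC2⟩ := hC2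
  set κ := min κ₀ 1 with hκ_def
  set d := min d₀ 1 with hd_def
  have hκ : 0 < κ := lt_min hκ₀ one_pos
  have hd : 0 < d := lt_min hd₀ one_pos
  set x : ℕ → ℝ := fun n => max (η n - γ n) 0
  have hx0 : ∀ n, 0 ≤ x n := fun n => le_max_right _ _
  set q : ℕ → ℝ := fun n =>
    (M n).aMax * √(k n) / √((m n : ℝ) ^ (1 - 2 * x n) / Real.log (m n)) with hq_def
  have hq : Tendsto q atTop (𝓝 0) := hC1_upper.tendsto_div_nhds_zero
  have hsq : Tendsto (fun n => √(q n)) atTop (𝓝 0) := by simpa using hq.sqrt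
  have hm2 : ∀ᶠ n in atTop, 2 ≤ m n := hm.eventually_ge_atTop 2
  have hbasic : ∀ᶠ n in atTop, 2 ≤ m n ∧ 0 < q n ∧
      (M n).aMax * √(k n) ≤ q n * √((m n : ℝ) ^ (1 - 2 * x n) / Real.log (m n)) := by
    filter_upwards [hm2, hlow] with n h2 h3
    have hm0 : (0 : ℝ) < m n := by
      have : 0 < m n := by omega
      exact_mod_cast this
    have hL : 0 < Real.log (m n) := Real.log_pos (by exact_mod_cast h2)
    have h4 : 0 < √((m n : ℝ) ^ (1 - 2 * x n) / Real.log (m n)) := by positivity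
    have h5 : 0 < (M n).aMax * √(k n) :=
      lt_of_lt_of_le (by positivity) (h3.trans (mul_le_mul_of_nonneg_right
        ((M n).aMin_le_aMax (by omega)) (Real.sqrt_nonneg _)))
    exact ⟨h2, div_pos h5 h4, (div_mul_cancel₀ _ h4.ne').ge⟩
  refine ⟨fun n => PFAModel.shiftBound (m n) (x n) (q n), fun n =>
    24 * (51 * 8) ^ 2 / (d ^ 2 * κ / 2 * (d ^ 2 * κ)) ^ 2 / C ^ 2 * q n, fun n => ?_, ?_, ?_, ?_, ?_⟩
  · unfold PFAModel.shiftBound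
    positivity
  · refine hsq.congr' ?_
    filter_upwards [hm2] with n h2
    have hm0 : (0 : ℝ) < m n := by
      have : 0 < m n := by omega
      exact_mod_cast this
    have hL : 0 < Real.log (m n) := Real.log_pos (by exact_mod_cast h2)
    rw [PFAModel.shiftBound, Real.rpow_neg hm0.le]
    field_simp
    rfl
  · simpa using hq.const_mul (24 * (51 * 8) ^ 2 / (d ^ 2 * κ / 2 * (d ^ 2 * κ)) ^ 2 / C ^ 2)
  · filter_upwards [hbasic, hlow, hI, hC2.eventually_le_const (half_pos hκ),
      hsq.eventually_le_const (show (0 : ℝ) < 4 / 5 by norm_num)] with n hb h3 h4 h5 h6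
    obtain ⟨h2, hq0, hup⟩ := hb
    have hm1 : (1 : ℝ) ≤ m n := by
      have : 1 ≤ m n := by omega
      exact_mod_cast this
    refine (M n).measureReal_shift_gt_le (hsample n) h2 hκ (min_le_right _ _) hd (min_le_right _ _)
      ?_ (fun u hu => ?_) hC hq0 (x n) (hdep n) h3 hup ?_
    · filter_upwards [h4] with ω h
      exact le_trans (mul_le_mul_of_nonneg_right (min_le_left _ _) (Nat.cast_nonneg _)) h
    · have hle : ∀ v : EuclideanSpace ℝ (Fin (k n)),
          (M n).smallLoadingFraction d v ≤ (M n).smallLoadingFraction d₀ v := fun v => by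
        unfold PFAModel.smallLoadingFraction
        refine div_le_div_of_nonneg_right ?_ (Nat.cast_nonneg _)
        refine Nat.cast_le.2 (Set.ncard_le_ncard (fun i hi => ?_) (toFinite _))
        rw [mem_ofPred_eq] at hi ⊢
        exact hi.trans (min_le_left _ _)
      have hbdd : BddAbove (range fun u : Metric.sphere (0 : EuclideanSpace ℝ (Fin (k n))) 1 =>
          (M n).smallLoadingFraction d₀ u) := by
        refine ⟨1, ?_⟩
        rintro _ ⟨v, rfl⟩
        unfold PFAModel.smallLoadingFraction
        refine div_le_one_of_le₀ ?_ (Nat.cast_nonneg _)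
        have := Set.ncard_le_ncard (subset_univ
          {i : Fin (m n) | |inner ℝ ((M n).b i) (v : EuclideanSpace ℝ (Fin (k n)))| ≤ d₀})
          (toFinite _)
        rw [Set.ncard_univ, Nat.card_eq_fintype_card, Fintype.card_fin] at this
        exact_mod_cast this
      exact (hle u).trans ((le_ciSup hbdd ⟨u, by simpa using hu⟩).trans h5)
    · unfold PFAModel.shiftBound
      have h7 := four_fifths_le_sqrt_log h2
      rw [div_le_one (by linarith)]
      have h8 : (m n : ℝ) ^ (-x n) ≤ 1 := Real.rpow_le_one_of_one_le_of_nonpos hm1 (by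
        linarith [hx0 n])
      calc _ ≤ √(q n) * 1 := mul_le_mul_of_nonneg_left h8 (Real.sqrt_nonneg _)
        _ ≤ _ := by linarith
  · have hlim : Tendsto (fun n => q n ^ 2 * (25 / 16 / C ^ 2)) atTop (𝓝 0) := by
      simpa using (hq.pow 2).mul_const (25 / 16 / C ^ 2)
    refine squeeze_zero' (Eventually.of_forall fun n => by positivity) ?_ hlim
    filter_upwards [hbasic, hlow] with n hb h3
    obtain ⟨h2, hq0, hup⟩ := hb
    have hm1 : (1 : ℝ) ≤ m n := by
      have : 1 ≤ m n := by omega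
      exact_mod_cast this
    have h4 := (M n).calibration_le h2 hC (x n) h3 hup
    have h5 : (m n : ℝ) ^ (-thresholdExponent (γ n) (η n)) ≤ (m n : ℝ) ^ (2 * x n - η n) :=
      Real.rpow_le_rpow_of_exponent_le hm1 (neg_thresholdExponent_le _ _)
    have h6 : (16 / 25 : ℝ) ≤ Real.log (m n) :=
      log_two_ge.trans (Real.log_le_log two_pos (by exact_mod_cast h2))
    rw [← mul_div_assoc, le_div_iff₀ (by positivity)]
    have h7 : 0 ≤ (m n : ℝ) ^ (-thresholdExponent (γ n) (η n)) := by positivity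
    have h8 : (m n : ℝ) ^ (-thresholdExponent (γ n) (η n)) * (16 / 25) ≤
        (m n : ℝ) ^ (2 * x n - η n) * Real.log (m n) :=
      mul_le_mul h5 h6 (by norm_num) (by positivity)
    have h9 := (mul_le_mul_of_nonneg_left h8 (sq_nonneg C)).trans h4
    linarith

/-! ### Fluctuations of the null statistics over the threshold grid -/

lemma measureReal_mem_le {α β : Type*} [MeasurableSpace α] [MeasurableSpace β] {P : Measure α}
    {ν : Measure β} [IsFiniteMeasure ν] {Z : α → β} (h : HasLaw Z ν P) (A : Set β) :
    P.real {ω | Z ω ∈ A} ≤ ν.real A := by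
  have h1 := Measure.le_map_apply h.aemeasurable A
  rw [h.map_eq] at h1
  exact ENNReal.toReal_mono (measure_ne_top _ _) h1

lemma gaussExp_le_mul_normalTail {m : ℕ} {γ η : ℝ} {t : ℕ} (hm : 2 ≤ m)
    (ht : t ∈ thresholdGrid m γ η) : gaussExp t ≤ 60 * √(Real.log m) * normalTail t := by
  refine (gaussExp_le_normalTail (Nat.cast_nonneg t)).trans ?_
  have := one_add_le_of_mem_thresholdGrid hm ht
  have := normalTail_nonneg t
  nlinarith

lemma sqrt_rpow_neg_mul {m : ℕ} (L η : ℝ) :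
    √((m : ℝ) ^ (-η) * L) = (m : ℝ) ^ (-η / 2) * √L := by
  have hm0 : (0 : ℝ) ≤ m := by positivity
  rw [Real.sqrt_mul (by positivity), Real.sqrt_eq_rpow ((m : ℝ) ^ (-η)), ← Real.rpow_mul hm0]
  congr 2
  ring

namespace PFAModel

section NullBounds

variable {m k : ℕ} (M : PFAModel m k) {C γ η : ℝ}

/-- The variance of an exceedance proportion is at most a multiple of `m ^ (-η) * normalTail t`, so the
normalisation by `√(normalTail t)` calls for a bounding constant of order `√(m ^ (-η) * log m)`. -/
lemma measureReal_exists_half_lt_le (hm : 2 ≤ m) (hC : 0 < C)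
    (hdep : M.meanAbsAdjCorr = (m : ℝ) ^ (-η)) (γ : ℝ) :
    M.nullLaw.real {z : EuclideanSpace ℝ (Fin m) | ∃ t ∈ thresholdGrid m γ η,
      C * √((m : ℝ) ^ (-η) * Real.log m) * normalTail (t : ℕ) ^ (1 / 2 : ℝ) <
        |exceedFraction (fun i => z i) (t : ℕ) - normalTail (t : ℕ)|} ≤
      560 / (C ^ 2 * √(Real.log m)) := by
  have hm0 : (0 : ℝ) < m := by positivity
  have hL : 0 < Real.log m := Real.log_pos (by exact_mod_cast hm)
  have h4 : (0 : ℝ) < (m : ℝ) ^ (-η) := by positivity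
  refine (measureReal_exists_abs_sub_gt_le (y := fun t => C * √((m : ℝ) ^ (-η) * Real.log m) *
    normalTail (t : ℕ) ^ (1 / 2 : ℝ)) (by omega) M.posSemidef_adjCorr M.adjCorr_self _
    (fun t _ => ?_)).trans ?_
  · have := normalTail_pos t
    positivity
  · refine (sum_thresholdGrid_le (C := 140 / (C ^ 2 * Real.log m)) hm (by positivity)
      fun t _ => le_of_eq ?_).trans (le_of_eq ?_)
    · have h3 : (∑ i, ∑ j, |M.adjCorr i j|) / (m : ℝ) ^ 2 = (m : ℝ) ^ (-η) := hdep
      have h5 := normalTail_pos t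
      rw [h3, mul_pow, mul_pow, Real.sq_sqrt (by positivity), ← Real.sqrt_eq_rpow,
        Real.sq_sqrt h5.le]
      field_simp
    · have h6 : √(Real.log m) ^ 2 = Real.log m := Real.sq_sqrt hL.le
      have h7 : 0 < √(Real.log m) := Real.sqrt_pos.2 hL
      nth_rw 2 [← h6]
      field_simp
      norm_num

/-- The normalisation by the tail itself calls for a bounding constant of order `√(log m)`, whatever the
dependence: this is the maximal inequality, applied to the `O(√(log m))` levels of the grid. -/
lemma measureReal_exists_le_exceedFraction_le (hm : 2 ≤ m) (hC : 0 < C) (γ η : ℝ) :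
    M.nullLaw.real {z : EuclideanSpace ℝ (Fin m) | ∃ t ∈ thresholdGrid m γ η,
      C * √(Real.log m) * normalTail (t : ℕ) ≤ exceedFraction (fun i => z i) (t : ℕ)} ≤
      (2 / C + 16 / C ^ 2) / √(Real.log m) := by
  have hL : 0 < √(Real.log m) := Real.sqrt_pos.2 (Real.log_pos (by exact_mod_cast hm))
  set N := ⌊√(5 * Real.log m)⌋₊ + 1 with hN
  have h1 := measureReal_exists_exceedFraction_ge_le (c := C * √(Real.log m) / 2)
    (show m ≠ 0 by omega) M.posSemidef_adjCorr M.adjCorr_self (by positivity) N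
  refine (measureReal_mono ?_).trans (h1.trans ?_)
  · rintro z ⟨t, ht, hz⟩
    exact ⟨t, (mem_thresholdGrid.1 ht).1, by rwa [mul_div_cancel₀ _ (two_ne_zero' ℝ)]⟩
  · have h2 : (N : ℝ) ≤ 4 * √(Real.log m) := floor_sqrt_add_one_le hm
    calc _ ≤ (C * √(Real.log m) / 2 + 4 * √(Real.log m)) / (C * √(Real.log m) / 2) ^ 2 := by
          gcongr
      _ = _ := by
          field_simp
          ring

lemma isBounding_half (hm : 2 ≤ m) {α : ℝ} (hα : 0 < α)
    (hdep : M.meanAbsAdjCorr = (m : ℝ) ^ (-η)) (γ : ℝ) :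
    IsBounding M (1 / 2) (thresholdGrid m γ η) (α / 2)
      ((1 + 1400 / α) * √((m : ℝ) ^ (-η) * Real.log m)) := by
  have hC : (0 : ℝ) < 1 + 1400 / α := by positivity
  have h1 := M.measureReal_exists_half_lt_le hm hC hdep γ
  refine lt_of_le_of_lt (measureReal_mono fun z hz => ?_) (lt_of_le_of_lt h1 ?_)
  · exact exists_of_lt_discrepancy (by positivity) hz
  · have h2 := four_fifths_le_sqrt_log hm
    have h3 : 1 + 1400 / α ≤ (1 + 1400 / α) ^ 2 := by
      have : 0 < 1400 / α := by positivity
      nlinarith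
    have h4 : 1400 < (1 + 1400 / α) ^ 2 * α := by
      calc _ < (1 + 1400 / α) * α := by
            field_simp
            linarith
        _ ≤ _ := by gcongr
    rw [div_lt_div_iff₀ (by positivity) two_pos]
    nlinarith

lemma isBounding_one (hm : 2 ≤ m) {α : ℝ} (hα : 0 < α) (γ η : ℝ) :
    IsBounding M 1 (thresholdGrid m γ η) (α / 2) ((2 + 45 / α) * √(Real.log m)) := by
  have hα' : 0 < 45 / α := by positivity
  have hC : (0 : ℝ) < 2 + 45 / α := by positivity
  have h1 := M.measureReal_exists_le_exceedFraction_le hm hC γ η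
  have h2 := four_fifths_le_sqrt_log hm
  refine lt_of_le_of_lt (measureReal_mono fun z hz => ?_) (lt_of_le_of_lt h1 ?_)
  · obtain ⟨t, ht, h⟩ := exists_of_lt_discrepancy (by positivity) hz
    refine ⟨t, ht, ?_⟩
    rw [Real.rpow_one] at h
    have h3 := normalTail_pos t
    have h4 := exceedFraction_nonneg (fun i => z i) (t : ℝ)
    have h5 : 1 ≤ (2 + 45 / α) * √(Real.log m) := by nlinarith
    rcases lt_abs.1 h with h | h <;> nlinarith
  · set D := 2 + 45 / α with hD
    have h3 : 45 < D * α := by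
      rw [hD, add_mul, div_mul_cancel₀ _ hα.ne']
      linarith
    have h4 : 2 / D + 16 / D ^ 2 ≤ 18 / D := by
      rw [div_add_div _ _ (by positivity) (by positivity),
        div_le_div_iff₀ (by positivity) (by positivity)]
      have : D ≤ D ^ 2 := by nlinarith
      nlinarith [mul_le_mul_of_nonneg_left this (show (0 : ℝ) ≤ D by positivity)]
    refine lt_of_le_of_lt (div_le_div_of_nonneg_right h4 (Real.sqrt_nonneg _)) ?_
    rw [div_div, div_lt_div_iff₀ (by positivity) two_pos]
    nlinarith

variable {ε : ℝ} (hm : 2 ≤ m) (hε : 0 ≤ ε)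
  (hT : ∀ t ∈ thresholdGrid m γ η, ε ≤ (t : ℝ) ∧ (t : ℝ) * ε ≤ 1)

include hm hε hT

lemma measureReal_exists_band_const_le {y : ℝ} (hy : 0 < y) :
    M.nullLaw.real {z : EuclideanSpace ℝ (Fin m) | ∃ t ∈ thresholdGrid m γ η,
      y < exceedFraction (fun i => z i) ((t : ℕ) - ε) -
        exceedFraction (fun i => z i) ((t : ℕ) + ε)} ≤
      24 * ε * √(Real.log m) * ((m : ℝ) ^ (-thresholdExponent γ η) / y) := by
  refine (measureReal_exists_band_gt_le (y := fun _ => y) (by omega) M.posSemidef_adjCorr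
    M.adjCorr_self _ (fun t _ => hy) hε hT).trans ?_
  refine (sum_thresholdGrid_le (C := 6 * ε * (m : ℝ) ^ (-thresholdExponent γ η) / y) hm
    (by positivity) fun t ht => ?_).trans (le_of_eq (by ring))
  have := gaussExp_le_of_mem_thresholdGrid hm ht
  gcongr

lemma measureReal_exists_band_one_le (hC : 0 < C) :
    M.nullLaw.real {z : EuclideanSpace ℝ (Fin m) | ∃ t ∈ thresholdGrid m γ η,
      C * √(Real.log m) * normalTail (t : ℕ) < exceedFraction (fun i => z i) ((t : ℕ) - ε) -
        exceedFraction (fun i => z i) ((t : ℕ) + ε)} ≤ 1440 / C * (ε * √(Real.log m)) := by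
  have hL : 0 < √(Real.log m) := Real.sqrt_pos.2 (Real.log_pos (by exact_mod_cast hm))
  refine (measureReal_exists_band_gt_le (y := fun t => C * √(Real.log m) * normalTail (t : ℕ))
    (by omega) M.posSemidef_adjCorr
    M.adjCorr_self _ (fun t _ => mul_pos (by positivity) (normalTail_pos _)) hε hT).trans ?_
  refine (sum_thresholdGrid_le (C := 360 / C * ε) hm
    (by positivity) fun t ht => ?_).trans (le_of_eq (by ring))
  have h1 := gaussExp_le_mul_normalTail hm ht
  have h2 := normalTail_pos t
  rw [div_le_iff₀ (by positivity)]
  calc _ ≤ 6 * ε * (60 * √(Real.log m) * normalTail t) := by gcongr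
    _ = _ := by
      field_simp
      ring

lemma measureReal_exists_band_half_le (hC : 0 < C)
    (he : η - thresholdExponent γ η ≤ 2 * max (η - γ) 0) :
    M.nullLaw.real {z : EuclideanSpace ℝ (Fin m) | ∃ t ∈ thresholdGrid m γ η,
      C * √((m : ℝ) ^ (-η) * Real.log m) * normalTail (t : ℕ) ^ (1 / 2 : ℝ) <
        exceedFraction (fun i => z i) ((t : ℕ) - ε) -
        exceedFraction (fun i => z i) ((t : ℕ) + ε)} ≤
      1440 / C * (ε * (m : ℝ) ^ max (η - γ) 0 * √(Real.log m)) := by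
  have hm0 : (0 : ℝ) < m := by positivity
  have hm1 : (1 : ℝ) ≤ m := by
    have : 1 ≤ m := by omega
    exact_mod_cast this
  have hL : 0 < √(Real.log m) := Real.sqrt_pos.2 (Real.log_pos (by exact_mod_cast hm))
  set e := thresholdExponent γ η
  set x := max (η - γ) 0
  refine (measureReal_exists_band_gt_le (y := fun t => C * √((m : ℝ) ^ (-η) * Real.log m) *
    normalTail (t : ℕ) ^ (1 / 2 : ℝ)) (by omega) M.posSemidef_adjCorr
    M.adjCorr_self _ (fun t _ => ?_) hε hT).trans ?_
  · have := normalTail_pos t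
    have := Real.sqrt_pos.1 hL
    positivity
  refine (sum_thresholdGrid_le (C := 360 / C * (ε * (m : ℝ) ^ x)) hm
    (by positivity) fun t ht => ?_).trans (le_of_eq (by ring))
  have h1 := gaussExp_le_mul_normalTail hm ht
  have h2 := normalTail_pos t
  rw [← Real.sqrt_eq_rpow, sqrt_rpow_neg_mul, div_le_iff₀ (by positivity)]
  -- one factor `√(gaussExp t)` is compared with the tail, the other with the size of the grid
  have h3 : gaussExp t ≤ (m : ℝ) ^ (-e / 2) * (60 * √(Real.log m) * √(normalTail t)) := by
    have a1 : √(gaussExp t) ≤ (m : ℝ) ^ (-e / 2) := by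
      refine (Real.sqrt_le_sqrt (gaussExp_le_of_mem_thresholdGrid hm ht)).trans (le_of_eq ?_)
      rw [Real.sqrt_eq_rpow, ← Real.rpow_mul hm0.le]
      congr 1
      ring
    have a2 : √(gaussExp t) ≤ 60 * √(Real.log m) * √(normalTail t) := by
      refine (Real.sqrt_le_sqrt h1).trans ?_
      rw [Real.sqrt_mul (by positivity)]
      refine mul_le_mul_of_nonneg_right ?_ (Real.sqrt_nonneg _)
      have := four_fifths_le_sqrt_log hm
      exact Real.sqrt_le_iff.2 ⟨by positivity, by nlinarith⟩
    calc _ = √(gaussExp t) * √(gaussExp t) := (Real.mul_self_sqrt (gaussExp_pos _).le).symm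
      _ ≤ _ := mul_le_mul a1 a2 (Real.sqrt_nonneg _) (by positivity)
  have h4 : (m : ℝ) ^ (-e / 2) ≤ (m : ℝ) ^ x * (m : ℝ) ^ (-η / 2) := by
    rw [← Real.rpow_add hm0]
    exact Real.rpow_le_rpow_of_exponent_le hm1 (by linarith)
  calc _ ≤ 6 * ε * ((m : ℝ) ^ x * (m : ℝ) ^ (-η / 2) *
        (60 * √(Real.log m) * √(normalTail t))) := by
        refine mul_le_mul_of_nonneg_left (h3.trans ?_) (by positivity)
        gcongr
    _ = _ := by
      field_simp
      ring

end NullBounds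

end PFAModel

/-! ### Deterministic bounds for the estimators -/

section Deterministic

variable {m : ℕ} {x z : Fin m → ℝ} {J : Finset (Fin m)} {T : Finset ℕ} {ε : ℝ}

lemma exceedFraction_le_add_band (hε : 0 ≤ ε) (hx : ∀ i ∉ J, x i ≤ z i + ε) (t : ℝ) :
    exceedFraction x t ≤ (J.card : ℝ) / m + exceedFraction z t +
      (exceedFraction z (t - ε) - exceedFraction z (t + ε)) := by
  have h1 := exceedFraction_le_add hx t
  have h2 := exceedFraction_antitone z (show t ≤ t + ε by linarith)
  linarith

lemma le_exceedFraction_add_band (hε : 0 ≤ ε) (t : ℝ) :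
    exceedFraction z t ≤ exceedFraction z (t + ε) +
      (exceedFraction z (t - ε) - exceedFraction z (t + ε)) := by
  have h2 := exceedFraction_antitone z (show t - ε ≤ t by linarith)
  linarith

/-- Where the discrepancies respect their bounding constants, the estimator exceeds the proportion of
signals at most by the band around the level and by the factor `1 - normalTail t`. -/
lemma adaptiveEstimator_lt_of_discrepancy_le {δ cHalf cOne : ℝ} (hδ : 0 < δ)
    (hJ : 0 < (J.card : ℝ) / m) (hε : 0 ≤ ε) (hx : ∀ i ∉ J, x i ≤ z i + ε)
    (hHalf : discrepancy (1 / 2) T z ≤ cHalf) (hOne : discrepancy 1 T z ≤ cOne)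
    (hband : ∀ t ∈ T, exceedFraction z ((t : ℕ) - ε) - exceedFraction z ((t : ℕ) + ε) ≤
      δ / 4 * ((J.card : ℝ) / m))
    (hΦ : ∀ t ∈ T, normalTail (t : ℕ) ≤ δ / (2 * (1 + δ))) :
    adaptiveEstimator cHalf cOne T x < (J.card : ℝ) / m * (1 + δ) := by
  have key : ∀ {θ c : ℝ}, discrepancy θ T z ≤ c →
      propEstimator θ c T x < (J.card : ℝ) / m * (1 + δ) := fun {θ c} hc => by
    refine propEstimator_lt (by positivity) fun t ht => ?_
    have h1 := exceedFraction_le_add_band hε hx t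
    have h2 := (le_abs_self _).trans (abs_sub_le_of_discrepancy_le hc ht)
    have h3 := hband t ht
    have h4 : (1 + δ) * normalTail t ≤ δ / 2 := by
      calc _ ≤ (1 + δ) * (δ / (2 * (1 + δ))) := by
            have := hΦ t ht
            gcongr
        _ = _ := by field_simp
    have h5 := mul_le_mul_of_nonneg_left h4 hJ.le
    have h6 := mul_pos hJ hδ
    linarith
  exact max_lt (key hHalf) (key hOne)

/-- Where the null statistics fluctuate by a fraction of the bounding constants only, these
constants also absorb the shift of the levels. -/
lemma adaptiveEstimator_lt {s₁ s₂ CHalf COne : ℝ} (hJ : 0 < (J.card : ℝ) / m)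
    (hJ1 : (J.card : ℝ) / m ≤ 1) (hε : 0 ≤ ε) (hx : ∀ i ∉ J, x i ≤ z i + ε) (hO : 0 < COne * s₂)
    (hhalf : ∀ t ∈ T, |exceedFraction z (t : ℕ) - normalTail (t : ℕ)| ≤
      CHalf / 4 * s₁ * normalTail (t : ℕ) ^ (1 / 2 : ℝ))
    (hone : ∀ t ∈ T, exceedFraction z (t : ℕ) ≤ COne / 2 * s₂ * normalTail (t : ℕ))
    (hbandH : ∀ t ∈ T, exceedFraction z ((t : ℕ) - ε) - exceedFraction z ((t : ℕ) + ε) ≤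
      CHalf / 4 * s₁ * normalTail (t : ℕ) ^ (1 / 2 : ℝ))
    (hbandO : ∀ t ∈ T, exceedFraction z ((t : ℕ) - ε) - exceedFraction z ((t : ℕ) + ε) ≤
      COne / 4 * s₂ * normalTail (t : ℕ))
    (hΦ : ∀ t ∈ T, (J.card : ℝ) / m * √(normalTail (t : ℕ)) < CHalf * s₁ / 2) :
    adaptiveEstimator (CHalf * s₁) (COne * s₂) T x < (J.card : ℝ) / m := by
  refine max_lt (propEstimator_lt hJ fun t ht => ?_) (propEstimator_lt hJ fun t ht => ?_)
  · have h1 := exceedFraction_le_add_band hε hx t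
    have h2 := (le_abs_self _).trans (hhalf t ht)
    have h3 := hbandH t ht
    have h4 := hΦ t ht
    rw [← Real.sqrt_eq_rpow] at h2 h3 ⊢
    have h5 := Real.sqrt_pos.2 (normalTail_pos t)
    have h6 := mul_lt_mul_of_pos_right h4 h5
    have h7 : √(normalTail t) * √(normalTail t) = normalTail t :=
      Real.mul_self_sqrt (normalTail_nonneg _)
    rw [mul_assoc, h7] at h6
    linarith
  · have h1 := exceedFraction_le_add_band hε hx t
    have h2 := hone t ht
    have h3 := hbandO t ht
    have h4 := normalTail_pos t
    have h5 := mul_pos hO h4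
    have h6 := mul_le_mul_of_nonneg_right hJ1 h4.le
    rw [Real.rpow_one]
    linarith

/-- If at some level of the grid almost all signals and hardly any unshifted statistics of the signal
set are above the level, and if one of the two bounding constants is negligible there, then the
estimator recovers almost all of the proportion. -/
lemma lt_adaptiveEstimator {s₁ s₂ CHalf COne ε' g : ℝ} {t : ℕ} (hε'1 : ε' ≤ 1)
    (hε : 0 ≤ ε) (hx : ∀ i ∉ J, z i - ε ≤ x i) (hxJ : ∀ i ∈ J, z i + g - ε ≤ x i) (ht : t ∈ T)
    (hJ1 : partialFraction J z (t + ε) ≤ ε' / 8 * ((J.card : ℝ) / m))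
    (hJ2 : (J.card : ℝ) / m - partialFraction J z (t + ε - g) ≤ ε' / 8 * ((J.card : ℝ) / m))
    (hhalf : |exceedFraction z (t : ℕ) - normalTail (t : ℕ)| ≤
      CHalf / 4 * s₁ * normalTail (t : ℕ) ^ (1 / 2 : ℝ))
    (hbandH : exceedFraction z ((t : ℕ) - ε) - exceedFraction z ((t : ℕ) + ε) ≤
      CHalf / 4 * s₁ * normalTail (t : ℕ) ^ (1 / 2 : ℝ))
    (hsmall : 3 / 2 * (CHalf * s₁) * √(normalTail t) < 3 / 4 * ε' * ((J.card : ℝ) / m) ∨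
      (1 + COne * s₂) * normalTail t < 3 / 4 * ε' * ((J.card : ℝ) / m)) :
    (1 - ε') * ((J.card : ℝ) / m) < adaptiveEstimator (CHalf * s₁) (COne * s₂) T x := by
  have h1 := le_exceedFraction hx hxJ t
  have hC : 0 ≤ (1 - ε') * ((J.card : ℝ) / m) :=
    mul_nonneg (by linarith) (by positivity)
  rcases hsmall with h | h
  · refine lt_of_lt_of_le (lt_propEstimator hC ht ?_) (le_max_left _ _)
    have h2 := (abs_le.1 hhalf).1
    have h3 := le_exceedFraction_add_band (z := z) hε t
    rw [← Real.sqrt_eq_rpow] at h2 hbandH ⊢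
    linarith
  · refine lt_of_lt_of_le (lt_propEstimator hC ht ?_) (le_max_right _ _)
    have h2 := exceedFraction_nonneg z (t + ε)
    rw [Real.rpow_one]
    linarith

end Deterministic

/-! ### Probability bounds for the adaptive estimator -/

lemma one_sub_le_measureReal {α : Type*} [MeasurableSpace α] {P : Measure α}
    [IsProbabilityMeasure P] {B S : Set α} {b : ℝ} (h : ∀ ω ∉ B, ω ∈ S) (hB : P.real B ≤ b) :
    1 - b ≤ P.real S := by
  have h1 : B ∪ S = univ := eq_univ_of_forall fun ω => or_iff_not_imp_left.2 (h ω)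
  have h2 := measureReal_union_le (μ := P) B S
  rw [h1, probReal_univ] at h2
  linarith

/-- A small shift is compatible with all levels of the grid: these are at least one, being positive
integers, and at most of order `√(log m)`. -/
lemma thresholdGrid_shift {m : ℕ} {γ η ε : ℝ} (hm : 2 ≤ m) (hε : 0 ≤ ε)
    (hν : ε * (m : ℝ) ^ max (η - γ) 0 * √(Real.log m) ≤ 1 / 4)
    (he : (m : ℝ) ^ (-thresholdExponent γ η) < 1) :
    ε * √(Real.log m) ≤ ε * (m : ℝ) ^ max (η - γ) 0 * √(Real.log m) ∧ ε ≤ 1 / 2 ∧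
      0 < thresholdExponent γ η ∧
      ∀ t ∈ thresholdGrid m γ η, ε ≤ (t : ℝ) ∧ (t : ℝ) * ε ≤ 1 := by
  have hm1 : (1 : ℝ) ≤ m := by
    have : 1 ≤ m := by omega
    exact_mod_cast this
  have hL := four_fifths_le_sqrt_log hm
  have h1 : (1 : ℝ) ≤ (m : ℝ) ^ max (η - γ) 0 :=
    Real.one_le_rpow hm1 (le_max_right _ _)
  have h2 : ε * √(Real.log m) ≤ ε * (m : ℝ) ^ max (η - γ) 0 * √(Real.log m) := by
    refine mul_le_mul_of_nonneg_right ?_ (by linarith)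
    nlinarith
  have h3 : 0 < thresholdExponent γ η := by
    by_contra h
    have h4 : thresholdExponent γ η = 0 := le_antisymm (not_lt.1 h) (thresholdExponent_nonneg _ _)
    rw [h4, neg_zero, Real.rpow_zero] at he
    exact lt_irrefl _ he
  have hε1 : ε ≤ 1 / 2 := by nlinarith
  refine ⟨h2, hε1, h3, fun t ht => ⟨?_, ?_⟩⟩
  · have h5 : 0 < Real.log m := Real.log_pos (by exact_mod_cast hm)
    have h6 : (0 : ℝ) < t :=
      lt_of_lt_of_le (Real.sqrt_pos.2 (by positivity)) (mem_thresholdGrid.1 ht).2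
    have h7 : (1 : ℝ) ≤ t := by exact_mod_cast Nat.cast_pos.1 h6
    linarith
  · have := one_add_le_of_mem_thresholdGrid hm ht
    nlinarith

namespace PFAModel

section Sample

variable {m k : ℕ} (M : PFAModel m k) {C γ η h : ℝ} {I₁ : Finset (Fin m)}
  {Ω : Type*} [MeasurableSpace Ω] {P : Measure Ω} [IsProbabilityMeasure P]
  {W what : Ω → EuclideanSpace ℝ (Fin k)} {K : Ω → EuclideanSpace ℝ (Fin m)}
  {I : Ω → Set (Fin m)} {ε p : ℝ}

/-- Where the shifts due to the estimated factors are at most `ε`, the adjusted statistics are the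
scaled errors, raised on the signal set, up to `ε`. -/
lemma adjusted_bounds {w v : EuclideanSpace ℝ (Fin k)} {e : EuclideanSpace ℝ (Fin m)}
    (hgood : ¬ ∃ i, ε < |M.a i * inner ℝ (M.b i) (w - v)|) :
    (∀ i ∉ I₁, M.adjusted (M.obs (signalMean I₁ h) w e) v i ≤ M.scaledErrors e i + ε) ∧
    (∀ i ∉ I₁, M.scaledErrors e i - ε ≤ M.adjusted (M.obs (signalMean I₁ h) w e) v i) ∧
    ∀ i ∈ I₁, M.scaledErrors e i + M.aMin * √(2 * h * Real.log m) - ε ≤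
      M.adjusted (M.obs (signalMean I₁ h) w e) v i := by
  push Not at hgood
  refine ⟨fun i hi => ?_, fun i hi => ?_, fun i hi => ?_⟩
  · rw [adjusted_obs_eq, signalMean, if_neg hi]
    linarith [(abs_le.1 (hgood i)).2]
  · rw [adjusted_obs_eq, signalMean, if_neg hi]
    linarith [(abs_le.1 (hgood i)).1]
  · rw [adjusted_obs_eq, signalMean, if_pos hi]
    have := mul_le_mul_of_nonneg_right (M.aMin_le i) (Real.sqrt_nonneg (2 * h * Real.log m))
    linarith [(abs_le.1 (hgood i)).1]

/-- A finite-sample version of the asymptotic lower bound property. -/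
lemma le_measureReal_adaptiveEstimator_lt (hm : 2 ≤ m)
    (hK : HasLaw K (multivariateGaussian 0 M.A) P)
    (hπ : (I₁.card : ℝ) / m = (m : ℝ) ^ (-γ)) (hε : 0 ≤ ε)
    (hν : ε * (m : ℝ) ^ max (η - γ) 0 * √(Real.log m) ≤ 1 / 4)
    (hp : P.real {ω | ∃ i, ε < |M.a i * inner ℝ (M.b i) (W ω - what ω)|} ≤ p)
    {α δ cHalf cOne : ℝ} (hδ : 0 < δ)
    (he : (m : ℝ) ^ (-thresholdExponent γ η) ≤ δ / (2 * (1 + δ)))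
    (hHalf : IsBounding M (1 / 2) (thresholdGrid m γ η) (α / 2) cHalf)
    (hOne : IsBounding M 1 (thresholdGrid m γ η) (α / 2) cOne) :
    1 - α - (p + 96 / δ * (ε * (m : ℝ) ^ max (η - γ) 0 * √(Real.log m))) ≤
      P.real {ω | adaptiveEstimator cHalf cOne (thresholdGrid m γ η)
        (M.adjusted (M.obs (signalMean I₁ h) (W ω) (K ω)) (what ω)) <
          (I₁.card : ℝ) / m * (1 + δ)} := by
  have hm0 : (0 : ℝ) < m := by positivity
  have hm1 : (1 : ℝ) ≤ m := by
    have : 1 ≤ m := by omega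
    exact_mod_cast this
  have hπ0 : 0 < (I₁.card : ℝ) / m := by rw [hπ]; positivity
  have he1 : (m : ℝ) ^ (-thresholdExponent γ η) < 1 := by
    refine he.trans_lt ?_
    rw [div_lt_one (by positivity)]
    linarith
  obtain ⟨-, -, -, hT⟩ := thresholdGrid_shift hm hε hν he1
  have hZ := M.hasLaw_scaledErrors hK
  have b1 := (measureReal_mem_le hZ
    {z | cHalf < discrepancy (1 / 2) (thresholdGrid m γ η) (fun i => z i)}).trans hHalf.le
  have b2 := (measureReal_mem_le hZ
    {z | cOne < discrepancy 1 (thresholdGrid m γ η) (fun i => z i)}).trans hOne.le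
  have b3 := (measureReal_mem_le hZ _).trans
    (M.measureReal_exists_band_const_le hm hε hT (mul_pos (by positivity : 0 < δ / 4) hπ0))
  have hexp : 24 * ε * √(Real.log m) * ((m : ℝ) ^ (-thresholdExponent γ η) /
      (δ / 4 * ((I₁.card : ℝ) / m))) ≤
      96 / δ * (ε * (m : ℝ) ^ max (η - γ) 0 * √(Real.log m)) := by
    have h1 : (m : ℝ) ^ (-thresholdExponent γ η) ≤
        (m : ℝ) ^ max (η - γ) 0 * ((I₁.card : ℝ) / m) := by
      rw [hπ, ← Real.rpow_add hm0]
      refine Real.rpow_le_rpow_of_exponent_le hm1 ?_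
      have : γ - max (η - γ) 0 ≤ thresholdExponent γ η := le_max_left _ _
      linarith
    calc _ ≤ 24 * ε * √(Real.log m) * ((m : ℝ) ^ max (η - γ) 0 * ((I₁.card : ℝ) / m) /
        (δ / 4 * ((I₁.card : ℝ) / m))) := by gcongr
      _ = _ := by
        generalize hy : (I₁.card : ℝ) / m = y
        rw [hy] at hπ0
        field_simp
        ring
  rw [sub_sub]
  refine one_sub_le_measureReal (fun ω hω => ?_) ((measureReal_union_le _ _).trans
    (add_le_add ((measureReal_union_le _ _).trans (add_le_add b1 b2))
      ((measureReal_union_le _ _).trans (add_le_add hp (b3.trans hexp))))) |>.trans' ?_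
  · simp only [mem_union, not_or] at hω
    obtain ⟨⟨h1, h2⟩, h3, h4⟩ := hω
    refine adaptiveEstimator_lt_of_discrepancy_le hδ hπ0 hε (M.adjusted_bounds h3).1
      (not_lt.1 h1) (not_lt.1 h2) (fun t ht => ?_) fun t ht => ?_
    · by_contra hcon
      exact h4 ⟨t, ht, not_le.1 hcon⟩
    · exact ((normalTail_le_gaussExp (Nat.cast_nonneg t)).trans
        (gaussExp_le_of_mem_thresholdGrid hm ht)).trans he
  · linarith

variable {CHalf COne : ℝ}

/-- A finite-sample bound for the probability of overestimating the proportion. -/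
lemma measureReal_proportion_le_adaptiveEstimator_le (hm : 2 ≤ m) (hγ : 0 < γ)
    (hK : HasLaw K (multivariateGaussian 0 M.A) P)
    (hπ : (I₁.card : ℝ) / m = (m : ℝ) ^ (-γ)) (hdep : M.meanAbsAdjCorr = (m : ℝ) ^ (-η))
    (hε : 0 ≤ ε) (hν : ε * (m : ℝ) ^ max (η - γ) 0 * √(Real.log m) ≤ 1 / 4)
    (hp : P.real {ω | ∃ i, ε < |M.a i * inner ℝ (M.b i) (W ω - what ω)|} ≤ p)
    (he : (m : ℝ) ^ (-thresholdExponent γ η) < 1) (hC : 0 < C) (hHalf : C ≤ CHalf)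
    (hOne : C ≤ COne) (hCL : 2 < C * √(Real.log m)) :
    P.real {ω | (I₁.card : ℝ) / m ≤ adaptiveEstimator (CHalf * √((m : ℝ) ^ (-η) * Real.log m))
        (COne * √(Real.log m)) (thresholdGrid m γ η)
        (M.adjusted (M.obs (signalMean I₁ h) (W ω) (K ω)) (what ω))} ≤
      p + (8960 / C ^ 2 + 4 / C + 64 / C ^ 2) / √(Real.log m) +
        11520 / C * (ε * (m : ℝ) ^ max (η - γ) 0 * √(Real.log m)) := by
  have hm0 : (0 : ℝ) < m := by positivity
  have hm1 : (1 : ℝ) ≤ m := by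
    have : 1 ≤ m := by omega
    exact_mod_cast this
  have hL : 0 < √(Real.log m) := Real.sqrt_pos.2 (Real.log_pos (by exact_mod_cast hm))
  have hπ0 : 0 < (I₁.card : ℝ) / m := by rw [hπ]; positivity
  have hπ1 : (I₁.card : ℝ) / m ≤ 1 := by
    rw [hπ]
    exact Real.rpow_le_one_of_one_le_of_nonpos hm1 (by linarith)
  have hH0 : 0 < CHalf := hC.trans_le hHalf
  have hO0 : 0 < COne := hC.trans_le hOne
  obtain ⟨hνε, -, he0, hT⟩ := thresholdGrid_shift hm hε hν he
  have hZ := M.hasLaw_scaledErrors hK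
  have hx : η - thresholdExponent γ η ≤ 2 * max (η - γ) 0 := by
    linarith [neg_thresholdExponent_le γ η]
  have b1 := (measureReal_mem_le hZ _).trans
    (M.measureReal_exists_half_lt_le hm (by positivity : 0 < CHalf / 4) hdep γ)
  have b2 := (measureReal_mem_le hZ _).trans
    (M.measureReal_exists_le_exceedFraction_le hm (by positivity : 0 < COne / 2) γ η)
  have b3 := (measureReal_mem_le hZ _).trans
    (M.measureReal_exists_band_half_le hm hε hT (by positivity : 0 < CHalf / 4) hx)
  have b4 := (measureReal_mem_le hZ _).trans
    (M.measureReal_exists_band_one_le hm hε hT (by positivity : 0 < COne / 4))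
  have c1 : 560 / ((CHalf / 4) ^ 2 * √(Real.log m)) ≤ 8960 / C ^ 2 / √(Real.log m) := by
    calc _ ≤ 560 / ((C / 4) ^ 2 * √(Real.log m)) := by gcongr
      _ = _ := by
        field_simp
        norm_num
  have c2 : (2 / (COne / 2) + 16 / (COne / 2) ^ 2) / √(Real.log m) ≤
      (4 / C + 64 / C ^ 2) / √(Real.log m) := by
    calc _ ≤ (2 / (C / 2) + 16 / (C / 2) ^ 2) / √(Real.log m) := by gcongr
      _ = _ := by
        field_simp
        ring
  have c3 : 1440 / (CHalf / 4) * (ε * (m : ℝ) ^ max (η - γ) 0 * √(Real.log m)) ≤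
      5760 / C * (ε * (m : ℝ) ^ max (η - γ) 0 * √(Real.log m)) := by
    calc _ ≤ 1440 / (C / 4) * (ε * (m : ℝ) ^ max (η - γ) 0 * √(Real.log m)) := by gcongr
      _ = _ := by
        field_simp
        ring
  have c4 : 1440 / (COne / 4) * (ε * √(Real.log m)) ≤
      5760 / C * (ε * (m : ℝ) ^ max (η - γ) 0 * √(Real.log m)) := by
    calc _ ≤ 1440 / (C / 4) * (ε * (m : ℝ) ^ max (η - γ) 0 * √(Real.log m)) := by gcongr
      _ = _ := by
        field_simp
        ring
  refine (measureReal_mono fun ω hbad => ?_).trans ((measureReal_union_le _ _).trans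
    (add_le_add hp ((measureReal_union_le _ _).trans
      (add_le_add ((measureReal_union_le _ _).trans (add_le_add (b1.trans c1) (b2.trans c2)))
      ((measureReal_union_le _ _).trans (add_le_add (b3.trans c3) (b4.trans c4))))))) |>.trans ?_
  · rw [mem_ofPred_eq] at hbad
    by_contra hω
    simp only [mem_union, not_or] at hω
    obtain ⟨h0, ⟨h1, h2⟩, h3, h4⟩ := hω
    refine absurd hbad (not_le.2 ?_)
    refine adaptiveEstimator_lt hπ0 hπ1 hε (M.adjusted_bounds h0).1 (mul_pos hO0 hL)
      (fun t ht => ?_) (fun t ht => ?_) (fun t ht => ?_) (fun t ht => ?_) fun t ht => ?_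
    · by_contra hcon
      exact h1 ⟨t, ht, not_le.1 hcon⟩
    · by_contra hcon
      exact h2 ⟨t, ht, (not_le.1 hcon).le⟩
    · by_contra hcon
      exact h3 ⟨t, ht, not_le.1 hcon⟩
    · by_contra hcon
      exact h4 ⟨t, ht, not_le.1 hcon⟩
    · have a1 : √(normalTail t) ≤ (m : ℝ) ^ (-thresholdExponent γ η / 2) := by
        refine (Real.sqrt_le_sqrt ((normalTail_le_gaussExp (Nat.cast_nonneg t)).trans
          (gaussExp_le_of_mem_thresholdGrid hm ht))).trans (le_of_eq ?_)
        rw [Real.sqrt_eq_rpow, ← Real.rpow_mul hm0.le]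
        congr 1
        ring
      have a2 : η / 2 ≤ γ + thresholdExponent γ η / 2 := by
        -- the exponent vanishes as soon as `2 * γ ≤ η`
        by_contra hcon
        have : thresholdExponent γ η = 0 := by
          refine max_eq_right ?_
          have := le_max_left (η - γ) 0
          linarith
        linarith
      calc _ ≤ (m : ℝ) ^ (-γ) * (m : ℝ) ^ (-thresholdExponent γ η / 2) := by
            rw [hπ]
            gcongr
        _ ≤ (m : ℝ) ^ (-η / 2) := by
            rw [← Real.rpow_add hm0]
            exact Real.rpow_le_rpow_of_exponent_le hm1 (by linarith)
        _ < _ := by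
            rw [sqrt_rpow_neg_mul]
            have a3 : (0 : ℝ) < (m : ℝ) ^ (-η / 2) := by positivity
            have a4 : C * √(Real.log m) ≤ CHalf * √(Real.log m) := by gcongr
            nlinarith
  · exact le_of_eq (by ring)

end Sample

end PFAModel

/-! ### The level at which the signals are detected -/

section Level

variable {m : ℕ} {γ η e ρ : ℝ}

/-- A level slightly above the lower end of the threshold grid. -/
noncomputable def detectionLevel (m : ℕ) (e ρ : ℝ) : ℕ := ⌈√(2 * (e + ρ) * Real.log m)⌉₊

lemma le_detectionLevel (m : ℕ) (e ρ : ℝ) :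
    √(2 * (e + ρ) * Real.log m) ≤ detectionLevel m e ρ := Nat.le_ceil _

lemma detectionLevel_le (m : ℕ) (e ρ : ℝ) :
    (detectionLevel m e ρ : ℝ) ≤ √(2 * (e + ρ) * Real.log m) + 1 :=
  (Nat.ceil_lt_add_one (Real.sqrt_nonneg _)).le

lemma sqrt_two_mul_add_mul_log_le (he : e ≤ 1) (hρ1 : ρ ≤ 1) :
    √(2 * (e + ρ) * Real.log m) ≤ 2 * √(Real.log m) := by
  have hL : 0 ≤ Real.log m := Real.log_natCast_nonneg m
  refine Real.sqrt_le_iff.2 ⟨by positivity, ?_⟩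
  rw [mul_pow, Real.sq_sqrt hL]
  nlinarith

lemma detectionLevel_mem (hρ : 0 ≤ ρ) (hρ1 : ρ ≤ 1) (he : thresholdExponent γ η ≤ 1)
    (hL : 5 ≤ √(Real.log m)) :
    detectionLevel m (thresholdExponent γ η) ρ ∈ thresholdGrid m γ η := by
  have hL0 : 0 ≤ Real.log m := Real.log_natCast_nonneg m
  refine mem_thresholdGrid.2 ⟨Nat.lt_succ_of_le (Nat.le_floor ?_), ?_⟩
  · refine (detectionLevel_le _ _ _).trans ?_
    refine Real.le_sqrt_of_sq_le ?_
    have h1 := sqrt_two_mul_add_mul_log_le (m := m) he hρ1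
    have h2 := Real.sqrt_nonneg (2 * (thresholdExponent γ η + ρ) * Real.log m)
    have h3 := Real.sq_sqrt hL0
    nlinarith
  · refine le_trans (Real.sqrt_le_sqrt ?_) (le_detectionLevel _ _ _)
    nlinarith

/-- The intensity of the signals exceeds the detection level by a multiple of `√(log m)`. -/
lemma detectionLevel_add_le {A h : ℝ} (hA : 0 ≤ A) (he0 : 0 ≤ e) (he : e ≤ 1) (hρ : 0 ≤ ρ)
    (hρ1 : ρ ≤ 1) (h1 : e + 2 * ρ ≤ A ^ 2 * h) :
    √(Real.log m) * ρ / 3 + detectionLevel m e ρ - 1 ≤ A * √(2 * h * Real.log m) := by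
  have hL0 : 0 ≤ Real.log m := Real.log_natCast_nonneg m
  have h2 := detectionLevel_le m e ρ
  -- the gap between the square roots is of order `ρ √(log m)` since both radicands are `O(log m)`
  have h3 : √(Real.log m) * ρ / 3 + √(2 * (e + ρ) * Real.log m) ≤
      √(2 * (e + 2 * ρ) * Real.log m) := by
    refine Real.le_sqrt_of_sq_le ?_
    have a1 := sqrt_two_mul_add_mul_log_le (m := m) he hρ1
    have a2 := Real.sqrt_nonneg (2 * (e + ρ) * Real.log m)
    have a3 : √(2 * (e + ρ) * Real.log m) ^ 2 = 2 * (e + ρ) * Real.log m :=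
      Real.sq_sqrt (by positivity)
    have a4 := Real.sq_sqrt hL0
    have a5 := Real.sqrt_nonneg (Real.log m)
    have a6 : √(Real.log m) * √(2 * (e + ρ) * Real.log m) ≤ 2 * Real.log m := by nlinarith
    have a7 : ρ * (√(Real.log m) * √(2 * (e + ρ) * Real.log m)) ≤ ρ * (2 * Real.log m) := by
      gcongr
    have a8 : ρ ^ 2 * Real.log m ≤ ρ * Real.log m :=
      mul_le_mul_of_nonneg_right (by nlinarith) hL0
    calc _ = Real.log m * ρ ^ 2 / 9 + 2 / 3 * (ρ * (√(Real.log m) * √(2 * (e + ρ) * Real.log m))) +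
          2 * (e + ρ) * Real.log m := by
          rw [add_sq, a3, div_pow, mul_pow, a4]
          ring
      _ ≤ _ := by nlinarith [mul_nonneg hρ hL0]
  have h4 : √(2 * (e + 2 * ρ) * Real.log m) ≤ A * √(2 * h * Real.log m) := by
    rw [← Real.sqrt_sq hA, ← Real.sqrt_mul (sq_nonneg A)]
    refine Real.sqrt_le_sqrt ?_
    nlinarith
  linarith

end Level

lemma thresholdExponent_le {γ η : ℝ} (hγ : 0 ≤ γ) : thresholdExponent γ η ≤ γ :=
  max_le (by linarith [le_max_right (η - γ) 0]) hγ

/-- At the detection level one of the two bounding constants is negligible against the proportion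
of signals: that with `θ = 1/2` for `γ ≤ η`, that with `θ = 1` otherwise. -/
lemma bounding_small {m : ℕ} {γ η ρ ε' CHalf COne : ℝ} (hm : 2 ≤ m) (hγ : 0 < γ)
    (hρ : 0 ≤ ρ) (hε' : 0 < ε')
    (hO0 : 1 ≤ COne * √(Real.log m)) (hH : CHalf ≤ (m : ℝ) ^ (ρ / 8))
    (hO : COne ≤ (m : ℝ) ^ (ρ / 8)) (hsm : √(Real.log m) * (m : ℝ) ^ (-(3 * ρ / 8)) ≤ ε' / 4) :
    3 / 2 * (CHalf * √((m : ℝ) ^ (-η) * Real.log m)) *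
        √(normalTail (detectionLevel m (thresholdExponent γ η) ρ)) <
          3 / 4 * ε' * (m : ℝ) ^ (-γ) ∨
      (1 + COne * √(Real.log m)) * normalTail (detectionLevel m (thresholdExponent γ η) ρ) <
        3 / 4 * ε' * (m : ℝ) ^ (-γ) := by
  have hm0 : (0 : ℝ) < m := by positivity
  have hm1 : (1 : ℝ) ≤ m := by
    have : 1 ≤ m := by omega
    exact_mod_cast this
  set e := thresholdExponent γ η with he
  have he0 : 0 ≤ e := thresholdExponent_nonneg _ _
  set t := detectionLevel m e ρ
  have hΦ : normalTail t ≤ (m : ℝ) ^ (-(e + ρ)) :=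
    (normalTail_le_gaussExp (Nat.cast_nonneg t)).trans
      (gaussExp_le_rpow hm (by positivity) (le_detectionLevel _ _ _))
  have hπ : (0 : ℝ) < (m : ℝ) ^ (-γ) := by positivity
  rcases le_or_gt γ η with h | h
  · left
    have a1 : √(normalTail t) ≤ (m : ℝ) ^ (-(e + ρ) / 2) := by
      refine (Real.sqrt_le_sqrt hΦ).trans (le_of_eq ?_)
      rw [Real.sqrt_eq_rpow, ← Real.rpow_mul hm0.le]
      congr 1
      ring
    have a2 : γ ≤ (η + e) / 2 := by
      have : γ - max (η - γ) 0 ≤ e := le_max_left _ _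
      rw [max_eq_left (by linarith)] at this
      linarith
    have a3 : CHalf * √((m : ℝ) ^ (-η) * Real.log m) * √(normalTail t) ≤
        ε' / 4 * (m : ℝ) ^ (-γ) := by
      rw [sqrt_rpow_neg_mul]
      calc _ ≤ (m : ℝ) ^ (ρ / 8) * ((m : ℝ) ^ (-η / 2) * √(Real.log m)) *
            (m : ℝ) ^ (-(e + ρ) / 2) := by gcongr
        _ = √(Real.log m) * ((m : ℝ) ^ (ρ / 8) * (m : ℝ) ^ (-η / 2) *
            (m : ℝ) ^ (-(e + ρ) / 2)) := by ring
        _ = √(Real.log m) * (m : ℝ) ^ (-(3 * ρ / 8)) * (m : ℝ) ^ (-((η + e) / 2)) := by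
            rw [← Real.rpow_add hm0, ← Real.rpow_add hm0, mul_assoc, ← Real.rpow_add hm0]
            congr 2
            ring
        _ ≤ _ := by
            gcongr
    nlinarith [mul_pos hε' hπ]
  · right
    have a1 : γ = e := by
      rw [he, thresholdExponent, max_eq_right (a := η - γ) (by linarith), sub_zero,
        max_eq_left hγ.le]
    have a2 : COne * √(Real.log m) * normalTail t ≤ ε' / 4 * (m : ℝ) ^ (-γ) := by
      calc _ ≤ (m : ℝ) ^ (ρ / 8) * √(Real.log m) * (m : ℝ) ^ (-(e + ρ)) := by
            have := normalTail_nonneg t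
            gcongr
        _ = √(Real.log m) * (m : ℝ) ^ (ρ / 8 - ρ) * (m : ℝ) ^ (-γ) := by
            rw [mul_comm ((m : ℝ) ^ (ρ / 8)), mul_assoc, mul_assoc, ← Real.rpow_add hm0,
              ← Real.rpow_add hm0, ← a1]
            congr 2
            ring
        _ ≤ √(Real.log m) * (m : ℝ) ^ (-(3 * ρ / 8)) * (m : ℝ) ^ (-γ) := by
            gcongr
            linarith
        _ ≤ _ := by gcongr
    have a3 := mul_le_mul_of_nonneg_right hO0 (normalTail_nonneg t)
    nlinarith [mul_pos hε' hπ]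

namespace PFAModel

section Sample

variable {m k : ℕ} (M : PFAModel m k)

lemma measureReal_lt_partialFraction_le {J : Finset (Fin m)} (hJ : 0 < (J.card : ℝ) / m) {b : ℝ}
    (hb : 0 < b) (t : ℝ) :
    M.nullLaw.real {z : EuclideanSpace ℝ (Fin m) |
      b * ((J.card : ℝ) / m) < partialFraction J (fun i => z i) t} ≤ normalTail t / b := by
  refine (measureReal_lt_le_integral_div (fun z => partialFraction_nonneg J _ t)
    (integrable_partialFraction J t) (mul_pos hb hJ)
    (integral_partialFraction M.posSemidef_adjCorr M.adjCorr_self J t).le).trans (le_of_eq ?_)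
  generalize (J.card : ℝ) / m = y at hJ
  field_simp

lemma measureReal_lt_sub_partialFraction_le {J : Finset (Fin m)} (hJ : 0 < (J.card : ℝ) / m)
    {b : ℝ} (hb : 0 < b) (t : ℝ) :
    M.nullLaw.real {z : EuclideanSpace ℝ (Fin m) |
      b * ((J.card : ℝ) / m) < (J.card : ℝ) / m - partialFraction J (fun i => z i) t} ≤
      normalTail (-t) / b := by
  refine (measureReal_lt_le_integral_div (C := (J.card : ℝ) / m * normalTail (-t))
    (fun z => sub_nonneg.2 (partialFraction_le J _ t))
    ((integrable_const _).sub (integrable_partialFraction J t)) (mul_pos hb hJ) ?_).trans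
    (le_of_eq ?_)
  · refine (integral_sub (integrable_const _) (integrable_partialFraction J t)).trans_le ?_
    rw [integral_partialFraction M.posSemidef_adjCorr M.adjCorr_self J t, normalTail_neg,
      integral_const, probReal_univ, one_smul]
    linarith
  · generalize (J.card : ℝ) / m = y at hJ
    field_simp

variable {C γ η h : ℝ} {I₁ : Finset (Fin m)}
  {Ω : Type*} [MeasurableSpace Ω] {P : Measure Ω} [IsProbabilityMeasure P]
  {W what : Ω → EuclideanSpace ℝ (Fin k)} {K : Ω → EuclideanSpace ℝ (Fin m)}
  {I : Ω → Set (Fin m)} {ε p : ℝ} {CHalf COne ρ ε' : ℝ}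

/-- A finite-sample bound for the probability of missing a fraction `ε'` of the proportion. -/
lemma measureReal_adaptiveEstimator_le_le (hm : 2 ≤ m) (hγ : 0 < γ) (hγ1 : γ < 1)
    (hK : HasLaw K (multivariateGaussian 0 M.A) P)
    (hπ : (I₁.card : ℝ) / m = (m : ℝ) ^ (-γ)) (hdep : M.meanAbsAdjCorr = (m : ℝ) ^ (-η))
    (hε : 0 ≤ ε) (hν : ε * (m : ℝ) ^ max (η - γ) 0 * √(Real.log m) ≤ 1 / 4)
    (hp : P.real {ω | ∃ i, ε < |M.a i * inner ℝ (M.b i) (W ω - what ω)|} ≤ p)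
    (he : (m : ℝ) ^ (-thresholdExponent γ η) < 1) (hC : 0 < C) (hHalf : C ≤ CHalf)
    (hO0 : 1 ≤ COne * √(Real.log m)) (hL5 : 5 ≤ √(Real.log m))
    (hρ : 0 < ρ) (hρ1 : ρ ≤ 1) (hε' : 0 < ε') (hε'1 : ε' ≤ 1)
    (hH : CHalf ≤ (m : ℝ) ^ (ρ / 8)) (hO : COne ≤ (m : ℝ) ^ (ρ / 8))
    (hsm : √(Real.log m) * (m : ℝ) ^ (-(3 * ρ / 8)) ≤ ε' / 4)
    (hsig : thresholdExponent γ η + 2 * ρ ≤ M.aMin ^ 2 * h) :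
    P.real {ω | adaptiveEstimator (CHalf * √((m : ℝ) ^ (-η) * Real.log m))
        (COne * √(Real.log m)) (thresholdGrid m γ η)
        (M.adjusted (M.obs (signalMean I₁ h) (W ω) (K ω)) (what ω)) ≤
          (1 - ε') * ((I₁.card : ℝ) / m)} ≤
      p + 8960 / C ^ 2 / √(Real.log m) +
        5760 / C * (ε * (m : ℝ) ^ max (η - γ) 0 * √(Real.log m)) +
        16 / ε' * normalTail (√(Real.log m) * ρ / 3 - 2) := by
  have hm0 : (0 : ℝ) < m := by positivity
  have hL : 0 < √(Real.log m) := by linarith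
  have hL0 : 0 < Real.log m := Real.sqrt_pos.1 hL
  have hπ0 : 0 < (I₁.card : ℝ) / m := by rw [hπ]; positivity
  have hH0 : 0 < CHalf := hC.trans_le hHalf
  obtain ⟨hνε, hε2, he0, hT⟩ := thresholdGrid_shift hm hε hν he
  have hZ := M.hasLaw_scaledErrors hK
  have hx : η - thresholdExponent γ η ≤ 2 * max (η - γ) 0 := by
    linarith [neg_thresholdExponent_le γ η]
  have he1 : thresholdExponent γ η ≤ 1 := (thresholdExponent_le hγ.le).trans hγ1.le
  set t := detectionLevel m (thresholdExponent γ η) ρ with ht_def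
  have ht : t ∈ thresholdGrid m γ η := detectionLevel_mem hρ.le hρ1 he1 hL5
  set g := M.aMin * √(2 * h * Real.log m) with hg
  have hgt : √(Real.log m) * ρ / 3 + t - 1 ≤ g :=
    detectionLevel_add_le (zero_le_one.trans (M.one_le_aMin (by omega))) he0.le he1 hρ.le hρ1 hsig
  have hb : 0 < ε' / 8 := by positivity
  have b1 := (measureReal_mem_le hZ _).trans
    (M.measureReal_exists_half_lt_le hm (by positivity : 0 < CHalf / 4) hdep γ)
  have b3 := (measureReal_mem_le hZ _).trans
    (M.measureReal_exists_band_half_le hm hε hT (by positivity : 0 < CHalf / 4) hx)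
  have b5 := (measureReal_mem_le hZ _).trans
    (M.measureReal_lt_partialFraction_le hπ0 hb (t + ε))
  have b6 := (measureReal_mem_le hZ _).trans
    (M.measureReal_lt_sub_partialFraction_le hπ0 hb (t + ε - g))
  have c1 : 560 / ((CHalf / 4) ^ 2 * √(Real.log m)) ≤ 8960 / C ^ 2 / √(Real.log m) := by
    calc _ ≤ 560 / ((C / 4) ^ 2 * √(Real.log m)) := by gcongr
      _ = _ := by
        field_simp
        norm_num
  have c3 : 1440 / (CHalf / 4) * (ε * (m : ℝ) ^ max (η - γ) 0 * √(Real.log m)) ≤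
      5760 / C * (ε * (m : ℝ) ^ max (η - γ) 0 * √(Real.log m)) := by
    calc _ ≤ 1440 / (C / 4) * (ε * (m : ℝ) ^ max (η - γ) 0 * √(Real.log m)) := by gcongr
      _ = _ := by
        field_simp
        ring
  have c5 : normalTail (t + ε) / (ε' / 8) ≤
      8 / ε' * normalTail (√(Real.log m) * ρ / 3 - 2) := by
    have a1 : √(Real.log m) * ρ / 3 - 2 ≤ t + ε := by
      have a2 : √(Real.log m) * ρ ≤ t := by
        refine le_trans (Real.le_sqrt_of_sq_le ?_) (le_detectionLevel _ _ _)
        rw [mul_pow, Real.sq_sqrt hL0.le]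
        have : ρ ^ 2 ≤ 2 * (thresholdExponent γ η + ρ) := by nlinarith
        nlinarith
      have a3 := mul_pos hL hρ
      linarith
    calc _ ≤ normalTail (√(Real.log m) * ρ / 3 - 2) / (ε' / 8) := by
          have := normalTail_antitone a1
          gcongr
      _ = _ := by field_simp
  have c6 : normalTail (-(t + ε - g)) / (ε' / 8) ≤
      8 / ε' * normalTail (√(Real.log m) * ρ / 3 - 2) := by
    calc _ ≤ normalTail (√(Real.log m) * ρ / 3 - 2) / (ε' / 8) := by
          have := normalTail_antitone
            (show √(Real.log m) * ρ / 3 - 2 ≤ -(t + ε - g) by linarith)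
          gcongr
      _ = _ := by field_simp
  refine (measureReal_mono fun ω hbad => ?_).trans ((measureReal_union_le _ _).trans
    (add_le_add hp ((measureReal_union_le _ _).trans
      (add_le_add ((measureReal_union_le _ _).trans (add_le_add (b1.trans c1) (b3.trans c3)))
      ((measureReal_union_le _ _).trans (add_le_add (b5.trans c5) (b6.trans c6))))))) |>.trans ?_
  · rw [mem_ofPred_eq] at hbad
    by_contra hω
    simp only [mem_union, not_or] at hω
    obtain ⟨h0, ⟨h1, h3⟩, h5, h6⟩ := hω
    have hadj := M.adjusted_bounds (I₁ := I₁) (h := h) (e := K ω) h0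
    refine absurd hbad (not_le.2 ?_)
    refine lt_adaptiveEstimator hε'1 hε hadj.2.1 hadj.2.2 ht (not_lt.1 h5) (not_lt.1 h6) ?_ ?_ ?_
    · by_contra hcon
      exact h1 ⟨t, ht, not_le.1 hcon⟩
    · by_contra hcon
      exact h3 ⟨t, ht, not_le.1 hcon⟩
    · rw [hπ]
      exact bounding_small hm hγ hρ.le hε' hO0 hH hO hsm
  · exact le_of_eq (by ring)

end Sample

end PFAModel

/-! ### Asymptotics of the adaptive estimator -/

lemma tendsto_sqrt_log_mul_rpow_neg {m : ℕ → ℕ} (hm : Tendsto m atTop atTop) {a : ℝ} (ha : 0 < a) :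
    Tendsto (fun n => √(Real.log (m n)) * (m n : ℝ) ^ (-a)) atTop (𝓝 0) := by
  have hm' : Tendsto (fun n => (m n : ℝ)) atTop atTop := tendsto_natCast_atTop_atTop.comp hm
  have h1 : Tendsto (fun x : ℝ => Real.log x * x ^ (-(2 * a))) atTop (𝓝 0) := by
    refine (isLittleO_log_rpow_atTop (show 0 < 2 * a by positivity)).tendsto_div_nhds_zero.congr' ?_
    filter_upwards [eventually_gt_atTop 0] with x hx
    rw [Real.rpow_neg hx.le, div_eq_mul_inv]
  have h2 := (h1.comp hm').sqrt
  rw [Real.sqrt_zero] at h2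
  refine h2.congr fun n => ?_
  have h3 : (0 : ℝ) ≤ m n := by positivity
  simp only [Function.comp_apply]
  rw [Real.sqrt_mul (Real.log_natCast_nonneg _), Real.sqrt_eq_rpow ((m n : ℝ) ^ (-(2 * a))),
    ← Real.rpow_mul h3]
  congr 2
  ring

theorem theorem4p2
    {m k : ℕ → ℕ} (hm : Tendsto m atTop atTop)
    (M : ∀ n, PFAModel (m n) (k n))
    (I₁ : ∀ n, Finset (Fin (m n))) (γ η : ℕ → ℝ) (h : ℝ)
    -- calibrations of sparsity, intensity and adjusted dependence
    (hγ : ∀ n, γ n ∈ Ioo (0 : ℝ) 1)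
    (hπ : ∀ n, ((I₁ n).card : ℝ) / m n = (m n : ℝ) ^ (-γ n))
    (hh : 0 < h)
    (hη : ∀ n, η n ∈ Icc (0 : ℝ) 1)
    (hdep : ∀ n, (M n).meanAbsAdjCorr = (m n : ℝ) ^ (-η n))
    -- the samples with their estimated factors
    {Ω : ℕ → Type*} [∀ n, MeasurableSpace (Ω n)] (P : ∀ n, Measure (Ω n))
    [∀ n, IsProbabilityMeasure (P n)]
    (W what : ∀ n, Ω n → EuclideanSpace ℝ (Fin (k n)))
    (K : ∀ n, Ω n → EuclideanSpace ℝ (Fin (m n)))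
    (I : ∀ n, Ω n → Set (Fin (m n)))
    (hsample : ∀ n, (M n).IsSample (signalMean (I₁ n) h) (P n) (W n) (K n) (I n) (what n))
    (hI : ∃ κ : ℝ, 0 < κ ∧ ∀ᶠ n in atTop, ∀ᵐ ω ∂(P n), κ * m n ≤ ((I n ω).ncard : ℝ))
    -- bounds on the scalings
    (hC1_lower : ∃ C : ℝ, 0 < C ∧ ∀ᶠ n in atTop,
      C * Real.sqrt ((m n : ℝ) ^ (1 - η n)) ≤ (M n).aMin * Real.sqrt (k n))
    (hC1_upper : (fun n => (M n).aMax * Real.sqrt (k n)) =o[atTop]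
      fun n => Real.sqrt ((m n : ℝ) ^ (1 - 2 * max (η n - γ n) 0) / Real.log (m n)))
    -- pervasiveness of the loadings
    (hC2 : ∃ d : ℝ, 0 < d ∧ Tendsto
      (fun n => ⨆ u : Metric.sphere (0 : EuclideanSpace ℝ (Fin (k n))) 1,
        (M n).smallLoadingFraction d u) atTop (𝓝 0)) :
    -- asymptotic lower bound property
    (∀ α : ℝ, 0 < α → ∀ cHalf cOne : ℕ → ℝ,
      (∀ᶠ n in atTop,
        IsBounding (M n) (1 / 2) (thresholdGrid (m n) (γ n) (η n)) (α / 2) (cHalf n) ∧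
        IsBounding (M n) 1 (thresholdGrid (m n) (γ n) (η n)) (α / 2) (cOne n)) →
      ∀ δ : ℝ, 0 < δ → ∃ r : ℕ → ℝ, Tendsto r atTop (𝓝 0) ∧ ∀ n,
        1 - α + r n ≤ (P n).real {ω |
          adaptiveEstimator (cHalf n) (cOne n) (thresholdGrid (m n) (γ n) (η n))
              ((M n).adjusted ((M n).obs (signalMean (I₁ n) h) (W n ω) (K n ω)) (what n ω)) <
            ((I₁ n).card : ℝ) / m n * (1 + δ)}) ∧
    -- admissible constants exist and depend on the level only
    (∀ α : ℝ, 0 < α → ∃ CHalf COne : ℝ, 0 < CHalf ∧ 0 < COne ∧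
      ∀ (m' k' : ℕ) (M' : PFAModel m' k') (γ' η' : ℝ), 2 ≤ m' →
        M'.meanAbsAdjCorr = (m' : ℝ) ^ (-η') →
        IsBounding M' (1 / 2) (thresholdGrid m' γ' η') (α / 2)
          (CHalf * Real.sqrt ((m' : ℝ) ^ (-η') * Real.log m')) ∧
        IsBounding M' 1 (thresholdGrid m' γ' η') (α / 2) (COne * Real.sqrt (Real.log m'))) ∧
    -- consistency
    (∀ α CHalf COne : ℕ → ℝ, Tendsto α atTop (𝓝 0) →
      (∃ C : ℝ, 0 < C ∧ ∀ᶠ n in atTop, C ≤ CHalf n ∧ C ≤ COne n) →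
      (∀ κ : ℝ, 0 < κ → ∀ᶠ n in atTop, CHalf n ≤ (m n : ℝ) ^ κ ∧ COne n ≤ (m n : ℝ) ^ κ) →
      (∀ᶠ n in atTop,
        IsBounding (M n) (1 / 2) (thresholdGrid (m n) (γ n) (η n)) (α n / 2)
          (CHalf n * Real.sqrt ((m n : ℝ) ^ (-η n) * Real.log (m n))) ∧
        IsBounding (M n) 1 (thresholdGrid (m n) (γ n) (η n)) (α n / 2)
          (COne n * Real.sqrt (Real.log (m n)))) →
      (∃ ρ : ℝ, 0 < ρ ∧ ∀ᶠ n in atTop,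
        thresholdExponent (γ n) (η n) + ρ ≤ (M n).aMin ^ 2 * h) →
      ∀ ε : ℝ, 0 < ε → Tendsto (fun n => (P n).real {ω |
        (1 - ε) * (((I₁ n).card : ℝ) / m n) <
          adaptiveEstimator (CHalf n * Real.sqrt ((m n : ℝ) ^ (-η n) * Real.log (m n)))
            (COne n * Real.sqrt (Real.log (m n))) (thresholdGrid (m n) (γ n) (η n))
            ((M n).adjusted ((M n).obs (signalMean (I₁ n) h) (W n ω) (K n ω)) (what n ω)) ∧
        adaptiveEstimator (CHalf n * Real.sqrt ((m n : ℝ) ^ (-η n) * Real.log (m n)))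
            (COne n * Real.sqrt (Real.log (m n))) (thresholdGrid (m n) (γ n) (η n))
            ((M n).adjusted ((M n).obs (signalMean (I₁ n) h) (W n ω) (K n ω)) (what n ω)) <
          ((I₁ n).card : ℝ) / m n}) atTop (𝓝 1)) := by
  obtain ⟨ε, p, hε, hν, hp, hshift, he⟩ :=
    exists_shift_bound hm M hdep hsample hI hC1_lower hC1_upper hC2
  have hm2 : ∀ᶠ n in atTop, 2 ≤ m n := hm.eventually_ge_atTop 2
  have hν4 : ∀ᶠ n in atTop, ε n * (m n : ℝ) ^ max (η n - γ n) 0 * √(Real.log (m n)) ≤ 1 / 4 :=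
    hν.eventually_le_const (by norm_num)
  have hsqrtLog : Tendsto (fun n => √(Real.log (m n))) atTop atTop :=
    Real.tendsto_sqrt_atTop.comp
      (Real.tendsto_log_atTop.comp (tendsto_natCast_atTop_atTop.comp hm))
  refine ⟨fun α hα cHalf cOne hbd δ hδ => ?_, fun α hα => ?_,
    fun α CHalf COne _ hC hgrowth _ hsig ε' hε' => ?_⟩
  · refine ⟨fun n => min 0 ((P n).real {ω |
          adaptiveEstimator (cHalf n) (cOne n) (thresholdGrid (m n) (γ n) (η n))
              ((M n).adjusted ((M n).obs (signalMean (I₁ n) h) (W n ω) (K n ω)) (what n ω)) <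
            ((I₁ n).card : ℝ) / m n * (1 + δ)} - (1 - α)), ?_, fun n => ?_⟩
    · have hlim := (hp.add (hν.const_mul (96 / δ))).neg
      rw [mul_zero, add_zero, neg_zero] at hlim
      refine tendsto_of_tendsto_of_tendsto_of_le_of_le' hlim tendsto_const_nhds ?_
        (Eventually.of_forall fun n => min_le_left _ _)
      filter_upwards [hm2, hν4, hshift, hbd,
        he.eventually_le_const (show 0 < δ / (2 * (1 + δ)) by positivity)] with n h1 h2 h3 h4 h6
      have h7 := (M n).le_measureReal_adaptiveEstimator_lt (h := h) h1 (hsample n).law_K (hπ n)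
        (hε n) h2 h3 hδ h6 h4.1 h4.2
      have h8 : 0 ≤ p n := measureReal_nonneg.trans h3
      have h9 : 0 ≤ 96 / δ * (ε n * (m n : ℝ) ^ max (η n - γ n) 0 * √(Real.log (m n))) := by
        have := hε n
        positivity
      exact le_min (by linarith) (by linarith)
    · have := min_le_right 0 ((P n).real {ω |
          adaptiveEstimator (cHalf n) (cOne n) (thresholdGrid (m n) (γ n) (η n))
              ((M n).adjusted ((M n).obs (signalMean (I₁ n) h) (W n ω) (K n ω)) (what n ω)) <
            ((I₁ n).card : ℝ) / m n * (1 + δ)} - (1 - α))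
      linarith
  · exact ⟨1 + 1400 / α, 2 + 45 / α, by positivity, by positivity,
      fun m' k' M' γ' η' hm' hdep' => ⟨M'.isBounding_half hm' hα hdep' γ',
        M'.isBounding_one hm' hα γ' η'⟩⟩
  · obtain ⟨C, hC, hCle⟩ := hC
    obtain ⟨ρ₀, hρ₀, hsig⟩ := hsig
    set ρ := min (ρ₀ / 2) 1 with hρ_def
    have hρ : 0 < ρ := lt_min (half_pos hρ₀) one_pos
    have hρ1 : ρ ≤ 1 := min_le_right _ _
    set ε₁ := min ε' 1 with hε₁_def
    have hε₁ : 0 < ε₁ := lt_min hε' one_pos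
    -- half of the margin `ρ₀` lifts the detection level, the other half separates it from the signals
    have hsm : Tendsto (fun n => √(Real.log (m n)) * (m n : ℝ) ^ (-(3 * ρ / 8))) atTop (𝓝 0) :=
      tendsto_sqrt_log_mul_rpow_neg hm (by positivity)
    have hinv : Tendsto (fun n => (√(Real.log (m n)))⁻¹) atTop (𝓝 0) :=
      tendsto_inv_atTop_zero.comp hsqrtLog
    have htail : Tendsto (fun n => normalTail (√(Real.log (m n)) * ρ / 3 - 2)) atTop (𝓝 0) := by
      refine tendsto_normalTail_atTop.comp (tendsto_atTop_add_const_right _ _ ?_)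
      exact (hsqrtLog.atTop_mul_const hρ).atTop_div_const (by norm_num)
    have hlim : Tendsto (fun n => 1 - ((p n + (8960 / C ^ 2 + 4 / C + 64 / C ^ 2) *
        (√(Real.log (m n)))⁻¹ +
        11520 / C * (ε n * (m n : ℝ) ^ max (η n - γ n) 0 * √(Real.log (m n)))) +
        (p n + 8960 / C ^ 2 * (√(Real.log (m n)))⁻¹ +
        5760 / C * (ε n * (m n : ℝ) ^ max (η n - γ n) 0 * √(Real.log (m n))) +
        16 / ε₁ * normalTail (√(Real.log (m n)) * ρ / 3 - 2)))) atTop (𝓝 1) := by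
      have := (((hp.add (hinv.const_mul (8960 / C ^ 2 + 4 / C + 64 / C ^ 2))).add
        (hν.const_mul (11520 / C))).add (((hp.add (hinv.const_mul (8960 / C ^ 2))).add
        (hν.const_mul (5760 / C))).add (htail.const_mul (16 / ε₁)))).const_sub 1
      simpa using this
    refine tendsto_of_tendsto_of_tendsto_of_le_of_le' hlim tendsto_const_nhds ?_
      (Eventually.of_forall fun n => measureReal_le_one)
    filter_upwards [hm2, hν4, hshift, hCle, hgrowth (ρ / 8) (by positivity), hsig,
      he.eventually_lt_const one_pos, hsqrtLog.eventually_ge_atTop 5,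
      hsqrtLog.eventually_gt_atTop (2 / C), hsm.eventually_le_const (show 0 < ε₁ / 4 by positivity)]
      with n h1 h2 h3 h4 h5 h6 h7 h8 h9 h10
    have hCL : 2 < C * √(Real.log (m n)) := by
      rwa [div_lt_iff₀' hC] at h9
    have hO : 1 ≤ COne n * √(Real.log (m n)) := by
      have := mul_le_mul_of_nonneg_right h4.2 (Real.sqrt_nonneg (Real.log (m n)))
      linarith
    have hup := (M n).measureReal_proportion_le_adaptiveEstimator_le (h := h) h1 (hγ n).1
      (hsample n).law_K (hπ n) (hdep n) (hε n) h2 h3 h7 hC h4.1 h4.2 hCL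
    have hlo := (M n).measureReal_adaptiveEstimator_le_le (h := h) h1 (hγ n).1 (hγ n).2
      (hsample n).law_K (hπ n) (hdep n) (hε n) h2 h3 h7 hC h4.1 hO h8 hρ hρ1 hε₁
      (min_le_right _ _) h5.1 h5.2 h10 (by linarith [min_le_left (ρ₀ / 2) 1])
    refine le_trans (le_of_eq ?_) (one_sub_le_measureReal (fun ω hω => ?_)
      ((measureReal_union_le _ _).trans (add_le_add hup hlo)))
    · simp only [div_eq_mul_inv]
    · simp only [mem_union, not_or, mem_ofPred_eq, not_le] at hω ⊢
      refine ⟨lt_of_le_of_lt ?_ hω.2, hω.1⟩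
      have := min_le_left ε' 1
      gcongr
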